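/- Let $X$ be a compact smooth $4$-manifold (Hausdorff, without boundary) and let $E\to X$ be a smooth oriented Euclidean vector bundle of rank $3$ (an $\mathrm{SO}(3)$-bundle). Let $\mathcal A_E$ be the affine space of metric connections in $E$, modelled on $\Omega^1(X,\mathfrak{so}(E))$. A connection $A\in\mathcal A_E$ is called definite if its curvature is non-zero on every tangent $2$-plane, i.e. $F_A(u,v)\neq 0$ for all linearly independent $u,v\in T_xX$ and all $x\in X$. Let $\mathcal D\subset\mathcal A_E$ be the set of definite connections; it is open in the $C^\infty$ topology, and $T_A\mathcal D=\Omega^1(X,\mathfrak{so}(E))$. Let $\pi\colon Z\to X$ be the unit sphere bundle of $E$ (a compact manifold of dimension $2n=6$) and let $V=\ker d\pi\to Z$ be its vertical tangent bundle, with fibre $V_z=z^\perp\subset E_{\pi(z)}$. The metric of $E$ and the orientation of its fibres make $V$ a Hermitian line bundle, multiplication by $i$ being the positive rotation by $\pi/2$. For $A\in\mathcal A_E$ write $TZ=V\oplus H_A$, where $H_A$ is the $A$-horizontal distribution. The induced connection $A_V$ in $V$ is defined as follows: in vertical directions it is the Levi-Civita connection of the round unit spheres $Z_x$, and in the direction of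 an $A$-horizontal vector $u$ it is the derivative of sections of $V$ with respect to the trivialisation of $V$ along an $A$-horizontal path with velocity $u$ that is given by $A$-parallel transport. Let $\mathcal S$ be the set of unitary connections $B$ in $V$ for which $\omega_B=\frac{i}{2\pi}F_B$ is a symplectic form on $Z$. Its tangent spaces are identified with $T_B\mathcal S=\Omega^1(Z,\mathbb R)$, a real $1$-form $a$ corresponding to the tangent vector $-2\pi i\,a\in\Omega^1(Z,i\mathbb R)$, so that the derivative of $\omega_B$ in the direction $a$ is $da$. For $B\in\mathcal S$ and $a,b\in\Omega^1(Z,\mathbb R)$ let $$\Omega_B(a,b)=\frac{1}{2!}\int_Z a\wedge b\wedge\omega_B^2 ,$$ where $Z$ is oriented by $\omega_B^3$. Then, for every $A\in\mathcal A_E$, the connection $A_V$ is a (smooth) unitary connection in $V$; if $A\in\mathcal D$, then $A_V\in\mathcal S$; and the map $\mathcal D\to\mathcal S$, $A\mapsto A_V$, is an embedding with isotropic image. In detail: 1. $A\mapsto A_V$ is a homeomorphism of $\mathcal D$ onto its image in $\mathcal S$, for the $C^\infty$ topologies. 2. For every $A\in\mathcal D$ the differential $L_A\colon\Omega^1(X,\mathfrak{so}(E))\to\Omega^1(Z,\mathbb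 R)$ of this map, which sends $a$ to the velocity at $r=0$ of the curve $r\mapsto (A+ra)_V$, exists and is injective. 3. For every $A\in\mathcal D$ and all $a,b\in\Omega^1(X,\mathfrak{so}(E))$, $$\Omega_{A_V}(L_A a,\,L_A b)=0 .$$ -/

import Mathlib

noncomputable section

namespace Definite

open Bundle Manifold ContDiff Topology Metric Set Module
open scoped RealInnerProductSpace

set_option linter.unusedSectionVars false

/-- The model spaces of `X` and of the 2-sphere, the model fibre of `E`, and the 2-sphere. -/
abbrev Coord4 := EuclideanSpace ℝ (Fin 4)
abbrev Coord2 := EuclideanSpace ℝ (Fin 2)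
abbrev Fib := EuclideanSpace ℝ (Fin 3)
abbrev S2 := sphere (0 : Fib) 1

section Sphere
variable {X : Type*} [TopologicalSpace X] [ChartedSpace Coord4 X]
  (E : X → Type*) [TopologicalSpace (TotalSpace Fib E)]
  [∀ x, NormedAddCommGroup (E x)] [∀ x, InnerProductSpace ℝ (E x)]
  [FiberBundle Fib E] [VectorBundle ℝ Fib E]

/-- The unit sphere bundle `Z` of `E`, as a subspace of the total space of `E`. -/
def SphereBundle : Type _ := {p : TotalSpace Fib E // ‖p.2‖ = 1}

instance : TopologicalSpace (SphereBundle E) :=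
  inferInstanceAs (TopologicalSpace {p : TotalSpace Fib E // ‖p.2‖ = 1})

variable {E}

/-- The projection `π : Z → X`. -/
def SphereBundle.proj (z : SphereBundle E) : X := z.1.proj

/-- A point `z` of `Z`, as a unit vector in the fibre of `E` over `π z`. -/
def SphereBundle.vec (z : SphereBundle E) : E z.proj := z.1.2

theorem SphereBundle.norm_vec (z : SphereBundle E) : ‖z.vec‖ = 1 := z.2

theorem exists_unit (x : X) : ∃ w : E x, ‖w‖ = 1 := by
  have e := VectorBundle.continuousLinearEquivAt ℝ Fib E x
  have : Nontrivial (E x) := e.toEquiv.nontrivial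
  exact exists_norm_eq (E x) zero_le_one

open scoped Classical in
/-- The unit vector `w / ‖w‖` (an arbitrary unit vector of `E x` if `w = 0`). -/
def unitVec {x : X} (w : E x) : E x :=
  if w = 0 then (exists_unit x).choose else ‖w‖⁻¹ • w

theorem norm_unitVec {x : X} (w : E x) : ‖unitVec w‖ = 1 := by
  unfold unitVec
  split_ifs with h
  · exact (exists_unit x).choose_spec
  · simpa using norm_smul_inv_norm (𝕜 := ℝ) h

/-- The point `w / ‖w‖` of the unit sphere of `E x`. -/
def toSphere {x : X} (w : E x) : SphereBundle E := ⟨⟨x, unitVec w⟩, norm_unitVec w⟩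

theorem toSphere_val {x : X} {w : E x} (h : w ≠ 0) : (toSphere w).1 = ⟨x, ‖w‖⁻¹ • w⟩ := by
  simp [toSphere, unitVec, h]

theorem toSphere_vec (z : SphereBundle E) (c : ℝ) (hc : 0 < c) : toSphere (c • z.vec) = z := by
  have hz : z.vec ≠ 0 := by
    intro h; simpa [h] using z.norm_vec
  apply Subtype.ext
  rw [toSphere_val (smul_ne_zero hc.ne' hz), norm_smul, z.norm_vec, smul_smul]
  simp only [Real.norm_eq_abs, abs_of_pos hc, mul_one, inv_mul_cancel₀ hc.ne', one_smul]
  rfl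

open scoped Classical in
/-- Radial projection of the model fibre to the standard sphere. -/
def toS2 (w : Fib) : S2 :=
  if h : w = 0 then ⟨EuclideanSpace.single 0 1, by simp⟩
  else ⟨‖w‖⁻¹ • w, by simpa using norm_smul_inv_norm (𝕜 := ℝ) h⟩

theorem toS2_val {w : Fib} (h : w ≠ 0) : (toS2 w : Fib) = ‖w‖⁻¹ • w := by
  simp [toS2, h]

theorem toS2_smul (q : S2) (c : ℝ) (hc : 0 < c) : toS2 (c • (q : Fib)) = q := by
  have hq : ‖(q : Fib)‖ = 1 := norm_eq_of_mem_sphere q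
  have hz : (q : Fib) ≠ 0 := ne_zero_of_mem_unit_sphere q
  apply Subtype.ext
  rw [toS2_val (smul_ne_zero hc.ne' hz), norm_smul, hq, smul_smul]
  simp [abs_of_pos hc, hc.ne']

variable [IsContMDiffRiemannianBundle (𝓡 4) ∞ Fib E]

theorem triv_snd_ne (e : Trivialization Fib (π Fib E)) [MemTrivializationAtlas e]
    {z : SphereBundle E} (hz : z.1.proj ∈ e.baseSet) : (e z.1).2 ≠ 0 := by
  have h : z.1.2 ≠ 0 := by
    intro h; have := z.2; simp [h] at this
  have h2 : (e z.1).2 = e.continuousLinearEquivAt ℝ z.1.proj hz z.1.2 := rfl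
  rw [h2]
  exact fun h' => h ((e.continuousLinearEquivAt ℝ z.1.proj hz).map_eq_zero_iff.1 h')

theorem triv_symm_ne (e : Trivialization Fib (π Fib E)) [MemTrivializationAtlas e]
    {x : X} (hx : x ∈ e.baseSet) (q : S2) : e.symm x (q : Fib) ≠ 0 := by
  rw [← e.symmL_apply (R := ℝ) hx, ← e.symm_continuousLinearEquivAt_eq (R := ℝ) hx]
  exact fun h => ne_zero_of_mem_unit_sphere q
    ((e.continuousLinearEquivAt ℝ x hx).symm.map_eq_zero_iff.1 h)

theorem continuousOn_toS2 : ContinuousOn toS2 {0}ᶜ := by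
  rw [Topology.IsInducing.subtypeVal.continuousOn_iff]
  have : ContinuousOn (fun w : Fib => ‖w‖⁻¹ • w) {0}ᶜ := by
    refine ContinuousOn.smul (ContinuousOn.inv₀ continuous_norm.continuousOn ?_) continuousOn_id
    intro w hw; simpa using hw
  exact this.congr fun w hw => toS2_val hw

/-- The local trivialisation of `Z` induced by a local trivialisation of `E`. -/
def sphereTriv (e : Trivialization Fib (π Fib E)) [MemTrivializationAtlas e] :
    OpenPartialHomeomorph (SphereBundle E) (X × S2) where
  toFun z := (z.1.proj, toS2 (e z.1).2)
  invFun p := toSphere (e.symm p.1 (p.2 : Fib))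
  source := {z | z.1.proj ∈ e.baseSet}
  target := e.baseSet ×ˢ univ
  map_source' z hz := ⟨hz, mem_univ _⟩
  map_target' p hp := by
    exact hp.1
  left_inv' z hz := by
    have h := triv_snd_ne e hz
    have h2 : e.symm z.1.proj ((e z.1).2) = z.vec := e.symm_proj_apply z.1 hz
    simp only
    rw [toS2_val h, ← e.symmL_apply (R := ℝ) hz, map_smul, e.symmL_apply (R := ℝ) hz, h2]
    exact toSphere_vec z _ (inv_pos.2 (norm_pos_iff.2 h))
  right_inv' := by
    rintro ⟨x, q⟩ ⟨hx, -⟩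
    have h := triv_symm_ne e hx q
    refine Prod.ext rfl ?_
    simp only
    rw [toSphere_val h]
    have : (e ⟨x, ‖e.symm x (q : Fib)‖⁻¹ • e.symm x (q : Fib)⟩).2
        = ‖e.symm x (q : Fib)‖⁻¹ • (q : Fib) := by
      rw [← e.symmL_apply (R := ℝ) hx, ← map_smul, e.symmL_apply (R := ℝ) hx,
        e.apply_mk_symm hx]
    rw [this]
    exact toS2_smul _ _ (inv_pos.2 (norm_pos_iff.2 h))
  open_source := by
    exact e.open_baseSet.preimage ((FiberBundle.continuous_proj Fib E).comp continuous_subtype_val)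
  open_target := e.open_baseSet.prod isOpen_univ
  continuousOn_toFun := by
    refine ContinuousOn.prodMk
      ((FiberBundle.continuous_proj Fib E).comp continuous_subtype_val).continuousOn ?_
    refine continuousOn_toS2.comp (t := {0}ᶜ) ?_ fun z hz => triv_snd_ne e hz
    refine continuous_snd.comp_continuousOn ?_
    refine e.continuousOn.comp continuous_subtype_val.continuousOn fun z hz => ?_
    rw [e.mem_source]; exact hz
  continuousOn_invFun := by
    refine (Topology.IsInducing.subtypeVal).continuousOn_iff.2 ?_
    have hq : ContinuousOn (fun p : X × S2 => (p.2 : Fib)) (e.baseSet ×ˢ univ) :=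
      (continuous_subtype_val.comp continuous_snd).continuousOn
    have h1 : ContinuousOn (fun p : X × S2 =>
        (⟨p.1, e.symm p.1 (p.2 : Fib)⟩ : TotalSpace Fib E)) (e.baseSet ×ˢ univ) :=
      e.continuousOn_symm.comp (continuousOn_fst.prodMk hq) fun p hp => ⟨hp.1, mem_univ _⟩
    have : IsContinuousRiemannianBundle Fib E := by
      obtain ⟨g, hg, h⟩ := IsContMDiffRiemannianBundle.exists_contMDiff (IB := 𝓡 4) (n := ∞)
        (F := Fib) (E := E)
      exact ⟨g, hg.continuous, h⟩
    have h2 : ContinuousOn (fun p : X × S2 => ‖e.symm p.1 (p.2 : Fib)‖) (e.baseSet ×ˢ univ) := by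
      have := h1.inner_bundle h1
      simp only [real_inner_self_eq_norm_sq] at this
      simpa using this.sqrt
    have h3 : ContinuousOn (fun p : X × S2 => (⟨p.1, e.symm p.1
        (‖e.symm p.1 (p.2 : Fib)‖⁻¹ • (p.2 : Fib))⟩ : TotalSpace Fib E)) (e.baseSet ×ˢ univ) := by
      refine e.continuousOn_symm.comp (continuousOn_fst.prodMk ?_) fun p hp => ⟨hp.1, mem_univ _⟩
      refine (h2.inv₀ fun p hp => ?_).smul hq
      exact norm_ne_zero_iff.2 (triv_symm_ne e hp.1 _)
    refine h3.congr fun p hp => ?_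
    simp only [Function.comp]
    rw [toSphere_val (triv_symm_ne e hp.1 _), ← e.symmL_apply (R := ℝ) hp.1,
      ← e.symmL_apply (R := ℝ) hp.1, map_smul]

instance : ChartedSpace (X × S2) (SphereBundle E) where
  atlas := {f | ∃ (e : Trivialization Fib (π Fib E)) (_ : MemTrivializationAtlas e),
    f = sphereTriv e}
  chartAt z := sphereTriv (trivializationAt Fib E z.1.proj)
  mem_chart_source z := FiberBundle.mem_baseSet_trivializationAt' z.1.proj
  chart_mem_atlas _ := ⟨_, inferInstance, rfl⟩

instance : ChartedSpace (ModelProd Coord4 Coord2) (SphereBundle E) :=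
  ChartedSpace.comp _ (X × S2) _


theorem contMDiffOn_toS2 : ContMDiffOn 𝓘(ℝ, Fib) (𝓡 2) ∞ toS2 {0}ᶜ := by
  intro w hw
  have : Fact (finrank ℝ Fib = 2 + 1) := ⟨by simp⟩
  let U : TopologicalSpace.Opens Fib := ⟨{0}ᶜ, isOpen_compl_singleton⟩
  have h : ContMDiff 𝓘(ℝ, Fib) (𝓡 2) ∞ (fun u : U => toS2 (u : Fib)) := by
    have hc : ContMDiff 𝓘(ℝ, Fib) 𝓘(ℝ, Fib) ∞ (fun u : U => ‖(u : Fib)‖⁻¹ • (u : Fib)) := by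
      intro u
      have hu : (u : Fib) ≠ 0 := u.2
      refine (contMDiffAt_subtype_iff (U := U) (f := fun w : Fib => ‖w‖⁻¹ • w)).2 ?_
      exact (((contDiffAt_norm ℝ hu).inv (norm_ne_zero_iff.2 hu)).smul contDiffAt_id).contMDiffAt
    have hn : ∀ u : U, ‖(u : Fib)‖⁻¹ • (u : Fib) ∈ sphere (0 : Fib) 1 := fun u => by
      simpa using norm_smul_inv_norm (𝕜 := ℝ) (show (u : Fib) ≠ 0 from u.2)
    have := hc.codRestrict_sphere (n := 2) hn
    refine this.congr fun u => ?_
    apply Subtype.ext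
    rw [toS2_val (show (u : Fib) ≠ 0 from u.2)]
    rfl
  exact ((contMDiffAt_subtype_iff (U := U) (f := toS2) (x := ⟨w, hw⟩)).1
    (h ⟨w, hw⟩)).contMDiffWithinAt

theorem toS2_smul' {w : Fib} (hw : w ≠ 0) {c : ℝ} (hc : 0 < c) : toS2 (c • w) = toS2 w := by
  apply Subtype.ext
  rw [toS2_val hw, toS2_val (smul_ne_zero hc.ne' hw), norm_smul, smul_smul]
  congr 1
  rw [Real.norm_eq_abs, abs_of_pos hc]
  field_simp

variable [IsManifold (𝓡 4) ∞ X] [ContMDiffVectorBundle ∞ Fib E (𝓡 4)]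

theorem contMDiffOn_sphereTriv (e e' : Trivialization Fib (π Fib E)) [MemTrivializationAtlas e]
    [MemTrivializationAtlas e'] :
    ContMDiffOn ((𝓡 4).prod (𝓡 2)) ((𝓡 4).prod (𝓡 2)) ∞
      ((sphereTriv e).symm.trans (sphereTriv e')) ((e.baseSet ∩ e'.baseSet) ×ˢ univ) := by
  have h : ContMDiffOn ((𝓡 4).prod (𝓡 2)) ((𝓡 4).prod (𝓡 2)) ∞
      (fun p : X × S2 => (p.1, toS2 (e.coordChangeL ℝ e' p.1 (p.2 : Fib))))
      ((e.baseSet ∩ e'.baseSet) ×ˢ univ) := by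
    refine contMDiffOn_fst.prodMk ?_
    refine contMDiffOn_toS2.comp (t := {0}ᶜ) ?_ fun p hp => ?_
    · refine ContMDiffOn.clm_apply (F₁ := Fib) (F₂ := Fib)
        ((contMDiffOn_coordChangeL e e').comp contMDiffOn_fst fun p hp => hp.1) ?_
      have : Fact (finrank ℝ Fib = 2 + 1) := ⟨by simp⟩
      exact (contMDiff_coe_sphere.comp contMDiff_snd).contMDiffOn
    · intro h0
      exact ne_zero_of_mem_unit_sphere p.2 ((e.coordChangeL ℝ e' p.1).map_eq_zero_iff.1 h0)
  refine h.congr ?_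
  rintro ⟨x, q⟩ ⟨hx, -⟩
  refine Prod.ext rfl ?_
  have hne := triv_symm_ne e hx.1 q
  change toS2 (e' (toSphere (e.symm x (q : Fib))).1).2 = _
  have h1 : (e' ⟨x, ‖e.symm x (q : Fib)‖⁻¹ • e.symm x (q : Fib)⟩).2
      = ‖e.symm x (q : Fib)‖⁻¹ • e.coordChangeL ℝ e' x (q : Fib) := by
    rw [e.coordChangeL_apply e' hx]
    exact (e'.continuousLinearEquivAt ℝ x hx.2).map_smul _ _
  rw [toSphere_val hne, h1]
  refine toS2_smul' (fun h0 => ?_) (inv_pos.2 (norm_pos_iff.2 hne))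
  exact ne_zero_of_mem_unit_sphere q ((e.coordChangeL ℝ e' x).map_eq_zero_iff.1 h0)

/-- The pregroupoid of smooth maps between open subsets of `X × S²`. -/
def smoothPregroupoid : Pregroupoid (X × S2) where
  property f s := ContMDiffOn ((𝓡 4).prod (𝓡 2)) ((𝓡 4).prod (𝓡 2)) ∞ f s
  comp {f g u v} hf hg _ _ _ := hg.comp' hf
  id_mem := contMDiffOn_id
  locality {f u} _ H x hx := by
    obtain ⟨v, hv, hxv, h⟩ := H x hx
    exact (h x ⟨hx, hxv⟩).mono_of_mem_nhdsWithin (inter_mem_nhdsWithin _ (hv.mem_nhds hxv))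
  congr {f g u} _ H hf := hf.congr H

instance : HasGroupoid (SphereBundle E) (smoothPregroupoid (X := X)).groupoid where
  compatible := by
    rintro _ _ ⟨e, he, rfl⟩ ⟨e', he', rfl⟩
    rw [mem_groupoid_of_pregroupoid]
    constructor
    · exact (contMDiffOn_sphereTriv e e').mono fun p hp => ⟨⟨hp.1.1, hp.2⟩, mem_univ _⟩
    · exact (contMDiffOn_sphereTriv e' e).mono fun p hp => ⟨⟨hp.1.1, hp.2⟩, mem_univ _⟩

/-- `Z` is a smooth 6-manifold. -/
instance : IsManifold ((𝓡 4).prod (𝓡 2)) ∞ (SphereBundle E) := by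
  refine { StructureGroupoid.HasGroupoid.comp (smoothPregroupoid (X := X)).groupoid ?_ with }
  intro e he
  rw [isLocalStructomorphOn_contDiffGroupoid_iff]
  exact (mem_groupoid_of_pregroupoid.1 he)

end Sphere

/-! ### Forms, symplectic forms and integration -/

section Forms
variable {EM : Type*} [NormedAddCommGroup EM] [NormedSpace ℝ EM] {HM : Type*} [TopologicalSpace HM]
  (I : ModelWithCorners ℝ EM HM) (M : Type*) [TopologicalSpace M] [ChartedSpace HM M]
  [IsManifold I ∞ M]

/-- Smooth vector fields. -/
abbrev VF := Cₛ^∞⟮I; EM, (TangentSpace I : M → Type _)⟯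

/-- Smooth differential forms of degree `k`. -/
@[ext]
structure SmoothForm (k : ℕ) where
  val : ∀ p : M, TangentSpace I p [⋀^Fin k]→ₗ[ℝ] ℝ
  smooth : ∀ U : Fin k → VF I M, ContMDiff I 𝓘(ℝ, ℝ) ∞ fun p => val p fun i => U i p

variable {I M}

/-- The directional derivative `U f`. -/
def lieD (U : VF I M) (f : M → ℝ) (p : M) : ℝ := mvfderiv I f p (U p)

/-- The exterior derivative `dκ` vanishes, by the invariant formula for `dκ(U, V, W)`. -/
def SmoothForm.IsClosed (κ : SmoothForm I M 2) : Prop :=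
  ∀ (U V W : VF I M) (p : M),
    lieD U (fun q => κ.val q ![V q, W q]) p - lieD V (fun q => κ.val q ![U q, W q]) p
      + lieD W (fun q => κ.val q ![U q, V q]) p
      - κ.val p ![VectorField.mlieBracket I U V p, W p]
      + κ.val p ![VectorField.mlieBracket I U W p, V p]
      - κ.val p ![VectorField.mlieBracket I V W p, U p] = 0

/-- Symplectic forms: closed non-degenerate 2-forms. -/
def SmoothForm.IsSymplectic (κ : SmoothForm I M 2) : Prop :=
  κ.IsClosed ∧ ∀ (p : M) (u : TangentSpace I p), (∀ v, κ.val p ![u, v] = 0) → u = 0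

/-- The wedge product (sum over shuffles). -/
def wedge {V : Type*} [AddCommGroup V] [Module ℝ V] {k l : ℕ}
    (α : V [⋀^Fin k]→ₗ[ℝ] ℝ) (β : V [⋀^Fin l]→ₗ[ℝ] ℝ) : V [⋀^Fin (k + l)]→ₗ[ℝ] ℝ :=
  ((LinearMap.mul' ℝ ℝ).compAlternatingMap (α.domCoprod β)).domDomCongr finSumFinEquiv

/-- The coefficient of the form `η` in the chart centred at `c`, with respect to the basis `b` of
the model space. -/
def coordCoeff {n : ℕ} (b : Basis (Fin n) ℝ EM)
    (η : ∀ p : M, TangentSpace I p [⋀^Fin n]→ₗ[ℝ] ℝ) (c : M) (y : EM) : ℝ :=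
  η ((extChartAt I c).symm y) fun i => mfderiv 𝓘(ℝ, EM) I (extChartAt I c).symm y (b i)

open scoped Classical in
/-- The integral over `M` of the form `η` of top degree, where `M` is oriented by the nowhere
vanishing form `θ` of top degree: charts are used with the sign of the coefficient of `θ`, and the
local integrals are summed by means of a partition of unity. -/
def integralForm [MeasureTheory.MeasureSpace EM] {n : ℕ} (b : Basis (Fin n) ℝ EM)
    (θ η : ∀ p : M, TangentSpace I p [⋀^Fin n]→ₗ[ℝ] ℝ) : ℝ :=
  if h : ∃ ρ : PartitionOfUnity M M, ρ.IsSubordinate fun c => (chartAt HM c).source then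
    ∑ᶠ c : M, ∫ y in (extChartAt I c).target,
      h.choose c ((extChartAt I c).symm y) * Real.sign (coordCoeff b θ c y) * coordCoeff b η c y
  else 0

/-- The `C^∞` topology on functions on a compact manifold: uniform convergence of all iterated
derivatives along smooth vector fields. -/
abbrev smoothTopology (I : ModelWithCorners ℝ EM HM) (M : Type*) [TopologicalSpace M]
    [ChartedSpace HM M] [IsManifold I ∞ M] : TopologicalSpace (M → ℝ) :=
  ⨅ L : List (VF I M), TopologicalSpace.induced
    (fun f => UniformFun.ofFun (L.foldr lieD f)) inferInstance

end Forms

/-! ### Connections -/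

section Connections
variable {X : Type*} [TopologicalSpace X] [ChartedSpace Coord4 X] [IsManifold (𝓡 4) ∞ X]
  (E : X → Type*) [TopologicalSpace (TotalSpace Fib E)]
  [∀ x, NormedAddCommGroup (E x)] [∀ x, InnerProductSpace ℝ (E x)]
  [FiberBundle Fib E] [VectorBundle ℝ Fib E] [ContMDiffVectorBundle ∞ Fib E (𝓡 4)]
  [IsContMDiffRiemannianBundle (𝓡 4) ∞ Fib E]

/-- Smooth sections of `E`. -/
abbrev Sec := Cₛ^∞⟮𝓡 4; Fib, E⟯

/-- A smooth orientation of the fibres of `E`, given by its unit volume form. -/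
structure FibreOrientation where
  vol : ∀ x, E x [⋀^Fin 3]→ₗ[ℝ] ℝ
  unit : ∀ (x : X) (b : OrthonormalBasis (Fin 3) ℝ (E x)), |vol x b| = 1
  smooth : ∀ σ : Fin 3 → Sec E, ContMDiff (𝓡 4) 𝓘(ℝ, ℝ) ∞ fun x => vol x fun i => σ i x

/-- Metric connections in `E`, as covariant derivatives `(σ, x, v) ↦ (∇_v σ)(x)` of smooth
sections. -/
@[ext]
structure MetricConnection where
  toFun : Sec E → ∀ x : X, TangentSpace (𝓡 4) x →ₗ[ℝ] E x
  add : ∀ σ τ x, toFun (σ + τ) x = toFun σ x + toFun τ x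
  leibniz : ∀ (f : X → ℝ) (σ τ : Sec E), ContMDiff (𝓡 4) 𝓘(ℝ, ℝ) ∞ f → (∀ x, τ x = f x • σ x) →
    ∀ x v, toFun τ x v = f x • toFun σ x v + mvfderiv (𝓡 4) f x v • σ x
  metric : ∀ (σ τ : Sec E) x v,
    mvfderiv (𝓡 4) (fun y => ⟪σ y, τ y⟫) x v = ⟪toFun σ x v, τ x⟫ + ⟪σ x, toFun τ x v⟫
  smooth : ∀ (σ : Sec E) (U : VF (𝓡 4) X), ContMDiff (𝓡 4) ((𝓡 4).prod 𝓘(ℝ, Fib)) ∞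
    fun x => (⟨x, toFun σ x (U x)⟩ : TotalSpace Fib E)

/-- `1`-forms on `X` with values in the bundle of skew-symmetric endomorphisms of `E`. -/
@[ext]
structure SoForm where
  toFun : ∀ x : X, E x →ₗ[ℝ] TangentSpace (𝓡 4) x →ₗ[ℝ] E x
  skew : ∀ x v w w', ⟪toFun x w v, w'⟫ = -⟪w, toFun x w' v⟫
  smooth : ∀ (U : VF (𝓡 4) X) (σ : Sec E), ContMDiff (𝓡 4) ((𝓡 4).prod 𝓘(ℝ, Fib)) ∞
    fun x => (⟨x, toFun x (σ x) (U x)⟩ : TotalSpace Fib E)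

variable {E}

namespace MetricConnection

/-- The connection `A + r a`. -/
def translate (A : MetricConnection E) (r : ℝ) (a : SoForm E) : MetricConnection E where
  toFun σ x := A.toFun σ x + r • a.toFun x (σ x)
  add σ τ x := by
    rw [A.add, show (σ + τ) x = σ x + τ x from rfl, (a.toFun x).map_add, smul_add]
    abel
  leibniz f σ τ hf h x v := by
    change A.toFun τ x v + r • a.toFun x (τ x) v
      = f x • (A.toFun σ x v + r • a.toFun x (σ x) v) + _
    rw [A.leibniz f σ τ hf h x v, h x, (a.toFun x).map_smul, LinearMap.smul_apply]
    module
  metric σ τ x v := by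
    change _ = ⟪A.toFun σ x v + r • a.toFun x (σ x) v, τ x⟫
      + ⟪σ x, A.toFun τ x v + r • a.toFun x (τ x) v⟫
    rw [A.metric σ τ x v, inner_add_left, inner_add_right, real_inner_smul_left,
      real_inner_smul_right, a.skew x v (σ x)]
    ring
  smooth σ U := (A.smooth σ U).add_section (a.smooth U σ).const_smul_section

/-- The section `∇_U σ`. -/
def cov (A : MetricConnection E) (U : VF (𝓡 4) X) (σ : Sec E) : Sec E :=
  ⟨fun x => A.toFun σ x (U x), A.smooth σ U⟩

/-- The curvature `F_A(U, W) σ` at `x`. -/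
def curvature (A : MetricConnection E) (U W : VF (𝓡 4) X) (σ : Sec E) (x : X) : E x :=
  A.cov U (A.cov W σ) x - A.cov W (A.cov U σ) x
    - A.toFun σ x (VectorField.mlieBracket (𝓡 4) U W x)

/-- Definite connections: the curvature is non-zero on every tangent 2-plane. -/
def IsDefinite (A : MetricConnection E) : Prop :=
  ∀ (U W : VF (𝓡 4) X) (x : X), LinearIndependent ℝ ![U x, W x] → ∃ σ, A.curvature U W σ x ≠ 0

instance : TopologicalSpace (MetricConnection E) :=
  ⨅ (U : VF (𝓡 4) X) (σ : Sec E) (τ : Sec E), TopologicalSpace.induced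
    (fun A x => ⟪A.toFun σ x (U x), τ x⟫) (smoothTopology (𝓡 4) X)

end MetricConnection

/-- The model with corners of the 6-manifold `Z`. -/
abbrev I6 := (𝓡 4).prod (𝓡 2)

variable (E) in
/-- Smooth sections of the vertical tangent bundle `V → Z`, whose fibre at `z` is the tangent space
at `z` of the unit sphere of `E (π z)`, i.e. the orthogonal complement of `z`. -/
@[ext]
structure VSection where
  toFun : ∀ z : SphereBundle E, E z.proj
  tangent : ∀ z, ⟪toFun z, z.vec⟫ = 0
  smooth : ContMDiff I6 ((𝓡 4).prod 𝓘(ℝ, Fib)) ∞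
    fun z => (⟨z.proj, toFun z⟩ : TotalSpace Fib E)

/-- The area form of the fibre of `V` at `z`, for the orientation of the sphere as the boundary of
the ball. If `J` denotes the positive rotation by a right angle (multiplication by `i`) then
`area z v w = ⟪J v, w⟫`. -/
def FibreOrientation.area (o : FibreOrientation E) (z : SphereBundle E) (v w : E z.proj) : ℝ :=
  o.vol z.proj ![z.vec, v, w]

/-- Unitary connections in the Hermitian line bundle `V`: the covariant derivative preserves the
real and the imaginary part of the Hermitian metric. -/
@[ext]
structure UnitaryConnection (o : FibreOrientation E) where
  toFun : VSection E → ∀ z : SphereBundle E, TangentSpace I6 z →ₗ[ℝ] E z.proj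
  tangent : ∀ s z v, ⟪toFun s z v, z.vec⟫ = 0
  add : ∀ s t u : VSection E, (∀ z, u.toFun z = s.toFun z + t.toFun z) →
    ∀ z, toFun u z = toFun s z + toFun t z
  leibniz : ∀ (f : SphereBundle E → ℝ) (s t : VSection E), ContMDiff I6 𝓘(ℝ, ℝ) ∞ f →
    (∀ z, t.toFun z = f z • s.toFun z) →
    ∀ z v, toFun t z v = f z • toFun s z v + mvfderiv I6 f z v • s.toFun z
  metric : ∀ (s t : VSection E) z v, mvfderiv I6 (fun y => ⟪s.toFun y, t.toFun y⟫) z v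
    = ⟪toFun s z v, t.toFun z⟫ + ⟪s.toFun z, toFun t z v⟫
  area : ∀ (s t : VSection E) z v, mvfderiv I6 (fun y => o.area y (s.toFun y) (t.toFun y)) z v
    = o.area z (toFun s z v) (t.toFun z) + o.area z (s.toFun z) (toFun t z v)
  smooth : ∀ (s : VSection E) (U : VF I6 (SphereBundle E)),
    ContMDiff I6 ((𝓡 4).prod 𝓘(ℝ, Fib)) ∞
      fun z => (⟨z.proj, toFun s z (U z)⟩ : TotalSpace Fib E)

namespace UnitaryConnection
variable {o : FibreOrientation E}

/-- The section `∇_U s`. -/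
def cov (B : UnitaryConnection o) (U : VF I6 (SphereBundle E)) (s : VSection E) : VSection E :=
  ⟨fun z => B.toFun s z (U z), fun z => B.tangent s z (U z), B.smooth s U⟩

/-- The curvature `F_B(U, W) s` at `z`. -/
def curvature (B : UnitaryConnection o) (U W : VF I6 (SphereBundle E)) (s : VSection E)
    (z : SphereBundle E) : E z.proj :=
  (B.cov U (B.cov W s)).toFun z - (B.cov W (B.cov U s)).toFun z
    - B.toFun s z (VectorField.mlieBracket I6 U W z)

/-- `κ = (i / 2π) F_B`, i.e. `F_B = -2πi κ`. -/
def IsCurvatureForm (B : UnitaryConnection o) (κ : SmoothForm I6 (SphereBundle E) 2) : Prop :=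
  ∀ U W (s t : VSection E) z, ⟪B.curvature U W s z, t.toFun z⟫
    = -(2 * Real.pi) * κ.val z ![U z, W z] * o.area z (s.toFun z) (t.toFun z)

/-- `(i / 2π) F_B` is a symplectic form. -/
def IsSymplectic (B : UnitaryConnection o) : Prop :=
  ∃ κ, B.IsCurvatureForm κ ∧ κ.IsSymplectic

instance : TopologicalSpace (UnitaryConnection o) :=
  ⨅ (U : VF I6 (SphereBundle E)) (s : VSection E) (t : VSection E), TopologicalSpace.induced
    (fun B z => ⟪B.toFun s z (U z), t.toFun z⟫) (smoothTopology I6 (SphereBundle E))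

/-- The curve `γ` of unitary connections has velocity `α` at time `0`. The `1`-form `α` corresponds
to the tangent vector `-2πi α`, so that `dα` is the derivative of `κ` in this direction. -/
def HasVelocity (γ : ℝ → UnitaryConnection o) (α : SmoothForm I6 (SphereBundle E) 1) : Prop :=
  ∀ (s t : VSection E) z v, HasDerivAt (fun r => ⟪(γ r).toFun s z v, t.toFun z⟫)
    (-(2 * Real.pi) * α.val z ![v] * o.area z (s.toFun z) (t.toFun z)) 0

end UnitaryConnection

/-! ### The induced connection -/

/-- The covariant derivative `(π^*∇)_v s` at `z`, where `s` is a section of `π^*E`: if `σ` is a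
section of `E` with `σ (π z) = s z` then `s - π^*σ` vanishes at `z`, so that it has a well-defined
derivative there, and `(π^*∇)_v s` is the sum of this derivative and of `∇_{dπ v} σ`. -/
def pullbackDeriv (A : MetricConnection E) (s : ∀ z : SphereBundle E, E z.proj)
    (z : SphereBundle E) (v : TangentSpace I6 z) : E z.proj :=
  let e := trivializationAt Fib E z.proj
  let σ : Sec E := Classical.epsilon fun σ : Sec E => σ z.proj = s z
  e.symm z.proj (mvfderiv I6 (fun y => (e ⟨y.proj, s y - σ y.proj⟩).2) z v)
    + A.toFun σ z.proj (mfderiv I6 (𝓡 4) SphereBundle.proj z v)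

/-- A curve through `z` in the unit sphere of `E (π z)`, with velocity `ν` if `ν` is orthogonal
to `z`. -/
def fibreCurve (z : SphereBundle E) (ν : E z.proj) (t : ℝ) : SphereBundle E :=
  toSphere (z.vec + t • ν)

/-- A vector `ν` in the fibre of `V` at `z`, as a tangent vector of `Z`. -/
def fibreVector (z : SphereBundle E) (ν : E z.proj) : TangentSpace I6 z :=
  (mfderiv 𝓘(ℝ, ℝ) I6 (fibreCurve z ν) 0 (1 : ℝ) : Coord4 × Coord2)

/-- The Levi-Civita covariant derivative on the unit sphere of `E (π z)`: the tangential part of the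
derivative of `s` in the Euclidean space `E (π z)`. -/
def sphereLC (s : ∀ z : SphereBundle E, E z.proj) (z : SphereBundle E) (ν : E z.proj) : E z.proj :=
  let d : E z.proj := deriv (F := E z.proj) (fun t : ℝ => s (fibreCurve z ν t)) 0
  d - ⟪z.vec, d⟫ • z.vec

/-- The covariant derivative `∇^{A_V}_v s`. The vertical part of `v` for the splitting
`TZ = V ⊕ H` given by `A` is the covariant derivative `ν` of the tautological section of `π^*E`.
On vertical vectors `A_V` is the Levi-Civita connection of the fibres; along `A`-horizontal vectors
it is the derivative of `s` with respect to parallel transport by `A`. -/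
def inducedDeriv (A : MetricConnection E) (s : ∀ z : SphereBundle E, E z.proj)
    (z : SphereBundle E) (v : TangentSpace I6 z) : E z.proj :=
  let ν := pullbackDeriv A SphereBundle.vec z v
  sphereLC s z ν + pullbackDeriv A s z (v - fibreVector z ν)

/-- `B` is the connection `A_V` in `V` induced by `A`. -/
def IsInduced {o : FibreOrientation E} (A : MetricConnection E) (B : UnitaryConnection o) : Prop :=
  ∀ (s : VSection E) z v, B.toFun s z v = inducedDeriv A s.toFun z v

/-! ### The two spaces of connections and the symplectic form -/

variable (E) in
/-- The space of definite connections. -/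
abbrev DefiniteSpace := {A : MetricConnection E // A.IsDefinite}

/-- The space of unitary connections in `V` with symplectic curvature. -/
abbrev SymplecticSpace (o : FibreOrientation E) := {B : UnitaryConnection o // B.IsSymplectic}

/-- The symplectic form `κ_B`. -/
def SymplecticSpace.omega {o : FibreOrientation E} (B : SymplecticSpace o) :
    SmoothForm I6 (SphereBundle E) 2 := B.2.choose

/-- The standard basis of the model space of `Z`. -/
def basis6 : Basis (Fin 6) ℝ (Coord4 × Coord2) :=
  ((EuclideanSpace.basisFun (Fin 4) ℝ).toBasis.prod
    (EuclideanSpace.basisFun (Fin 2) ℝ).toBasis).reindex finSumFinEquiv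

/-- `Ω_B(α, β) = 1 / (n - 1)! ∫_Z α ∧ β ∧ κ_B ^ (n - 1)` with `n = 3`, where `Z` is oriented by
`κ_B ^ n`. -/
def SymplecticSpace.Omega {o : FibreOrientation E} (B : SymplecticSpace o)
    (α β : SmoothForm I6 (SphereBundle E) 1) : ℝ :=
  let κ := B.omega.val
  (1 / (Nat.factorial 2 : ℝ)) * integralForm basis6
    (fun z => wedge (κ z) (wedge (κ z) (κ z)))
    (fun z => wedge (α.val z) (wedge (β.val z) (wedge (κ z) (κ z))))

end Connections

end Definite
end

open Bundle Manifold ContDiff Definite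

/-!
Let `π : Z → X` be the unit sphere bundle of `E`. Its vertical tangent bundle `V` is the subbundle
`z^⊥` of `π^*E`, and the induced connection `A_V` is the orthogonal projection to `V` of the pulled
back connection `π^*∇` (`inducedDeriv_eq`). Hence it can be studied with sections of `π^*E` and
directional derivatives alone. All computations use finite global families that span the tangent
spaces and the fibres of `E` with smooth coefficients (`TangentFrame`, `BundleFrame`); they take the
place of local coordinates.

*The form `ω` is symplectic.* By the Gauss equation (`inner_curvature_induced`) the curvature of
`A_V` at `z` is, up to constant factors, the component of `F_A` along the rotation of `z^⊥` plus
the area form of the fibre evaluated on the vertical parts. It is closed by the Bianchi identity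
(`IsCurvatureForm.isClosed`). The area form is non-degenerate on `V` and the remaining term is
horizontal, so non-degeneracy means that `u ↦ (w ↦ ⟪F_A(u, w) e, e'⟫)` is injective for every
orthonormal pair `e, e'` of a fibre of `E`. If `u ≠ 0` were in the kernel, two linear conditions on
`w` would be left for `F_A(u, w)` to vanish, and on a four-dimensional space they have a solution
independent of `u`, against definiteness (`eq_zero_of_isDefinite`,
`isSymplectic_inducedConnection`).

*The map is an embedding.* `A ↦ A_V` is affine, and its velocity in the direction `a` at `z` is,
up to a constant factor, the component of `π^*a` along the rotation of `z^⊥`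
(`inner_eq_velocityVal`). Since `z` runs through all directions of a fibre, `a` can be recovered
(`velocity_injective`). The same formula compares the topologies: if the differences of connections
converge to zero on `X` with all derivatives, so do their pull-backs to `Z` (`smoothZero_lift`).
Conversely, where two sections `σ` and `τ` of `E` are independent, they are orthogonal to the
direction of their cross product, which is a local section of `Z`; along it the data on `Z` restrict to `⟪a(U) σ, τ⟫` (`smoothZero_mul_inner`,
`smoothZero_descend`, `isEmbedding_inducedConnection`).

*The image is isotropic.* The antipodal map of the fibres reverses the rotation of `z^⊥`. The
curvature form `κ` and the velocities are therefore anti-invariant (`isEigenform_kappaVal`,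
`isEigenform_velocity`), so that `κ ∧ κ ∧ κ`, which orients `Z`, changes sign, whereas
`L a ∧ L b ∧ κ ∧ κ` is preserved. An orientation reversing diffeomorphism that preserves a form of
top degree forces its integral to vanish (`integralForm_eq_zero`, `omega_velocity_eq_zero`).
-/

noncomputable section

namespace Definite

open Bundle Manifold ContDiff Topology Metric Set Module
open scoped RealInnerProductSpace

set_option linter.unusedSectionVars false

/-! ### Calculus of directional derivatives -/

section Calculus

theorem two_le_infty : (2 : WithTop ℕ∞) ≤ ∞ := WithTop.coe_le_coe.2 (le_top : (2 : ℕ∞) ≤ ⊤)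

variable {EM : Type*} [NormedAddCommGroup EM] [NormedSpace ℝ EM] {HM : Type*} [TopologicalSpace HM]
  {I : ModelWithCorners ℝ EM HM} {M : Type*} [TopologicalSpace M] [ChartedSpace HM M]

variable (I) in
/-- Smooth real functions on a manifold. -/
abbrev IsSmooth (f : M → ℝ) : Prop := ContMDiff I 𝓘(ℝ, ℝ) ∞ f

theorem IsSmooth.mdiffAt {f : M → ℝ} (hf : IsSmooth I f) (p : M) :
    MDifferentiableAt I 𝓘(ℝ, ℝ) f p :=
  (hf p).mdifferentiableAt (by simp)

theorem isSmooth_const (c : ℝ) : IsSmooth I (fun _ : M => c) := contMDiff_const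

theorem IsSmooth.add {f g : M → ℝ} (hf : IsSmooth I f) (hg : IsSmooth I g) :
    IsSmooth I fun p => f p + g p := ContMDiff.add hf hg

theorem IsSmooth.sub {f g : M → ℝ} (hf : IsSmooth I f) (hg : IsSmooth I g) :
    IsSmooth I fun p => f p - g p := ContMDiff.sub hf hg

theorem IsSmooth.neg {f : M → ℝ} (hf : IsSmooth I f) : IsSmooth I fun p => -f p :=
  ContMDiff.neg hf

theorem IsSmooth.mul {f g : M → ℝ} (hf : IsSmooth I f) (hg : IsSmooth I g) :
    IsSmooth I fun p => f p * g p := ContMDiff.mul hf hg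

theorem IsSmooth.sum {ι : Type*} {s : Finset ι} {f : ι → M → ℝ}
    (hf : ∀ i ∈ s, IsSmooth I (f i)) : IsSmooth I fun p => ∑ i ∈ s, f i p :=
  contMDiff_finsetSum hf

theorem IsSmooth.inv {f : M → ℝ} (hf : IsSmooth I f) (h0 : ∀ p, f p ≠ 0) :
    IsSmooth I fun p => (f p)⁻¹ := ContMDiff.inv₀ hf h0

variable {f g : M → ℝ} {p : M} {v : TangentSpace I p}

theorem dF_add (hf : MDifferentiableAt I 𝓘(ℝ, ℝ) f p) (hg : MDifferentiableAt I 𝓘(ℝ, ℝ) g p) :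
    mvfderiv I (fun q => f q + g q) p v = mvfderiv I f p v + mvfderiv I g p v := by
  rw [mvfderiv_fun_add hf hg]; rfl

theorem dF_sub (hf : MDifferentiableAt I 𝓘(ℝ, ℝ) f p) (hg : MDifferentiableAt I 𝓘(ℝ, ℝ) g p) :
    mvfderiv I (fun q => f q - g q) p v = mvfderiv I f p v - mvfderiv I g p v := by
  rw [mvfderiv_fun_sub hf hg]; rfl

theorem dF_neg : mvfderiv I (fun q => -f q) p v = -mvfderiv I f p v := by
  rw [mvfderiv_fun_neg]; rfl

theorem dF_mul (hf : MDifferentiableAt I 𝓘(ℝ, ℝ) f p) (hg : MDifferentiableAt I 𝓘(ℝ, ℝ) g p) :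
    mvfderiv I (fun q => f q * g q) p v = f p * mvfderiv I g p v + mvfderiv I f p v * g p := by
  rw [mvfderiv_fun_mul hf hg]; simp [mul_comm]

theorem dF_const (c : ℝ) : mvfderiv I (fun _ : M => c) p v = 0 := by
  rw [mvfderiv_const]; rfl

theorem dF_congr {F : Type*} [NormedAddCommGroup F] [NormedSpace ℝ F] {f g : M → F}
    (h : f =ᶠ[𝓝 p] g) : mvfderiv I f p v = mvfderiv I g p v := by
  unfold mvfderiv
  simp only [ContinuousLinearMap.comp_apply]
  rw [h.mfderiv_eq]
  rfl

theorem dF_sum {F : Type*} [NormedAddCommGroup F] [NormedSpace ℝ F] {ι : Type*} {s : Finset ι}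
    {f : ι → M → F} (hf : ∀ i ∈ s, MDifferentiableAt I 𝓘(ℝ, F) (f i) p) :
    mvfderiv I (fun q => ∑ i ∈ s, f i q) p v = ∑ i ∈ s, mvfderiv I (f i) p v := by
  classical
  have h : MDifferentiableAt I 𝓘(ℝ, F) (fun q => ∑ i ∈ s, f i q) p ∧
      mvfderiv I (fun q => ∑ i ∈ s, f i q) p v = ∑ i ∈ s, mvfderiv I (f i) p v := by
    induction s using Finset.induction_on with
    | empty =>
      simp only [Finset.sum_empty]
      exact ⟨mdifferentiableAt_const, by rw [mvfderiv_const]; rfl⟩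
    | insert i s hi ih =>
      obtain ⟨h1, h2⟩ := ih fun j hj => hf j (by simp [hj])
      simp only [Finset.sum_insert hi]
      refine ⟨(hf i (by simp)).add h1, ?_⟩
      rw [mvfderiv_fun_add (hf i (by simp)) h1, ← h2]
      rfl
  exact h.2

theorem dF_comp {EN HN N : Type*} [NormedAddCommGroup EN] [NormedSpace ℝ EN] [TopologicalSpace HN]
    {J : ModelWithCorners ℝ EN HN} [TopologicalSpace N] [ChartedSpace HN N] {g : N → ℝ} {φ : M → N}
    (hg : MDifferentiableAt J 𝓘(ℝ, ℝ) g (φ p)) (hφ : MDifferentiableAt I J φ p) :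
    mvfderiv I (g ∘ φ) p v = mvfderiv J g (φ p) (mfderiv I J φ p v) :=
  mfderiv_comp_apply p hg hφ v

theorem mvfderiv_model {f : EM → ℝ} (x : EM) (w : EM) :
    mvfderiv 𝓘(ℝ, EM) f x w = fderiv ℝ f x w := by
  change mfderiv 𝓘(ℝ, EM) 𝓘(ℝ, ℝ) f x w = _
  rw [mfderiv_eq_fderiv]
  rfl

variable [IsManifold I ∞ M]

theorem IsSmooth.lieD {f : M → ℝ} (hf : IsSmooth I f) (U : VF I M) : IsSmooth I (lieD U f) := by
  have h1 := (ContMDiff.contMDiff_tangentMap (m := ∞) hf (by simp)).comp U.contMDiff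
  exact (contMDiff_snd_tangentBundle_modelSpace ℝ 𝓘(ℝ, ℝ)).comp h1

theorem lieD_add {f g : M → ℝ} (hf : IsSmooth I f) (hg : IsSmooth I g) (U : VF I M) :
    lieD U (fun p => f p + g p) = fun p => lieD U f p + lieD U g p := by
  funext p; exact dF_add (hf.mdiffAt p) (hg.mdiffAt p)

theorem lieD_mul {f g : M → ℝ} (hf : IsSmooth I f) (hg : IsSmooth I g) (U : VF I M) :
    lieD U (fun p => f p * g p) = fun p => f p * lieD U g p + lieD U f p * g p := by
  funext p; exact dF_mul (hf.mdiffAt p) (hg.mdiffAt p)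

/-- The Lie bracket as a smooth vector field. -/
def bracket [CompleteSpace EM] (U V : VF I M) : VF I M :=
  ⟨VectorField.mlieBracket I U V, by
    have h2 : IsManifold I (minSmoothness ℝ 2) M :=
      IsManifold.of_le (n := ∞) (by simpa using two_le_infty)
    have h3 : IsManifold I (((⊤ : ℕ∞) : WithTop ℕ∞) + 1) M :=
      IsManifold.of_le (n := ∞) (by simp)
    exact ContDiff.mlieBracket_vectorField (n := (⊤ : ℕ∞)) (m := (⊤ : ℕ∞))
      U.contMDiff V.contMDiff (by simp)⟩

/-- Multiplication of a vector field by a smooth function. -/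
def VF.mul (f : M → ℝ) (hf : IsSmooth I f) (U : VF I M) : VF I M :=
  ⟨f • (U : ∀ p, TangentSpace I p), ContMDiff.smul_section hf U.contMDiff⟩

@[simp]
theorem VF.mul_apply (f : M → ℝ) (hf : IsSmooth I f) (U : VF I M) (p : M) :
    VF.mul f hf U p = f p • U p := rfl

theorem VF.sum_apply {ι : Type*} (s : Finset ι) (Y : ι → VF I M) (p : M) :
    (∑ i ∈ s, Y i) p = ∑ i ∈ s, Y i p := by
  have := map_sum (ContMDiffSection.coeAddHom I EM ∞ (TangentSpace I : M → Type _)) Y s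
  exact (congrFun this p).trans (Finset.sum_apply p s _)

end Calculus

/-! ### Global frames -/

section Frames
variable {EM : Type*} [NormedAddCommGroup EM] [NormedSpace ℝ EM] {HM : Type*} [TopologicalSpace HM]
  (I : ModelWithCorners ℝ EM HM) (M : Type*) [TopologicalSpace M] [ChartedSpace HM M]
  [IsManifold I ∞ M]

/-- A finite family of vector fields `field i` and functions `coord i` on `M` such that
`v = ∑ i, d(coord i)(v) • field i` for all tangent vectors `v`. -/
structure TangentFrame where
  n : ℕ
  field : Fin n → VF I M
  coord : Fin n → M → ℝ
  smooth : ∀ i, IsSmooth I (coord i)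
  sum_eq : ∀ (p : M) (v : TangentSpace I p), ∑ i, mvfderiv I (coord i) p v • field i p = v

variable {I M}

/-- If every point `c` has a smooth non-negative function `g c` that is positive at `c`, then
finitely many of these functions have a positive sum. -/
theorem exists_finset_sum_pos [CompactSpace M] (g : M → M → ℝ) (hg : ∀ c, Continuous (g c))
    (h0 : ∀ c p, 0 ≤ g c p) (h1 : ∀ c, 0 < g c c) :
    ∃ t : Finset M, ∀ p, 0 < ∑ c ∈ t, g c p := by
  obtain ⟨t, ht⟩ := isCompact_univ.elim_finite_subcover (fun c => {p | 0 < g c p})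
    (fun c => isOpen_lt continuous_const (hg c)) (fun p _ => mem_iUnion.2 ⟨p, h1 p⟩)
  refine ⟨t, fun p => ?_⟩
  obtain ⟨c, hc⟩ := mem_iUnion.1 (ht (mem_univ p))
  obtain ⟨hc, hp⟩ := mem_iUnion.1 hc
  exact Finset.sum_pos' (fun d _ => h0 d p) ⟨c, hc, hp⟩

variable [FiniteDimensional ℝ EM] [T2Space M]

theorem exists_bump {c : M} {u : Set M} (hu : u ∈ 𝓝 c) :
    ∃ g : M → ℝ, IsSmooth I g ∧ (∀ p, 0 ≤ g p) ∧ g =ᶠ[𝓝 c] 1 ∧ tsupport g ⊆ u := by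
  obtain ⟨f, hf, -⟩ := (SmoothBumpFunction.nhds_basis_support (I := I) hu).mem_iff.1
    (Filter.univ_mem)
  exact ⟨f, f.contMDiff, fun p => f.nonneg, f.eventuallyEq_one, hf⟩

/-- The local existence of a frame near `c`, multiplied by a bump function `g`. The coordinate
functions are cut off by a bump function that is `1` on a neighbourhood of the support of `g`. -/
theorem exists_local_tangentFrame (c : M) :
    ∃ (g : M → ℝ) (Y : Fin (finrank ℝ EM) → VF I M) (H : Fin (finrank ℝ EM) → M → ℝ),
      IsSmooth I g ∧ (∀ p, 0 ≤ g p) ∧ 0 < g c ∧ (∀ i, IsSmooth I (H i)) ∧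
      ∀ (p : M) (v : TangentSpace I p), ∑ i, mvfderiv I (H i) p v • Y i p = g p • v := by
  have : IsManifold I 1 M := IsManifold.of_le (n := ∞) (by simp)
  let b := finBasis ℝ EM
  let e := trivializationAt EM (TangentSpace I : M → Type _) c
  have hsrc : e.baseSet = (chartAt HM c).source := TangentBundle.trivializationAt_baseSet c
  obtain ⟨f, -⟩ := (SmoothBumpFunction.nhds_basis_support (I := I) (c := c)
    Filter.univ_mem).mem_iff.1 Filter.univ_mem
  have hf1 : {p | f =ᶠ[𝓝 p] 1} ∈ 𝓝 c := _root_.eventually_eventually_nhds.2 f.eventuallyEq_one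
  obtain ⟨g, hg, hg0, hg1, hgs⟩ := exists_bump (I := I)
    (Filter.inter_mem hf1 (chart_source_mem_nhds HM c))
  have hgc : g c = 1 := hg1.eq_of_nhds
  refine ⟨g, fun i => ⟨g • e.localFrame b i, ?_⟩,
    fun i p => f p • b.repr (extChartAt I c p) i, hg, hg0, by simp [hgc], ?_, ?_⟩
  · refine ContMDiffOn.smul_section_of_tsupport hg.contMDiffOn e.open_baseSet ?_
      (e.contMDiffOn_localFrame_baseSet ∞ b i)
    rw [hsrc]; exact fun p hp => (hgs hp).2
  · intro i
    refine f.contMDiff_smul ?_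
    have hb : ContDiff ℝ ∞ fun y : EM => b.repr y i :=
      (LinearMap.toContinuousLinearMap (b.coord i)).contDiff
    exact hb.contMDiff.comp_contMDiffOn contMDiffOn_extChartAt
  · intro p v
    by_cases hp : g p = 0
    · have : ∀ i, (g • e.localFrame b i) p = 0 := fun i => by simp [hp]
      simp [hp, this]
    have hp' := hgs (subset_tsupport g hp)
    have hps : p ∈ e.baseSet := by rw [hsrc]; exact hp'.2
    have hd : ∀ i, mvfderiv I (fun p => f p • b.repr (extChartAt I c p) i) p v
        = b.repr (e.continuousLinearMapAt ℝ p v) i := by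
      intro i
      have h1 : (fun p => f p • b.repr (extChartAt I c p) i) =ᶠ[𝓝 p]
          (LinearMap.toContinuousLinearMap (b.coord i)) ∘ extChartAt I c := by
        filter_upwards [hp'.1] with q hq
        simp [hq]
      rw [dF_congr h1, dF_comp (J := 𝓘(ℝ, EM))
        (ContinuousLinearMap.differentiableAt _).mdifferentiableAt
        (mdifferentiableAt_extChartAt hp'.2),
        TangentBundle.continuousLinearMapAt_trivializationAt hp'.2]
      refine (mvfderiv_model _ _).trans ?_
      rw [ContinuousLinearMap.fderiv]
      rfl
    simp only [hd]
    change ∑ i, b.repr (e.continuousLinearMapAt ℝ p v) i • (g p • e.localFrame b i p) = _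
    simp only [smul_comm _ (g p), ← Finset.smul_sum]
    congr 1
    simp only [e.localFrame_apply_of_mem_baseSet b hps, Trivialization.basisAt, Basis.map_apply]
    simp only [← map_smul, ← map_sum, b.sum_repr]
    refine Eq.trans ?_ (e.symmL_continuousLinearMapAt (R := ℝ) hps v)
    exact (e.symmL_apply (R := ℝ) hps _).symm

variable (I M) in
/-- The local frames, divided by the sum of their cut-off functions, form a global frame. -/
theorem exists_tangentFrame [CompactSpace M] : Nonempty (TangentFrame I M) := by
  choose g Y H hg hg0 hgc hH hsum using exists_local_tangentFrame (I := I) (M := M)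
  obtain ⟨t, ht⟩ := exists_finset_sum_pos g (fun c => (hg c).continuous) hg0 hgc
  let G : M → ℝ := fun p => (∑ c ∈ t, g c p)⁻¹
  have hG : IsSmooth I G := (IsSmooth.sum fun c _ => hg c).inv fun p => (ht p).ne'
  let ε := (Fintype.equivFin (t × Fin (finrank ℝ EM))).symm
  refine ⟨⟨_, fun k => VF.mul G hG (Y (ε k).1 (ε k).2), fun k => H (ε k).1 (ε k).2,
    fun k => hH _ _, fun p v => ?_⟩⟩
  simp only [VF.mul_apply]
  rw [ε.sum_comp (fun k : t × Fin (finrank ℝ EM) =>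
    mvfderiv I (H k.1 k.2) p v • G p • Y k.1 k.2 p), Fintype.sum_prod_type]
  simp only [smul_comm _ (G p), ← Finset.smul_sum, hsum, ← Finset.sum_smul]
  rw [Finset.sum_coe_sort t (fun c => g c p), smul_smul, inv_mul_cancel₀ (ht p).ne', one_smul]

/-- A vector field with given value at a point. -/
def TangentFrame.extend (T : TangentFrame I M) (p : M) (v : TangentSpace I p) : VF I M :=
  ∑ i, mvfderiv I (T.coord i) p v • T.field i

theorem TangentFrame.extend_apply (T : TangentFrame I M) (p : M) (v : TangentSpace I p) :
    T.extend p v p = v := by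
  rw [TangentFrame.extend, VF.sum_apply]
  exact T.sum_eq p v

/-- The bracket acts on functions as the commutator of derivations. The formula is read off from
the Jacobi identity for `U`, `V` and `f • W`, where `W` does not vanish at `p`. -/
theorem TangentFrame.lieD_bracket (T : TangentFrame I M) {f : M → ℝ} (hf : IsSmooth I f)
    (U V : VF I M) (p : M) :
    mvfderiv I f p (VectorField.mlieBracket I U V p)
      = lieD U (lieD V f) p - lieD V (lieD U f) p := by
  -- In dimension zero there is no vector field `W` as required, but both sides vanish.
  rcases subsingleton_or_nontrivial EM with hE | hE
  · have h : ∀ v : TangentSpace I p, v = 0 := fun v => Subsingleton.elim (α := EM) v 0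
    unfold lieD
    rw [h (VectorField.mlieBracket I U V p), h (U p), h (V p)]
    simp
  obtain ⟨w, hw⟩ := exists_ne (0 : EM)
  let W := T.extend p w
  have hW : W p = w := T.extend_apply p w
  have hsm : ∀ Y : VF I M, ContMDiff I (I.prod 𝓘(ℝ, EM)) (minSmoothness ℝ 2)
      fun x => (⟨x, Y x⟩ : TangentBundle I M) := fun Y =>
    Y.contMDiff.of_le (by simpa using two_le_infty)
  have h3 : IsManifold I (minSmoothness ℝ 3) M :=
    IsManifold.of_le (n := ∞) (by simpa using WithTop.coe_le_coe.2 (le_top : (3 : ℕ∞) ≤ ⊤))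
  have h2 : IsManifold I 2 M := IsManifold.of_le (n := ∞) two_le_infty
  have hmd : ∀ Y : VF I M, MDifferentiableAt I (I.prod 𝓘(ℝ, EM))
      (fun x => (⟨x, Y x⟩ : TangentBundle I M)) p := fun Y =>
    (Y.contMDiff p).mdifferentiableAt (by simp)
  have J1 := VectorField.leibniz_identity_mlieBracket_apply (x := p) (hsm U p) (hsm V p)
    (hsm W p)
  have J2 := VectorField.leibniz_identity_mlieBracket_apply (x := p) (hsm U p) (hsm V p)
    (hsm (VF.mul f hf W) p)
  have key : ∀ Y : VF I M, VectorField.mlieBracket I Y (VF.mul f hf W)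
      = lieD Y f • (W : ∀ p, TangentSpace I p)
        + f • VectorField.mlieBracket I Y W := by
    intro Y; funext q
    exact VectorField.mlieBracket_smul_right (hf.mdiffAt q)
      ((W.contMDiff q).mdifferentiableAt (by simp))
  have key2 : ∀ (g : M → ℝ), IsSmooth I g → ∀ Y Y' : VF I M,
      VectorField.mlieBracket I Y (g • (Y' : ∀ p, TangentSpace I p)) p
      = lieD Y g p • Y' p + g p • VectorField.mlieBracket I Y Y' p := fun g hg Y Y' =>
    VectorField.mlieBracket_smul_right (hg.mdiffAt p) (hmd Y')
  have key3 : ∀ Y Z : VF I M, VectorField.mlieBracket I Y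
      (VectorField.mlieBracket I Z (VF.mul f hf W)) p
      = (lieD Y (lieD Z f) p • W p + lieD Z f p • VectorField.mlieBracket I Y W p)
        + (lieD Y f p • VectorField.mlieBracket I Z W p
          + f p • VectorField.mlieBracket I Y (VectorField.mlieBracket I Z W) p) := by
    intro Y Z
    rw [key Z]
    refine (VectorField.mlieBracket_add_right (hmd (VF.mul _ (hf.lieD Z) W))
      (hmd (VF.mul f hf (bracket Z W)))).trans ?_
    refine congrArg₂ _ (key2 _ (hf.lieD Z) Y W) ?_
    exact key2 _ hf Y (bracket Z W)
  have h4 := key2 f hf (bracket U V) W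
  change VectorField.mlieBracket I (VectorField.mlieBracket I U V) (VF.mul f hf W) p
    = mvfderiv I f p (VectorField.mlieBracket I U V p) • W p
      + f p • VectorField.mlieBracket I (VectorField.mlieBracket I U V) W p at h4
  rw [key3, key3, h4, J1] at J2
  have : (mvfderiv I f p (VectorField.mlieBracket I U V p)
      - (lieD U (lieD V f) p - lieD V (lieD U f) p)) • W p = 0 := by
    rw [sub_smul, sub_smul, sub_eq_zero]
    simp only [smul_add] at J2
    have := sub_eq_zero.2 J2
    rw [← sub_eq_zero]
    rw [← neg_eq_zero, ← this]
    abel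
  rw [smul_eq_zero, hW] at this
  exact sub_eq_zero.1 (this.resolve_right hw)

end Frames

section Bundle
variable {X : Type*} [TopologicalSpace X] [ChartedSpace Coord4 X] [IsManifold (𝓡 4) ∞ X]
  (E : X → Type*) [TopologicalSpace (TotalSpace Fib E)]
  [∀ x, NormedAddCommGroup (E x)] [∀ x, InnerProductSpace ℝ (E x)]
  [FiberBundle Fib E] [VectorBundle ℝ Fib E] [ContMDiffVectorBundle ∞ Fib E (𝓡 4)]
  [IsContMDiffRiemannianBundle (𝓡 4) ∞ Fib E]

/-- Smooth sections `sec i` and `dual i` of `E`, finitely many, such that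
`w = ∑ i, ⟪w, dual i⟫ • sec i` for all `w` in a fibre of `E`. -/
structure BundleFrame where
  n : ℕ
  sec : Fin n → Sec E
  dual : Fin n → Sec E
  sum_eq : ∀ (x : X) (w : E x), ∑ i, ⟪w, dual i x⟫ • sec i x = w

theorem contMDiffOn_inv_matrix {u : Set X} {G : X → Matrix (Fin 3) (Fin 3) ℝ}
    (hG : ∀ i j, ContMDiffOn (𝓡 4) 𝓘(ℝ, ℝ) ∞ (fun x => G x i j) u) (h0 : ∀ x ∈ u, (G x).det ≠ 0)
    (i j : Fin 3) : ContMDiffOn (𝓡 4) 𝓘(ℝ, ℝ) ∞ (fun x => (G x)⁻¹ i j) u := by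
  have hdet : ∀ G : X → Matrix (Fin 3) (Fin 3) ℝ,
      (∀ i j, ContMDiffOn (𝓡 4) 𝓘(ℝ, ℝ) ∞ (fun x => G x i j) u) →
      ContMDiffOn (𝓡 4) 𝓘(ℝ, ℝ) ∞ (fun x => (G x).det) u := by
    intro G hG
    simp only [Matrix.det_apply]
    refine contMDiffOn_finsetSum fun σ _ => ?_
    have := contMDiffOn_finsetProd (t := Finset.univ) (f := fun i x => G x (σ i) i)
      (fun i _ => hG (σ i) i)
    rcases Int.units_eq_one_or (Equiv.Perm.sign σ) with h | h
    · simpa [h] using this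
    · simpa [h] using this.neg
  simp only [Matrix.inv_def, Ring.inverse_eq_inv', Matrix.smul_apply, smul_eq_mul,
    Matrix.adjugate_apply]
  refine ContMDiffOn.mul ((hdet G hG).inv₀ h0) (hdet _ fun k l => ?_)
  by_cases hk : k = j
  · subst hk; simpa using contMDiffOn_const
  · simpa [Matrix.updateRow_ne hk] using hG k l

variable {E}

/-- The frame of a local trivialisation and its dual frame, cut off by a bump function. -/
theorem exists_local_bundleFrame [T2Space X] (c : X) :
    ∃ (g : X → ℝ) (σ τ : Fin 3 → Sec E), IsSmooth (𝓡 4) g ∧ (∀ x, 0 ≤ g x) ∧ 0 < g c ∧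
      ∀ (x : X) (w : E x), ∑ i, ⟪w, τ i x⟫ • σ i x = g x • w := by
  let b := (EuclideanSpace.basisFun (Fin 3) ℝ).toBasis
  let e := trivializationAt Fib E c
  obtain ⟨g, hg, hg0, hg1, hgs⟩ := exists_bump (I := 𝓡 4) (c := c)
    (e.open_baseSet.mem_nhds (FiberBundle.mem_baseSet_trivializationAt' c))
  have hgc : g c = 1 := hg1.eq_of_nhds
  let G : X → Matrix (Fin 3) (Fin 3) ℝ := fun x => Matrix.gram ℝ fun i => e.localFrame b i x
  have hfr := fun i => e.contMDiffOn_localFrame_baseSet (I := 𝓡 4) ∞ b i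
  have hdet : ∀ x ∈ e.baseSet, (G x).det ≠ 0 := fun x hx =>
    Matrix.det_gram_ne_zero_iff_linearIndependent.2
      ((e.isLocalFrameOn_localFrame_baseSet (𝓡 4) ∞ b).linearIndependent hx)
  have hinv := contMDiffOn_inv_matrix (u := e.baseSet) (G := G)
    (fun i j => (hfr i).inner_bundle (hfr j)) hdet
  let d : Fin 3 → ∀ x, E x := fun j x => ∑ k, (G x)⁻¹ j k • e.localFrame b k x
  have hd : ∀ j, ContMDiffOn (𝓡 4) ((𝓡 4).prod 𝓘(ℝ, Fib)) ∞
      (fun x => (⟨x, d j x⟩ : TotalSpace Fib E)) e.baseSet := fun j =>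
    ContMDiffOn.sum_section fun k _ => (hinv j k).smul_section (hfr k)
  refine ⟨fun x => g x * g x,
    fun i => ⟨g • e.localFrame b i, hg.contMDiffOn.smul_section_of_tsupport e.open_baseSet hgs
      (hfr i)⟩, fun i => ⟨g • d i, hg.contMDiffOn.smul_section_of_tsupport e.open_baseSet hgs
      (hd i)⟩, hg.mul hg, fun x => mul_self_nonneg _, by simp [hgc], fun x w => ?_⟩
  change ∑ i, ⟪w, g x • d i x⟫ • (g x • e.localFrame b i x) = _
  by_cases hx : g x = 0
  · simp [hx]
  have hxe : x ∈ e.baseSet := hgs (subset_tsupport g hx)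
  let B := e.basisAt b hxe
  have hB : ∀ i, e.localFrame b i x = B i := fun i => e.localFrame_apply_of_mem_baseSet b hxe
  have hdual : ∀ i j, ⟪B j, d i x⟫ = if i = j then 1 else 0 := by
    intro i j
    have h1 : ((G x)⁻¹ * G x) i j = (1 : Matrix (Fin 3) (Fin 3) ℝ) i j := by
      rw [Matrix.nonsing_inv_mul _ (isUnit_iff_ne_zero.2 (hdet x hxe))]
    rw [Matrix.mul_apply, Matrix.one_apply] at h1
    rw [← h1, inner_sum]
    refine Finset.sum_congr rfl fun k _ => ?_
    rw [inner_smul_right, real_inner_comm, ← hB]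
    rfl
  have hw : ∀ i, ⟪w, d i x⟫ = B.repr w i := by
    intro i
    conv_lhs => rw [← B.sum_repr w]
    rw [sum_inner]
    simp only [real_inner_smul_left, hdual, mul_ite, mul_one, mul_zero, Finset.sum_ite_eq,
      Finset.mem_univ, if_true]
  simp only [inner_smul_right, hw, hB]
  conv_rhs => rw [← B.sum_repr w, Finset.smul_sum]
  refine Finset.sum_congr rfl fun i _ => ?_
  module

theorem Sec.sum_apply {ι : Type*} (s : Finset ι) (Y : ι → Sec E) (x : X) :
    (∑ i ∈ s, Y i) x = ∑ i ∈ s, Y i x := by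
  have := map_sum (ContMDiffSection.coeAddHom (𝓡 4) Fib ∞ E) Y s
  exact (congrFun this x).trans (Finset.sum_apply x s _)

/-- Multiplication of a section by a smooth function. -/
def Sec.mul (f : X → ℝ) (hf : IsSmooth (𝓡 4) f) (σ : Sec E) : Sec E :=
  ⟨f • (σ : ∀ x, E x), ContMDiff.smul_section hf σ.contMDiff⟩

@[simp]
theorem Sec.mul_apply (f : X → ℝ) (hf : IsSmooth (𝓡 4) f) (σ : Sec E) (x : X) :
    Sec.mul f hf σ x = f x • σ x := rfl

variable (E) in
/-- The local frames, divided by the sum of their cut-off functions, form a global frame. -/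
theorem exists_bundleFrame [T2Space X] [CompactSpace X] : Nonempty (BundleFrame E) := by
  choose g σ τ hg hg0 hgc hsum using exists_local_bundleFrame (E := E)
  obtain ⟨t, ht⟩ := exists_finset_sum_pos g (fun c => (hg c).continuous) hg0 hgc
  let G : X → ℝ := fun p => (∑ c ∈ t, g c p)⁻¹
  have hG : IsSmooth (𝓡 4) G := (IsSmooth.sum fun c _ => hg c).inv fun p => (ht p).ne'
  let ε := (Fintype.equivFin (t × Fin 3)).symm
  refine ⟨⟨_, fun k => Sec.mul G hG (σ (ε k).1 (ε k).2), fun k => τ (ε k).1 (ε k).2,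
    fun p v => ?_⟩⟩
  simp only [Sec.mul_apply]
  rw [ε.sum_comp (fun k : t × Fin 3 => ⟪v, τ k.1 k.2 p⟫ • G p • σ k.1 k.2 p),
    Fintype.sum_prod_type]
  simp only [smul_comm _ (G p), ← Finset.smul_sum, hsum, ← Finset.sum_smul]
  rw [Finset.sum_coe_sort t (fun c => g c p), smul_smul, inv_mul_cancel₀ (ht p).ne', one_smul]

namespace BundleFrame

/-- A section with given value at a point. -/
def extend (T : BundleFrame E) (x : X) (w : E x) : Sec E :=
  ∑ i, ⟪w, T.dual i x⟫ • T.sec i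

theorem extend_apply (T : BundleFrame E) (x : X) (w : E x) : T.extend x w x = w := by
  rw [extend, Sec.sum_apply]
  exact T.sum_eq x w

variable {EN HN N : Type*} [NormedAddCommGroup EN] [NormedSpace ℝ EN] [TopologicalSpace HN]
    {J : ModelWithCorners ℝ EN HN} [TopologicalSpace N] [ChartedSpace HN N]

theorem contMDiffAt_of_inner (T : BundleFrame E) {p : N → X} {z₀ : N}
    (hp : ContMDiffAt J (𝓡 4) ∞ p z₀) {s : ∀ z, E (p z)}
    (h : ∀ i, ContMDiffAt J 𝓘(ℝ, ℝ) ∞ (fun z => ⟪s z, T.dual i (p z)⟫) z₀) :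
    ContMDiffAt J ((𝓡 4).prod 𝓘(ℝ, Fib)) ∞ (fun z => (⟨p z, s z⟩ : TotalSpace Fib E)) z₀ := by
  rw [contMDiffAt_totalSpace]
  refine ⟨hp, ?_⟩
  simp only
  set e := trivializationAt Fib E (p z₀)
  have h1 : ContMDiffAt J 𝓘(ℝ, Fib) ∞
      (fun z => ∑ i, ⟪s z, T.dual i (p z)⟫ • (e ⟨p z, T.sec i (p z)⟩).2) z₀ := by
    refine contMDiffAt_finsetSum fun i _ => (h i).smul ?_
    have := ((T.sec i).contMDiff (p z₀)).comp z₀ hp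
    exact ((contMDiffAt_totalSpace (n := ∞)).1 this).2
  refine h1.congr_of_eventuallyEq ?_
  filter_upwards [hp.continuousAt.preimage_mem_nhds
    (e.open_baseSet.mem_nhds (FiberBundle.mem_baseSet_trivializationAt' (p z₀)))] with z hz
  have h2 : ∀ w : E (p z), (e ⟨p z, w⟩).2 = e.continuousLinearEquivAt ℝ (p z) hz w := fun _ => rfl
  simp only [h2, ← map_smul, ← map_sum, T.sum_eq]

theorem contMDiff_of_inner (T : BundleFrame E) {p : N → X} (hp : ContMDiff J (𝓡 4) ∞ p)
    {s : ∀ z, E (p z)} (h : ∀ i, IsSmooth J fun z => ⟪s z, T.dual i (p z)⟫) :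
    ContMDiff J ((𝓡 4).prod 𝓘(ℝ, Fib)) ∞ (fun z => (⟨p z, s z⟩ : TotalSpace Fib E)) :=
  fun z => T.contMDiffAt_of_inner (hp z) fun i => h i z

end BundleFrame
end Bundle

/-! ### The manifold `Z` -/

section SphereManifold
variable {X : Type*} [TopologicalSpace X] [ChartedSpace Coord4 X] [IsManifold (𝓡 4) ∞ X]
  {E : X → Type*} [TopologicalSpace (TotalSpace Fib E)]
  [∀ x, NormedAddCommGroup (E x)] [∀ x, InnerProductSpace ℝ (E x)]
  [FiberBundle Fib E] [VectorBundle ℝ Fib E] [ContMDiffVectorBundle ∞ Fib E (𝓡 4)]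
  [IsContMDiffRiemannianBundle (𝓡 4) ∞ Fib E]

theorem contMDiffAt_sphereTriv (z : SphereBundle E) :
    ContMDiffAt I6 I6 ∞ (sphereTriv (trivializationAt Fib E z.proj)) z := by
  rw [contMDiffAt_iff_target]
  refine ⟨(sphereTriv _).continuousAt (FiberBundle.mem_baseSet_trivializationAt' z.1.proj), ?_⟩
  exact contMDiffAt_extChartAt

theorem contMDiff_proj : ContMDiff I6 (𝓡 4) ∞ (SphereBundle.proj : SphereBundle E → X) :=
  fun z => contMDiffAt_fst.comp z (contMDiffAt_sphereTriv z)

theorem continuous_proj : Continuous (SphereBundle.proj : SphereBundle E → X) :=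
  contMDiff_proj.continuous

/-- In the chart given by a local trivialisation `e`, the inclusion of `Z` in the total space of `E`
is `(x, q) ↦ w / ‖w‖` with `w = e⁻¹ (x, q)`. -/
theorem contMDiff_val :
    ContMDiff I6 ((𝓡 4).prod 𝓘(ℝ, Fib)) ∞ (fun z : SphereBundle E => z.1) := by
  intro z
  rw [contMDiffAt_totalSpace]
  refine ⟨contMDiff_proj z, ?_⟩
  set e := trivializationAt Fib E z.1.proj
  have hz : z.1.proj ∈ e.baseSet := FiberBundle.mem_baseSet_trivializationAt' z.1.proj
  have : Fact (finrank ℝ Fib = 2 + 1) := ⟨by simp⟩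
  have hq : ContMDiff I6 𝓘(ℝ, Fib) ∞ (fun p : X × S2 => (p.2 : Fib)) :=
    contMDiff_coe_sphere.comp contMDiff_snd
  have h1 : ContMDiffAt I6 ((𝓡 4).prod 𝓘(ℝ, Fib)) ∞ (fun p : X × S2 =>
        (⟨p.1, e.symm p.1 (p.2 : Fib)⟩ : TotalSpace Fib E)) (sphereTriv e z) := by
    have h2 : e.target ∈ 𝓝 ((sphereTriv e z).1, ((sphereTriv e z).2 : Fib)) :=
      e.open_target.mem_nhds (by rw [e.target_eq]; exact ⟨hz, mem_univ _⟩)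
    have := (e.contMDiffOn_symm (IB := 𝓡 4) (n := ∞)).contMDiffAt h2
    refine (this.comp (sphereTriv e z) (contMDiffAt_fst.prodMk (hq _))).congr_of_eventuallyEq ?_
    filter_upwards [(e.open_baseSet.preimage continuous_fst).mem_nhds
      (show (sphereTriv e z).1 ∈ e.baseSet from hz)] with p hp
    exact e.mk_symm hp _
  have h2 : ContMDiffAt I6 𝓘(ℝ, ℝ) ∞ (fun p : X × S2 => ‖e.symm p.1 (p.2 : Fib)‖⁻¹)
      (sphereTriv e z) := by
    have h0 := triv_symm_ne e hz (sphereTriv e z).2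
    have h3 := h1.inner_bundle h1
    simp only [real_inner_self_eq_norm_sq] at h3
    have h4 := (Real.contDiffAt_sqrt (n := ∞)
      (pow_ne_zero 2 (norm_ne_zero_iff.2 h0))).contMDiffAt.comp (sphereTriv e z) h3
    simp only [Function.comp_def, Real.sqrt_sq (norm_nonneg _)] at h4
    exact h4.inv₀ (norm_ne_zero_iff.2 h0)
  have h3 := (h2.smul (hq _)).comp z (contMDiffAt_sphereTriv z)
  refine h3.congr_of_eventuallyEq ?_
  filter_upwards [(e.open_baseSet.preimage continuous_proj).mem_nhds hz] with y hy
  have hy' : y ∈ (sphereTriv e).source := hy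
  conv_lhs => rw [← (sphereTriv e).left_inv hy']
  have key : ∀ (x : X) (_ : x ∈ e.baseSet) (q : S2),
      (e (toSphere (e.symm x (q : Fib))).1).2 = ‖e.symm x (q : Fib)‖⁻¹ • (q : Fib) := by
    intro x hx q
    rw [toSphere_val (triv_symm_ne e hx _), ← e.symmL_apply (R := ℝ) hx, ← map_smul,
      e.symmL_apply (R := ℝ) hx, e.apply_mk_symm hx]
  exact key _ hy _

theorem contMDiff_vec :
    ContMDiff I6 ((𝓡 4).prod 𝓘(ℝ, Fib)) ∞
      (fun z : SphereBundle E => (⟨z.proj, z.vec⟩ : TotalSpace Fib E)) := contMDiff_val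

variable {EN HN N : Type*} [NormedAddCommGroup EN] [NormedSpace ℝ EN] [TopologicalSpace HN]
    {J : ModelWithCorners ℝ EN HN} [TopologicalSpace N] [ChartedSpace HN N]

/-- A map to `Z` is smooth if it is smooth as a map to the total space of `E`. -/
theorem contMDiffAt_sphereBundle {φ : N → SphereBundle E} {y : N}
    (h : ContMDiffAt J ((𝓡 4).prod 𝓘(ℝ, Fib)) ∞ (fun y => (φ y).1) y) :
    ContMDiffAt J I6 ∞ φ y := by
  have hc : ContinuousAt φ y := by
    exact (Topology.IsInducing.subtypeVal
      (t := {p : TotalSpace Fib E | ‖p.2‖ = 1})).continuousAt_iff.2 h.continuousAt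
  have h1 := (contMDiffAt_totalSpace (n := ∞)).1 h
  set e := trivializationAt Fib E (φ y).1.proj
  have hz : (φ y).1.proj ∈ e.baseSet := FiberBundle.mem_baseSet_trivializationAt' _
  have h2 : ContMDiffAt J I6 ∞ (fun y => sphereTriv e (φ y)) y := by
    refine h1.1.prodMk ?_
    exact ContMDiffAt.comp (I' := 𝓘(ℝ, Fib)) (g := toS2) y
      (contMDiffOn_toS2.contMDiffAt (isOpen_compl_singleton.mem_nhds (triv_snd_ne e hz))) h1.2
  exact contMDiffAt_iff_target.2 ⟨hc, (contMDiffAt_iff_target.1 h2).2⟩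

instance [T2Space X] : T2Space (SphereBundle E) := by
  refine ⟨fun z w hzw => ?_⟩
  by_cases h : z.proj = w.proj
  · let e := trivializationAt Fib E z.proj
    have hz : z ∈ (sphereTriv e).source := FiberBundle.mem_baseSet_trivializationAt' z.proj
    have hw : w ∈ (sphereTriv e).source := by
      change w.proj ∈ e.baseSet
      rw [← h]; exact hz
    obtain ⟨u, v, hu, hv, hzu, hwv, huv⟩ := t2_separation
      (fun h' => hzw ((sphereTriv e).injOn hz hw h'))
    refine ⟨_, _, (sphereTriv e).isOpen_inter_preimage hu, (sphereTriv e).isOpen_inter_preimage hv,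
      ⟨hz, hzu⟩, ⟨hw, hwv⟩, ?_⟩
    exact (huv.preimage (sphereTriv e)).mono inter_subset_right inter_subset_right
  · obtain ⟨u, v, hu, hv, hzu, hwv, huv⟩ := t2_separation h
    exact ⟨_, _, hu.preimage continuous_proj, hv.preimage continuous_proj, hzu, hwv,
      huv.preimage _⟩

instance [T2Space X] [CompactSpace X] : CompactSpace (SphereBundle E) := by
  have hloc : ∀ x : X, ∃ K ∈ 𝓝 x, IsCompact ((SphereBundle.proj : SphereBundle E → X) ⁻¹' K) := by
    intro x
    let e := trivializationAt Fib E x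
    obtain ⟨K, ⟨hK, hKc⟩, hKe⟩ := (compact_basis_nhds x).mem_iff.1
      (e.open_baseSet.mem_nhds (FiberBundle.mem_baseSet_trivializationAt' x))
    have h1 : IsCompact ((sphereTriv e).symm '' (K ×ˢ (univ : Set S2))) :=
      (hKc.prod isCompact_univ).image_of_continuousOn
        ((sphereTriv e).continuousOn_symm.mono fun p hp => ⟨hKe hp.1, hp.2⟩)
    refine ⟨K, hK, h1.of_isClosed_subset (hKc.isClosed.preimage continuous_proj) fun z hz => ?_⟩
    exact ⟨sphereTriv e z, ⟨hz, mem_univ _⟩, (sphereTriv e).left_inv (hKe hz)⟩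
  choose K hK hKc using hloc
  obtain ⟨t, -, ht⟩ := isCompact_univ.elim_nhds_subcover K fun x _ => hK x
  refine ⟨(t.isCompact_biUnion fun x _ => hKc x).of_isClosed_subset isClosed_univ fun z _ => ?_⟩
  obtain ⟨x, hx, hz⟩ := mem_iUnion₂.1 (ht (mem_univ z.proj))
  exact mem_iUnion₂.2 ⟨x, hx, hz⟩

end SphereManifold

/-! ### The pulled back connection -/

section Pullback
variable {X : Type*} [TopologicalSpace X] [ChartedSpace Coord4 X] [IsManifold (𝓡 4) ∞ X]
  {E : X → Type*} [TopologicalSpace (TotalSpace Fib E)]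
  [∀ x, NormedAddCommGroup (E x)] [∀ x, InnerProductSpace ℝ (E x)]
  [FiberBundle Fib E] [VectorBundle ℝ Fib E] [ContMDiffVectorBundle ∞ Fib E (𝓡 4)]
  [IsContMDiffRiemannianBundle (𝓡 4) ∞ Fib E]

/-- Smooth sections of `π^*E`. -/
abbrev SmoothAlong (s : ∀ z : SphereBundle E, E z.proj) : Prop :=
  ContMDiff I6 ((𝓡 4).prod 𝓘(ℝ, Fib)) ∞ fun z => (⟨z.proj, s z⟩ : TotalSpace Fib E)

theorem smoothAlong_pullback (σ : Sec E) :
    SmoothAlong fun z : SphereBundle E => σ z.proj :=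
  σ.contMDiff.comp contMDiff_proj

theorem IsSmooth.pullback {f : X → ℝ} (hf : IsSmooth (𝓡 4) f) :
    IsSmooth I6 fun z : SphereBundle E => f z.proj :=
  ContMDiff.comp hf contMDiff_proj

variable {s t : ∀ z : SphereBundle E, E z.proj}

theorem SmoothAlong.inner (hs : SmoothAlong s) (ht : SmoothAlong t) :
    IsSmooth I6 fun z => ⟪s z, t z⟫ := ContMDiff.inner_bundle hs ht

theorem BundleFrame.smoothAlong (T : BundleFrame E)
    (h : ∀ i, IsSmooth I6 fun z => ⟪s z, T.dual i z.proj⟫) : SmoothAlong s :=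
  T.contMDiff_of_inner contMDiff_proj h

theorem BundleFrame.smoothAlong_add (T : BundleFrame E) (hs : SmoothAlong s) (ht : SmoothAlong t) :
    SmoothAlong fun z => s z + t z :=
  T.smoothAlong fun i => by
    simp only [inner_add_left]
    exact (hs.inner (smoothAlong_pullback _)).add (ht.inner (smoothAlong_pullback _))

theorem BundleFrame.smoothAlong_sub (T : BundleFrame E) (hs : SmoothAlong s) (ht : SmoothAlong t) :
    SmoothAlong fun z => s z - t z :=
  T.smoothAlong fun i => by
    simp only [inner_sub_left]
    exact (hs.inner (smoothAlong_pullback _)).sub (ht.inner (smoothAlong_pullback _))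

theorem BundleFrame.smoothAlong_smul (T : BundleFrame E) {f : SphereBundle E → ℝ}
    (hf : IsSmooth I6 f) (hs : SmoothAlong s) : SmoothAlong fun z => f z • s z :=
  T.smoothAlong fun i => by
    simp only [real_inner_smul_left]
    exact hf.mul (hs.inner (smoothAlong_pullback _))

theorem BundleFrame.smoothAlong_sum (T : BundleFrame E) {ι : Type*} {a : Finset ι}
    {s : ι → ∀ z : SphereBundle E, E z.proj} (hs : ∀ i ∈ a, SmoothAlong (s i)) :
    SmoothAlong fun z => ∑ i ∈ a, s i z :=
  T.smoothAlong fun j => by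
    simp only [sum_inner]
    exact IsSmooth.sum fun i hi => (hs i hi).inner (smoothAlong_pullback _)

/-- The differential of the projection `Z → X`. -/
abbrev dπ (z : SphereBundle E) (v : TangentSpace I6 z) : TangentSpace (𝓡 4) z.proj :=
  mfderiv I6 (𝓡 4) SphereBundle.proj z v

theorem dF_pullback {f : X → ℝ} (hf : IsSmooth (𝓡 4) f) (z : SphereBundle E)
    (v : TangentSpace I6 z) :
    mvfderiv I6 (fun z : SphereBundle E => f z.proj) z v = mvfderiv (𝓡 4) f z.proj (dπ z v) :=
  dF_comp (hf.mdiffAt _) ((contMDiff_proj z).mdifferentiableAt (by simp))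

namespace MetricConnection
variable (A : MetricConnection E)

theorem toFun_zero (x : X) (v : TangentSpace (𝓡 4) x) : A.toFun 0 x v = 0 := by
  have := congrArg (fun l => l v) (A.add 0 0 x)
  simpa using this

theorem toFun_add (σ τ : Sec E) (x : X) (v : TangentSpace (𝓡 4) x) :
    A.toFun (σ + τ) x v = A.toFun σ x v + A.toFun τ x v := by
  rw [A.add]; rfl

theorem toFun_mul {f : X → ℝ} (hf : IsSmooth (𝓡 4) f) (σ : Sec E) (x : X)
    (v : TangentSpace (𝓡 4) x) :
    A.toFun (Sec.mul f hf σ) x v = f x • A.toFun σ x v + mvfderiv (𝓡 4) f x v • σ x :=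
  A.leibniz f σ _ hf (fun _ => rfl) x v

theorem toFun_sum {ι : Type*} (s : Finset ι) (σ : ι → Sec E) (x : X) (v : TangentSpace (𝓡 4) x) :
    A.toFun (∑ i ∈ s, σ i) x v = ∑ i ∈ s, A.toFun (σ i) x v := by
  classical
  induction s using Finset.induction_on with
  | empty => simpa using A.toFun_zero x v
  | insert i s hi ih => rw [Finset.sum_insert hi, Finset.sum_insert hi, toFun_add, ih]

end MetricConnection

theorem BundleFrame.isSmooth_coeff (T : BundleFrame E) (σ : Sec E) (i : Fin T.n) :
    IsSmooth (𝓡 4) fun x => ⟪σ x, T.dual i x⟫ :=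
  ContMDiff.inner_bundle σ.contMDiff (T.dual i).contMDiff

theorem BundleFrame.sum_mul_eq (T : BundleFrame E) (σ : Sec E) :
    ∑ i, Sec.mul (fun x => ⟪σ x, T.dual i x⟫) (T.isSmooth_coeff σ i) (T.sec i) = σ := by
  apply ContMDiffSection.ext
  intro x
  rw [Sec.sum_apply]
  exact T.sum_eq x (σ x)

theorem BundleFrame.toFun_eq (T : BundleFrame E) (A : MetricConnection E) (σ : Sec E) (x : X)
    (v : TangentSpace (𝓡 4) x) :
    A.toFun σ x v = ∑ i, (⟪σ x, T.dual i x⟫ • A.toFun (T.sec i) x v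
      + mvfderiv (𝓡 4) (fun x => ⟪σ x, T.dual i x⟫) x v • T.sec i x) := by
  conv_lhs => rw [← T.sum_mul_eq σ, A.toFun_sum]
  exact Finset.sum_congr rfl fun i _ => A.toFun_mul _ _ _ _

/-- The connection `π^*∇` in terms of a global frame of `E`. The coefficients of `s - π^*σ` vanish
at `z`, so that the derivative of `s - π^*σ` there does not depend on the trivialisation. -/
theorem BundleFrame.pullbackDeriv_eq (T : BundleFrame E) (A : MetricConnection E)
    (hs : SmoothAlong s) (z : SphereBundle E) (v : TangentSpace I6 z) :
    pullbackDeriv A s z v = ∑ i, (⟪s z, T.dual i z.proj⟫ • A.toFun (T.sec i) z.proj (dπ z v)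
      + mvfderiv I6 (fun y => ⟪s y, T.dual i y.proj⟫) z v • T.sec i z.proj) := by
  unfold pullbackDeriv
  simp only
  set e := trivializationAt Fib E z.proj
  have hz : z.proj ∈ e.baseSet := FiberBundle.mem_baseSet_trivializationAt' z.proj
  set σ : Sec E := Classical.epsilon fun σ : Sec E => σ z.proj = s z
  have hσ : σ z.proj = s z := Classical.epsilon_spec (p := fun σ : Sec E => σ z.proj = s z)
    ⟨T.extend z.proj (s z), T.extend_apply _ _⟩
  let c : Fin T.n → SphereBundle E → ℝ := fun i y =>
    ⟪s y, T.dual i y.proj⟫ - ⟪σ y.proj, T.dual i y.proj⟫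
  have h1 : ∀ i, IsSmooth I6 fun y : SphereBundle E => ⟪s y, T.dual i y.proj⟫ := fun i =>
    hs.inner (smoothAlong_pullback _)
  have h2 : ∀ i, IsSmooth I6 fun y : SphereBundle E => ⟪σ y.proj, T.dual i y.proj⟫ := fun i =>
    (smoothAlong_pullback σ).inner (smoothAlong_pullback _)
  have hc : ∀ i, IsSmooth I6 (c i) := fun i => (h1 i).sub (h2 i)
  have hc0 : ∀ i, c i z = 0 := fun i => by simp [c, hσ]
  have hev : (fun y : SphereBundle E => (e ⟨y.proj, s y - σ y.proj⟩).2) =ᶠ[𝓝 z]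
      fun y => ∑ i, c i y • (e ⟨y.proj, T.sec i y.proj⟩).2 := by
    filter_upwards [(e.open_baseSet.preimage continuous_proj).mem_nhds hz] with y hy
    have h3 : ∀ w : E y.proj, (e ⟨y.proj, w⟩).2 = e.continuousLinearEquivAt ℝ y.proj hy w :=
      fun _ => rfl
    simp only [h3, ← map_smul, ← map_sum, c, ← inner_sub_left, T.sum_eq]
  have hsm : ∀ i, MDifferentiableAt I6 𝓘(ℝ, Fib)
      (fun y : SphereBundle E => (e ⟨y.proj, T.sec i y.proj⟩).2) z := fun i =>
    ((contMDiffAt_totalSpace (n := ∞)).1 (smoothAlong_pullback (T.sec i) z)).2.mdifferentiableAt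
      (by simp)
  have hd : mvfderiv I6 (fun y : SphereBundle E => (e ⟨y.proj, s y - σ y.proj⟩).2) z v
      = ∑ i, mvfderiv I6 (c i) z v • (e ⟨z.proj, T.sec i z.proj⟩).2 := by
    rw [dF_congr hev, dF_sum (f := fun i y => c i y • (e ⟨y.proj, T.sec i y.proj⟩).2)
      fun i _ => ((hc i).mdiffAt z).smul (hsm i)]
    refine Finset.sum_congr rfl fun i _ => ?_
    rw [mvfderiv_fun_smul ((hc i).mdiffAt z) (hsm i), hc0]
    simp
  rw [hd, T.toFun_eq A σ, ← e.symmL_apply (R := ℝ) hz, map_sum, ← Finset.sum_add_distrib]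
  refine Finset.sum_congr rfl fun i _ => ?_
  have h4 : e.symm z.proj (e ⟨z.proj, T.sec i z.proj⟩).2 = T.sec i z.proj :=
    e.symm_proj_apply ⟨z.proj, T.sec i z.proj⟩ hz
  rw [map_smul, e.symmL_apply (R := ℝ) hz, h4, hσ, dF_sub ((h1 i).mdiffAt z) ((h2 i).mdiffAt z),
    dF_pullback (T.isSmooth_coeff σ i)]
  module

section Properties
variable (T : BundleFrame E) (A : MetricConnection E) (z : SphereBundle E) (v : TangentSpace I6 z)

include T

theorem pullbackDeriv_pullback (σ : Sec E) :
    pullbackDeriv A (fun z => σ z.proj) z v = A.toFun σ z.proj (dπ z v) := by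
  rw [T.pullbackDeriv_eq A (smoothAlong_pullback σ), T.toFun_eq A σ]
  simp only [dF_pullback (T.isSmooth_coeff σ _)]

theorem pullbackDeriv_add_vector (hs : SmoothAlong s) (w : TangentSpace I6 z) :
    pullbackDeriv A s z (v + w) = pullbackDeriv A s z v + pullbackDeriv A s z w := by
  simp only [T.pullbackDeriv_eq A hs, dπ, map_add, ← Finset.sum_add_distrib]
  refine Finset.sum_congr rfl fun i _ => ?_
  module

theorem pullbackDeriv_smul_vector (hs : SmoothAlong s) (c : ℝ) :
    pullbackDeriv A s z (c • v) = c • pullbackDeriv A s z v := by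
  simp only [T.pullbackDeriv_eq A hs, dπ, map_smul, Finset.smul_sum]
  refine Finset.sum_congr rfl fun i _ => ?_
  rw [smul_eq_mul]
  module

theorem pullbackDeriv_add (hs : SmoothAlong s) (ht : SmoothAlong t) :
    pullbackDeriv A (fun z => s z + t z) z v = pullbackDeriv A s z v + pullbackDeriv A t z v := by
  rw [T.pullbackDeriv_eq A (T.smoothAlong_add hs ht), T.pullbackDeriv_eq A hs,
    T.pullbackDeriv_eq A ht, ← Finset.sum_add_distrib]
  refine Finset.sum_congr rfl fun i _ => ?_
  simp only [inner_add_left]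
  rw [dF_add ((hs.inner (smoothAlong_pullback _)).mdiffAt z)
    ((ht.inner (smoothAlong_pullback _)).mdiffAt z)]
  module

theorem pullbackDeriv_smul {f : SphereBundle E → ℝ} (hf : IsSmooth I6 f) (hs : SmoothAlong s) :
    pullbackDeriv A (fun z => f z • s z) z v
      = f z • pullbackDeriv A s z v + mvfderiv I6 f z v • s z := by
  rw [T.pullbackDeriv_eq A (T.smoothAlong_smul hf hs), T.pullbackDeriv_eq A hs, Finset.smul_sum]
  conv_rhs => rw [← T.sum_eq z.proj (s z), Finset.smul_sum, ← Finset.sum_add_distrib]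
  refine Finset.sum_congr rfl fun i _ => ?_
  simp only [real_inner_smul_left]
  rw [dF_mul (hf.mdiffAt z) ((hs.inner (smoothAlong_pullback _)).mdiffAt z), T.sum_eq]
  module

theorem pullbackDeriv_sum {ι : Type*} {a : Finset ι} {s : ι → ∀ z : SphereBundle E, E z.proj}
    (hs : ∀ i ∈ a, SmoothAlong (s i)) :
    pullbackDeriv A (fun z => ∑ i ∈ a, s i z) z v = ∑ i ∈ a, pullbackDeriv A (s i) z v := by
  rw [T.pullbackDeriv_eq A (T.smoothAlong_sum hs)]
  rw [Finset.sum_congr rfl fun i hi => T.pullbackDeriv_eq A (hs i hi) z v, Finset.sum_comm]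
  refine Finset.sum_congr rfl fun j _ => ?_
  simp only [sum_inner]
  rw [dF_sum fun i hi => ((hs i hi).inner (smoothAlong_pullback _)).mdiffAt z, Finset.sum_smul,
    Finset.sum_smul, Finset.sum_add_distrib]

theorem pullbackDeriv_sub (hs : SmoothAlong s) (ht : SmoothAlong t) :
    pullbackDeriv A (fun z => s z - t z) z v = pullbackDeriv A s z v - pullbackDeriv A t z v := by
  rw [eq_sub_iff_add_eq, ← pullbackDeriv_add T A z v (T.smoothAlong_sub hs ht) ht]
  simp only [sub_add_cancel]

/-- A section of `π^*E` is a finite sum of multiples of pulled back sections, so that it suffices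
to check the product rule for the metric on pulled back sections. -/
theorem pullbackDeriv_metric_aux (ht : SmoothAlong t)
    (h : ∀ σ : Sec E, mvfderiv I6 (fun y : SphereBundle E => ⟪σ y.proj, t y⟫) z v
      = ⟪A.toFun σ z.proj (dπ z v), t z⟫ + ⟪σ z.proj, pullbackDeriv A t z v⟫)
    (hs : SmoothAlong s) :
    mvfderiv I6 (fun y => ⟪s y, t y⟫) z v
      = ⟪pullbackDeriv A s z v, t z⟫ + ⟪s z, pullbackDeriv A t z v⟫ := by
  have h1 : ∀ i, IsSmooth I6 fun y : SphereBundle E => ⟪s y, T.dual i y.proj⟫ := fun i =>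
    hs.inner (smoothAlong_pullback _)
  have h2 : ∀ i, IsSmooth I6 fun y : SphereBundle E => ⟪T.sec i y.proj, t y⟫ := fun i =>
    (smoothAlong_pullback _).inner ht
  have h3 : (fun y => ⟪s y, t y⟫)
      = fun y => ∑ i, ⟪s y, T.dual i y.proj⟫ * ⟪T.sec i y.proj, t y⟫ := by
    funext y
    conv_lhs => rw [← T.sum_eq y.proj (s y), sum_inner]
    simp only [real_inner_smul_left]
  rw [h3, dF_sum fun i _ => ((h1 i).mul (h2 i)).mdiffAt z, T.pullbackDeriv_eq A hs, sum_inner]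
  conv_rhs => rw [← T.sum_eq z.proj (s z), sum_inner, ← Finset.sum_add_distrib]
  refine Finset.sum_congr rfl fun i _ => ?_
  rw [dF_mul ((h1 i).mdiffAt z) ((h2 i).mdiffAt z), h, T.sum_eq, inner_add_left,
    real_inner_smul_left, real_inner_smul_left, real_inner_smul_left]
  ring

/-- `π^*∇` is a metric connection. -/
theorem pullbackDeriv_metric (hs : SmoothAlong s) (ht : SmoothAlong t) :
    mvfderiv I6 (fun y => ⟪s y, t y⟫) z v
      = ⟪pullbackDeriv A s z v, t z⟫ + ⟪s z, pullbackDeriv A t z v⟫ := by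
  refine pullbackDeriv_metric_aux T A z v ht (fun σ => ?_) hs
  have h := pullbackDeriv_metric_aux (s := t) T A z v (smoothAlong_pullback σ) (fun τ => ?_) ht
  · simp only [real_inner_comm (σ _) (t _)] at h ⊢
    rw [pullbackDeriv_pullback T] at h
    rw [h, real_inner_comm (σ _), real_inner_comm (t z)]
    ring
  · rw [pullbackDeriv_pullback T, ← A.metric τ σ]
    exact dF_pullback (ContMDiff.inner_bundle τ.contMDiff σ.contMDiff) z v

end Properties

/-- `(π^*∇)_U s` is smooth. -/
theorem smoothAlong_pullbackDeriv (T : BundleFrame E) (TX : TangentFrame (𝓡 4) X)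
    (A : MetricConnection E) (hs : SmoothAlong s) (U : VF I6 (SphereBundle E)) :
    SmoothAlong fun z => pullbackDeriv A s z (U z) := by
  have h : (fun z => pullbackDeriv A s z (U z)) = fun z => ∑ i, (⟪s z, T.dual i z.proj⟫ •
      (∑ k, lieD U (fun y : SphereBundle E => TX.coord k y.proj) z •
        A.cov (TX.field k) (T.sec i) z.proj)
      + lieD U (fun y => ⟪s y, T.dual i y.proj⟫) z • T.sec i z.proj) := by
    funext z
    rw [T.pullbackDeriv_eq A hs]
    refine Finset.sum_congr rfl fun i _ => ?_
    congr 2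
    conv_lhs => rw [← TX.sum_eq z.proj (dπ z (U z)), map_sum]
    refine Finset.sum_congr rfl fun k _ => ?_
    rw [map_smul, ← dF_pullback (TX.smooth k)]
    rfl
  rw [h]
  refine T.smoothAlong_sum fun i _ => T.smoothAlong_add (T.smoothAlong_smul
    (hs.inner (smoothAlong_pullback _)) (T.smoothAlong_sum fun k _ => ?_))
    (T.smoothAlong_smul ((hs.inner (smoothAlong_pullback _)).lieD U) (smoothAlong_pullback _))
  exact T.smoothAlong_smul ((TX.smooth k).pullback.lieD U) (smoothAlong_pullback _)

end Pullback

/-! ### The vertical directions -/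

section Vertical
variable {X : Type*} [TopologicalSpace X] [ChartedSpace Coord4 X] [IsManifold (𝓡 4) ∞ X]
  {E : X → Type*} [TopologicalSpace (TotalSpace Fib E)]
  [∀ x, NormedAddCommGroup (E x)] [∀ x, InnerProductSpace ℝ (E x)]
  [FiberBundle Fib E] [VectorBundle ℝ Fib E] [ContMDiffVectorBundle ∞ Fib E (𝓡 4)]
  [IsContMDiffRiemannianBundle (𝓡 4) ∞ Fib E]

/-- The orthogonal projection `E (π z) → V z`. -/
def vproj (z : SphereBundle E) (w : E z.proj) : E z.proj := w - ⟪z.vec, w⟫ • z.vec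

theorem inner_vec_self (z : SphereBundle E) : ⟪z.vec, z.vec⟫ = 1 := by
  rw [real_inner_self_eq_norm_sq, z.norm_vec, one_pow]

theorem inner_vproj_vec (z : SphereBundle E) (w : E z.proj) : ⟪vproj z w, z.vec⟫ = 0 := by
  rw [vproj, inner_sub_left, real_inner_smul_left, inner_vec_self, real_inner_comm]
  ring

theorem vproj_add (z : SphereBundle E) (w w' : E z.proj) :
    vproj z (w + w') = vproj z w + vproj z w' := by
  simp only [vproj, inner_add_right]; module

theorem vproj_smul (z : SphereBundle E) (c : ℝ) (w : E z.proj) :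
    vproj z (c • w) = c • vproj z w := by
  simp only [vproj, real_inner_smul_right]; module

theorem vproj_of_tangent {z : SphereBundle E} {w : E z.proj} (h : ⟪w, z.vec⟫ = 0) :
    vproj z w = w := by
  rw [vproj, real_inner_comm, h]; simp

theorem inner_vproj_left {z : SphereBundle E} (w : E z.proj) {t : E z.proj} (h : ⟪t, z.vec⟫ = 0) :
    ⟪vproj z w, t⟫ = ⟪w, t⟫ := by
  rw [vproj, inner_sub_left, real_inner_smul_left, real_inner_comm t z.vec, h]; ring

theorem inner_vproj_right {z : SphereBundle E} (w : E z.proj) {t : E z.proj} (h : ⟪t, z.vec⟫ = 0) :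
    ⟪t, vproj z w⟫ = ⟪t, w⟫ := by
  rw [real_inner_comm, inner_vproj_left w h, real_inner_comm]

theorem BundleFrame.smoothAlong_vproj (T : BundleFrame E) {s : ∀ z : SphereBundle E, E z.proj}
    (hs : SmoothAlong s) : SmoothAlong fun z => vproj z (s z) :=
  T.smoothAlong_sub hs (T.smoothAlong_smul (SmoothAlong.inner contMDiff_vec hs) contMDiff_vec)

/-- The vertical part of a section of `π^*E`. -/
def BundleFrame.vsec (T : BundleFrame E) (s : ∀ z : SphereBundle E, E z.proj)
    (hs : SmoothAlong s) : VSection E :=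
  ⟨fun z => vproj z (s z), fun z => inner_vproj_vec z _, T.smoothAlong_vproj hs⟩

/-- A section of `V` with given value at a point. -/
def BundleFrame.vextend (T : BundleFrame E) (z : SphereBundle E) (w : E z.proj) : VSection E :=
  T.vsec _ (smoothAlong_pullback (T.extend z.proj w))

theorem BundleFrame.vextend_apply (T : BundleFrame E) {z : SphereBundle E} {w : E z.proj}
    (h : ⟪w, z.vec⟫ = 0) : (T.vextend z w).toFun z = w := by
  change vproj z (T.extend z.proj w z.proj) = w
  rw [T.extend_apply, vproj_of_tangent h]

theorem vec_ne_zero (z : SphereBundle E) : z.vec ≠ 0 := fun h => by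
  have := z.norm_vec; simp [h] at this

theorem vec_add_ne_zero {z : SphereBundle E} {w : E z.proj} (h : ⟪w, z.vec⟫ = 0) (t : ℝ) :
    z.vec + t • w ≠ 0 := fun h0 => by
  have : ⟪z.vec + t • w, z.vec⟫ = 0 := by rw [h0, inner_zero_left]
  rw [inner_add_left, real_inner_smul_left, h, inner_vec_self] at this
  simp at this

theorem norm_vec_add {z : SphereBundle E} {w : E z.proj} (h : ⟪w, z.vec⟫ = 0) (t : ℝ) :
    ‖z.vec + t • w‖ = √(1 + t * t * ⟪w, w⟫) := by
  rw [← Real.sqrt_sq (norm_nonneg _), ← real_inner_self_eq_norm_sq]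
  congr 1
  rw [inner_add_left, inner_add_right, inner_add_right, real_inner_smul_left,
    real_inner_smul_right, real_inner_smul_right, real_inner_smul_left, real_inner_comm w z.vec, h,
    inner_vec_self]
  ring

theorem one_add_pos (t c : ℝ) (hc : 0 ≤ c) : 0 < 1 + t * t * c := by
  have := mul_nonneg (mul_self_nonneg t) hc
  linarith

theorem fibreCurve_val {z : SphereBundle E} {w : E z.proj} (h : ⟪w, z.vec⟫ = 0) (t : ℝ) :
    (fibreCurve z w t).1 = ⟨z.proj, (√(1 + t * t * ⟪w, w⟫))⁻¹ • (z.vec + t • w)⟩ := by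
  rw [fibreCurve, toSphere_val (vec_add_ne_zero h t), norm_vec_add h]

theorem fibreCurve_zero (z : SphereBundle E) (w : E z.proj) : fibreCurve z w 0 = z := by
  have := toSphere_vec z 1 one_pos
  simpa [fibreCurve] using this

/-- The curves `fibreCurve z (s z)` depend smoothly on `z`. -/
theorem BundleFrame.contMDiff_fibreCurve (T : BundleFrame E) (s : VSection E) :
    ContMDiff (I6.prod 𝓘(ℝ, ℝ)) I6 ∞
      fun p : SphereBundle E × ℝ => fibreCurve p.1 (s.toFun p.1) p.2 := by
  intro p
  refine contMDiffAt_sphereBundle ?_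
  have h1 : (fun p : SphereBundle E × ℝ => (fibreCurve p.1 (s.toFun p.1) p.2).1)
      = fun p => ⟨p.1.proj, (√(1 + p.2 * p.2 * ⟪s.toFun p.1, s.toFun p.1⟫))⁻¹ •
        (p.1.vec + p.2 • s.toFun p.1)⟩ := funext fun p => fibreCurve_val (s.tangent p.1) p.2
  rw [h1]
  refine T.contMDiff_of_inner (contMDiff_proj.comp contMDiff_fst) (fun i => ?_) p
  simp only [real_inner_smul_left, inner_add_left]
  have hs : ∀ i, IsSmooth (I6.prod 𝓘(ℝ, ℝ)) fun p : SphereBundle E × ℝ =>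
      ⟪s.toFun p.1, T.dual i p.1.proj⟫ := fun i =>
    (SmoothAlong.inner s.smooth (smoothAlong_pullback (T.dual i))).comp contMDiff_fst
  have hv : ∀ i, IsSmooth (I6.prod 𝓘(ℝ, ℝ)) fun p : SphereBundle E × ℝ =>
      ⟪p.1.vec, T.dual i p.1.proj⟫ := fun i =>
    (SmoothAlong.inner contMDiff_vec (smoothAlong_pullback (T.dual i))).comp contMDiff_fst
  have hss : IsSmooth (I6.prod 𝓘(ℝ, ℝ)) fun p : SphereBundle E × ℝ =>
      ⟪s.toFun p.1, s.toFun p.1⟫ := (SmoothAlong.inner s.smooth s.smooth).comp contMDiff_fst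
  have ht : IsSmooth (I6.prod 𝓘(ℝ, ℝ)) fun p : SphereBundle E × ℝ => p.2 := contMDiff_snd
  have hr : IsSmooth (I6.prod 𝓘(ℝ, ℝ)) fun p : SphereBundle E × ℝ =>
      √(1 + p.2 * p.2 * ⟪s.toFun p.1, s.toFun p.1⟫) := by
    intro p
    exact (Real.contDiffAt_sqrt (one_add_pos p.2 _ real_inner_self_nonneg).ne').contMDiffAt.comp p
      ((isSmooth_const 1).add ((ht.mul ht).mul hss) p)
  refine (hr.inv fun p => ?_).mul ((hv i).add (ht.mul (hs i)))
  exact (Real.sqrt_pos.2 (one_add_pos p.2 _ real_inner_self_nonneg)).ne'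

variable (T : BundleFrame E) {z : SphereBundle E} {w : E z.proj}

include T

theorem mdifferentiableAt_fibreCurve (h : ⟪w, z.vec⟫ = 0) (t : ℝ) :
    MDifferentiableAt 𝓘(ℝ, ℝ) I6 (fibreCurve z w) t := by
  have h1 := (T.contMDiff_fibreCurve (T.vextend z w)).comp
    (contMDiff_const (c := z).prodMk contMDiff_id : ContMDiff 𝓘(ℝ, ℝ) (I6.prod 𝓘(ℝ, ℝ)) ∞
      fun t : ℝ => (z, t))
  have h2 : fibreCurve z w = fun t => fibreCurve z ((T.vextend z w).toFun z) t := by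
    rw [T.vextend_apply h]
  rw [h2]
  exact (h1 t).mdifferentiableAt (by simp)

/-- The derivative of a function along `fibreCurve z w`. -/
theorem hasDerivAt_fibreCurve (h : ⟪w, z.vec⟫ = 0) {f : SphereBundle E → ℝ} (hf : IsSmooth I6 f) :
    HasDerivAt (fun t => f (fibreCurve z w t)) (mvfderiv I6 f z (fibreVector z w)) 0 := by
  have h1 := mdifferentiableAt_fibreCurve T h 0
  have h2 : MDifferentiableAt 𝓘(ℝ, ℝ) 𝓘(ℝ, ℝ) (f ∘ fibreCurve z w) 0 :=
    (hf.mdiffAt _).comp 0 h1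
  have h3 : DifferentiableAt ℝ (f ∘ fibreCurve z w) 0 := mdifferentiableAt_iff_differentiableAt.1 h2
  have h4 : deriv (f ∘ fibreCurve z w) 0 = mvfderiv I6 f z (fibreVector z w) := by
    rw [← fderiv_apply_one_eq_deriv, ← mvfderiv_model]
    refine (dF_comp (hf.mdiffAt _) h1).trans ?_
    have h5 : ∀ (y : SphereBundle E), y = z → ∀ u : Coord4 × Coord2,
        mvfderiv I6 f y u = mvfderiv I6 f z u := by
      rintro _ rfl u; rfl
    exact h5 _ (fibreCurve_zero z w) _
  rw [← h4]
  exact h3.hasDerivAt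

theorem dπ_fibreVector (h : ⟪w, z.vec⟫ = 0) (TX : TangentFrame (𝓡 4) X) :
    dπ z (fibreVector z w) = 0 := by
  rw [← TX.sum_eq z.proj (dπ z (fibreVector z w))]
  refine Finset.sum_eq_zero fun k _ => ?_
  have h1 := hasDerivAt_fibreCurve T h (TX.smooth k).pullback
  have h2 : (fun t => TX.coord k (fibreCurve z w t).proj) = fun _ => TX.coord k z.proj := rfl
  rw [h2] at h1
  rw [← dF_pullback (TX.smooth k), (hasDerivAt_const 0 _).unique h1 |>.symm, zero_smul]

theorem mvfderiv_inner_vec_fibreVector (h : ⟪w, z.vec⟫ = 0) (σ : Sec E) :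
    mvfderiv I6 (fun y : SphereBundle E => ⟪y.vec, σ y.proj⟫) z (fibreVector z w)
      = ⟪w, σ z.proj⟫ := by
  have h1 := hasDerivAt_fibreCurve T h (SmoothAlong.inner contMDiff_vec (smoothAlong_pullback σ))
  refine h1.unique ?_
  have h2 : (fun t => ⟪(fibreCurve z w t).vec, σ (fibreCurve z w t).proj⟫)
      = fun t => (√(1 + t * t * ⟪w, w⟫))⁻¹ * (⟪z.vec, σ z.proj⟫ + t * ⟪w, σ z.proj⟫) := by
    funext t
    have h3 : ∀ p : TotalSpace Fib E, p = ⟨z.proj, (√(1 + t * t * ⟪w, w⟫))⁻¹ • (z.vec + t • w)⟩ →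
        ⟪p.2, σ p.proj⟫ = (√(1 + t * t * ⟪w, w⟫))⁻¹ * (⟪z.vec, σ z.proj⟫ + t * ⟪w, σ z.proj⟫) := by
      rintro _ rfl
      simp only [real_inner_smul_left, inner_add_left]
    exact h3 _ (fibreCurve_val h t)
  rw [h2]
  have hq : HasDerivAt (fun t : ℝ => 1 + t * t * ⟪w, w⟫) 0 0 := by
    have := (((hasDerivAt_id (0 : ℝ)).mul (hasDerivAt_id (0 : ℝ))).mul_const ⟪w, w⟫).const_add 1
    simpa using this
  have hr := (hq.sqrt (by simp)).fun_inv (by simp)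
  have hl := ((hasDerivAt_id (0 : ℝ)).mul_const ⟪w, σ z.proj⟫).const_add ⟪z.vec, σ z.proj⟫
  have := hr.fun_mul hl
  simpa using this

/-- The derivative of a section of `π^*E` along `fibreCurve z w`, in the fixed space `E (π z)`. -/
theorem hasDerivAt_section_fibreCurve (TX : TangentFrame (𝓡 4) X) (A : MetricConnection E)
    (h : ⟪w, z.vec⟫ = 0)
    {s : ∀ z : SphereBundle E, E z.proj} (hs : SmoothAlong s) :
    HasDerivAt (F := E z.proj) (fun t : ℝ => s (fibreCurve z w t))
      (pullbackDeriv A s z (fibreVector z w)) 0 := by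
  have h1 : ∀ i, HasDerivAt
      (fun t : ℝ => (⟪s (fibreCurve z w t), T.dual i (fibreCurve z w t).proj⟫ : ℝ))
      (mvfderiv I6 (fun y => ⟪s y, T.dual i y.proj⟫) z (fibreVector z w)) 0 := fun i =>
    hasDerivAt_fibreCurve T h (hs.inner (smoothAlong_pullback (T.dual i)))
  have h2 := HasDerivAt.fun_sum (u := Finset.univ) fun i _ => (h1 i).smul_const (T.sec i z.proj)
  have h3 : (fun t : ℝ => ∑ i, (⟪s (fibreCurve z w t), T.dual i (fibreCurve z w t).proj⟫ : ℝ)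
      • T.sec i z.proj) = fun t => (s (fibreCurve z w t) : E z.proj) :=
    funext fun t => T.sum_eq z.proj (s (fibreCurve z w t))
  rw [h3] at h2
  convert h2 using 1
  rw [T.pullbackDeriv_eq A hs, dπ_fibreVector T h TX]
  simp

theorem pullbackDeriv_vec_fibreVector (TX : TangentFrame (𝓡 4) X) (A : MetricConnection E)
    (h : ⟪w, z.vec⟫ = 0) :
    pullbackDeriv A SphereBundle.vec z (fibreVector z w) = w := by
  rw [T.pullbackDeriv_eq A contMDiff_vec, dπ_fibreVector T h TX]
  simp only [mvfderiv_inner_vec_fibreVector T h, map_zero, smul_zero, zero_add, T.sum_eq]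

theorem inner_pullbackDeriv_vec (A : MetricConnection E) (v : TangentSpace I6 z) :
    ⟪pullbackDeriv A SphereBundle.vec z v, z.vec⟫ = 0 := by
  have h := pullbackDeriv_metric T A z v contMDiff_vec contMDiff_vec
  simp only [inner_vec_self] at h
  rw [dF_const, real_inner_comm z.vec] at h
  rw [real_inner_comm z.vec]
  linarith

theorem inner_pullbackDeriv_vsection (A : MetricConnection E) (s : VSection E)
    (v : TangentSpace I6 z) :
    ⟪pullbackDeriv A s.toFun z v, z.vec⟫
      = -⟪s.toFun z, pullbackDeriv A SphereBundle.vec z v⟫ := by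
  have h := pullbackDeriv_metric T A z v s.smooth contMDiff_vec
  simp only [s.tangent] at h
  rw [dF_const] at h
  linarith

/-- The induced connection in `V` is the orthogonal projection of the pulled back connection. -/
theorem inducedDeriv_eq (TX : TangentFrame (𝓡 4) X) (A : MetricConnection E) (s : VSection E)
    (v : TangentSpace I6 z) :
    inducedDeriv A s.toFun z v = vproj z (pullbackDeriv A s.toFun z v) := by
  have hν := inner_pullbackDeriv_vec T A v
  unfold inducedDeriv sphereLC
  simp only
  set ν := pullbackDeriv A SphereBundle.vec z v with hνdef
  rw [(hasDerivAt_section_fibreCurve T TX A hν s.smooth).deriv]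
  have hsplit : v = fibreVector z ν + (v - fibreVector z ν) := by abel
  have h0 : pullbackDeriv A SphereBundle.vec z (v - fibreVector z ν) = 0 := by
    have := pullbackDeriv_add_vector T A z (fibreVector z ν) contMDiff_vec (v - fibreVector z ν)
    rw [← hsplit, pullbackDeriv_vec_fibreVector T TX A hν] at this
    simpa [← hνdef] using this
  have h1 := inner_pullbackDeriv_vsection T A s (v - fibreVector z ν)
  rw [h0, inner_zero_right, neg_zero] at h1
  conv_rhs => rw [hsplit, pullbackDeriv_add_vector T A z _ s.smooth, vproj_add,
    vproj_of_tangent h1]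
  rfl

end Vertical

/-! ### The area form of the fibres and the induced connection -/

section Induced
variable {X : Type*} [TopologicalSpace X] [ChartedSpace Coord4 X] [IsManifold (𝓡 4) ∞ X]
  {E : X → Type*} [TopologicalSpace (TotalSpace Fib E)]
  [∀ x, NormedAddCommGroup (E x)] [∀ x, InnerProductSpace ℝ (E x)]
  [FiberBundle Fib E] [VectorBundle ℝ Fib E] [ContMDiffVectorBundle ∞ Fib E (𝓡 4)]
  [IsContMDiffRiemannianBundle (𝓡 4) ∞ Fib E]

theorem finrank_fibre (x : X) : finrank ℝ (E x) = 3 := by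
  rw [(VectorBundle.continuousLinearEquivAt ℝ Fib E x).toLinearEquiv.finrank_eq]
  simp

theorem finiteDimensional_fibre (x : X) : FiniteDimensional ℝ (E x) :=
  FiniteDimensional.of_finrank_pos (by rw [finrank_fibre]; norm_num)

/-- An orthonormal basis of the fibre of `E` whose first vector is `z`. -/
theorem exists_basis_vec (z : SphereBundle E) :
    ∃ b : OrthonormalBasis (Fin 3) ℝ (E z.proj), b 0 = z.vec := by
  have := finiteDimensional_fibre (E := E) z.proj
  have hv : Orthonormal ℝ (({0} : Set (Fin 3)).domRestrict fun _ => z.vec) :=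
    ⟨fun _ => z.norm_vec, fun i j hij => (hij (Subsingleton.elim i j)).elim⟩
  obtain ⟨b, hb⟩ := hv.exists_orthonormalBasis_extension_of_card_eq (by simp [finrank_fibre])
  exact ⟨b, hb 0 rfl⟩

/-- An orthonormal basis of `E (π z)` with first vector `z`. -/
def adaptedBasis (z : SphereBundle E) : OrthonormalBasis (Fin 3) ℝ (E z.proj) :=
  (exists_basis_vec z).choose

theorem adaptedBasis_zero (z : SphereBundle E) : adaptedBasis z 0 = z.vec :=
  (exists_basis_vec z).choose_spec

theorem adaptedBasis_inner_vec (z : SphereBundle E) {i : Fin 3} (hi : i ≠ 0) :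
    ⟪adaptedBasis z i, z.vec⟫ = 0 := by
  rw [← adaptedBasis_zero z]
  exact (adaptedBasis z).orthonormal.2 hi

theorem eq_adaptedBasis {z : SphereBundle E} {w : E z.proj} (h : ⟪w, z.vec⟫ = 0) :
    w = ⟪w, adaptedBasis z 1⟫ • adaptedBasis z 1 + ⟪w, adaptedBasis z 2⟫ • adaptedBasis z 2 := by
  conv_lhs => rw [← (adaptedBasis z).sum_repr' w, Fin.sum_univ_three, adaptedBasis_zero,
    real_inner_comm, h, zero_smul, zero_add]
  rw [real_inner_comm w, real_inner_comm w]

theorem inner_adaptedBasis {z : SphereBundle E} {v w : E z.proj} (h : ⟪v, z.vec⟫ = 0) :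
    ⟪v, w⟫ = ⟪v, adaptedBasis z 1⟫ * ⟪w, adaptedBasis z 1⟫
      + ⟪v, adaptedBasis z 2⟫ * ⟪w, adaptedBasis z 2⟫ := by
  conv_lhs => rw [eq_adaptedBasis h, inner_add_left, real_inner_smul_left, real_inner_smul_left,
    real_inner_comm w, real_inner_comm w]

theorem alternatingMap_sum_apply {V ι κ : Type*} [AddCommGroup V] [Module ℝ V] (a : Finset ι)
    (f : ι → V [⋀^κ]→ₗ[ℝ] ℝ) (v : κ → V) : (∑ i ∈ a, f i) v = ∑ i ∈ a, f i v := by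
  classical
  induction a using Finset.induction_on with
  | empty => simp
  | insert i s hi ih => simp [Finset.sum_insert hi, ih]

namespace FibreOrientation
variable (o : FibreOrientation E) (z : SphereBundle E)

theorem vol_sum_first {x : X} {ι : Type*} (a : Finset ι) (f : ι → ℝ) (σ : ι → E x) (v w : E x) :
    o.vol x ![∑ i ∈ a, f i • σ i, v, w] = ∑ i ∈ a, f i * o.vol x ![σ i, v, w] := by
  change (o.vol x).curryLeft (∑ i ∈ a, f i • σ i) ![v, w] = _
  rw [map_sum, alternatingMap_sum_apply]
  simp

theorem vol_sum_second {x : X} {ι : Type*} (a : Finset ι) (f : ι → ℝ) (σ : ι → E x) (v w : E x) :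
    o.vol x ![v, ∑ i ∈ a, f i • σ i, w] = ∑ i ∈ a, f i * o.vol x ![v, σ i, w] := by
  change ((o.vol x).curryLeft v).curryLeft (∑ i ∈ a, f i • σ i) ![w] = _
  rw [map_sum, alternatingMap_sum_apply]
  simp

theorem vol_sum_third {x : X} {ι : Type*} (a : Finset ι) (f : ι → ℝ) (σ : ι → E x) (v w : E x) :
    o.vol x ![v, w, ∑ i ∈ a, f i • σ i] = ∑ i ∈ a, f i * o.vol x ![v, w, σ i] := by
  change (((o.vol x).curryLeft v).curryLeft w).curryLeft (∑ i ∈ a, f i • σ i) ![] = _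
  rw [map_sum, alternatingMap_sum_apply]
  simp

theorem area_add_left (s t u : E z.proj) : o.area z (s + t) u = o.area z s u + o.area z t u := by
  change ((o.vol z.proj).curryLeft z.vec).curryLeft (s + t) ![u] = _
  rw [map_add]; rfl

theorem area_smul_left (c : ℝ) (s u : E z.proj) : o.area z (c • s) u = c * o.area z s u := by
  change ((o.vol z.proj).curryLeft z.vec).curryLeft (c • s) ![u] = _
  rw [map_smul]; rfl

theorem area_swap (s t : E z.proj) : o.area z s t = -o.area z t s := by
  unfold area
  have := (o.vol z.proj).map_swap ![z.vec, t, s] (show (1 : Fin 3) ≠ 2 by decide)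
  rw [← this]
  congr 1
  funext i
  fin_cases i <;> rfl

theorem area_self (s : E z.proj) : o.area z s s = 0 := by
  have := o.area_swap z s s
  linarith

theorem area_add_right (s t u : E z.proj) : o.area z u (s + t) = o.area z u s + o.area z u t := by
  rw [area_swap, area_add_left, area_swap o z s, area_swap o z t]; ring

theorem area_smul_right (c : ℝ) (s u : E z.proj) : o.area z u (c • s) = c * o.area z u s := by
  rw [area_swap, area_smul_left, area_swap o z s]; ring

theorem area_adaptedBasis_sq :
    o.area z (adaptedBasis z 1) (adaptedBasis z 2)
      * o.area z (adaptedBasis z 1) (adaptedBasis z 2) = 1 := by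
  have h : o.area z (adaptedBasis z 1) (adaptedBasis z 2) = o.vol z.proj (adaptedBasis z) := by
    unfold area
    congr 1
    funext i
    fin_cases i
    · exact (adaptedBasis_zero z).symm
    · rfl
    · rfl
  rw [h, ← abs_mul_abs_self, o.unit, one_mul]

theorem area_adaptedBasis_ne : o.area z (adaptedBasis z 1) (adaptedBasis z 2) ≠ 0 := fun h => by
  have := o.area_adaptedBasis_sq z
  rw [h] at this
  norm_num at this

theorem area_eq_coord {s t : E z.proj} (hs : ⟪s, z.vec⟫ = 0) (ht : ⟪t, z.vec⟫ = 0) :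
    o.area z s t = (⟪s, adaptedBasis z 1⟫ * ⟪t, adaptedBasis z 2⟫
      - ⟪s, adaptedBasis z 2⟫ * ⟪t, adaptedBasis z 1⟫)
      * o.area z (adaptedBasis z 1) (adaptedBasis z 2) := by
  conv_lhs => rw [eq_adaptedBasis hs, eq_adaptedBasis ht]
  simp only [area_add_left, area_smul_left, area_add_right, area_smul_right, area_self]
  rw [o.area_swap z (adaptedBasis z 2)]
  ring

/-- The product of two values of the area form is a Gram determinant. -/
theorem area_mul_area {s t s' t' : E z.proj} (hs : ⟪s, z.vec⟫ = 0) (ht : ⟪t, z.vec⟫ = 0)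
    (hs' : ⟪s', z.vec⟫ = 0) (ht' : ⟪t', z.vec⟫ = 0) :
    o.area z s t * o.area z s' t' = ⟪s, s'⟫ * ⟪t, t'⟫ - ⟪s, t'⟫ * ⟪t, s'⟫ := by
  rw [o.area_eq_coord z hs ht, o.area_eq_coord z hs' ht', inner_adaptedBasis hs (w := s'),
    inner_adaptedBasis ht (w := t'), inner_adaptedBasis hs (w := t'),
    inner_adaptedBasis ht (w := s')]
  have := o.area_adaptedBasis_sq z
  linear_combination (⟪s, adaptedBasis z 1⟫ * ⟪t, adaptedBasis z 2⟫
      - ⟪s, adaptedBasis z 2⟫ * ⟪t, adaptedBasis z 1⟫) * (⟪s', adaptedBasis z 1⟫ *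
      ⟪t', adaptedBasis z 2⟫ - ⟪s', adaptedBasis z 2⟫ * ⟪t', adaptedBasis z 1⟫) * this

theorem isSmooth_vol (T : BundleFrame E) {a b c : ∀ z : SphereBundle E, E z.proj}
    (ha : SmoothAlong a) (hb : SmoothAlong b) (hc : SmoothAlong c) :
    IsSmooth I6 fun z => o.vol z.proj ![a z, b z, c z] := by
  have h : (fun z => o.vol z.proj ![a z, b z, c z]) = fun z => ∑ k, ⟪c z, T.dual k z.proj⟫ *
      ∑ j, ⟪b z, T.dual j z.proj⟫ * ∑ i, ⟪a z, T.dual i z.proj⟫ *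
        o.vol z.proj ![T.sec i z.proj, T.sec j z.proj, T.sec k z.proj] := by
    funext z
    conv_lhs => rw [← T.sum_eq _ (a z), ← T.sum_eq _ (b z), ← T.sum_eq _ (c z)]
    simp only [vol_sum_first, vol_sum_second, vol_sum_third]
  rw [h]
  refine IsSmooth.sum fun k _ => (hc.inner (smoothAlong_pullback _)).mul <|
    IsSmooth.sum fun j _ => (hb.inner (smoothAlong_pullback _)).mul <|
    IsSmooth.sum fun i _ => (ha.inner (smoothAlong_pullback _)).mul ?_
  have := IsSmooth.pullback (E := E) (o.smooth ![T.sec i, T.sec j, T.sec k])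
  refine this.congr fun z => ?_
  congr 1
  funext l
  fin_cases l <;> rfl

theorem isSmooth_area (T : BundleFrame E) (s t : VSection E) :
    IsSmooth I6 fun z => o.area z (s.toFun z) (t.toFun z) :=
  o.isSmooth_vol T contMDiff_vec s.smooth t.smooth

end FibreOrientation

variable (T : BundleFrame E) (TX : TangentFrame (𝓡 4) X) (o : FibreOrientation E)

include T

/-- Sections of `V` that are linearly independent at a given point. -/
theorem exists_vsections (z : SphereBundle E) :
    ∃ s t : VSection E, o.area z (s.toFun z) (t.toFun z) ≠ 0 := by
  refine ⟨T.vextend z (adaptedBasis z 1), T.vextend z (adaptedBasis z 2), ?_⟩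
  rw [T.vextend_apply (adaptedBasis_inner_vec z (by decide)),
    T.vextend_apply (adaptedBasis_inner_vec z (by decide))]
  exact o.area_adaptedBasis_ne z

theorem vproj_pullbackDeriv_metric (A : MetricConnection E) (s t : VSection E)
    (z : SphereBundle E) (v : TangentSpace I6 z) :
    mvfderiv I6 (fun y => ⟪s.toFun y, t.toFun y⟫) z v
      = ⟪vproj z (pullbackDeriv A s.toFun z v), t.toFun z⟫
        + ⟪s.toFun z, vproj z (pullbackDeriv A t.toFun z v)⟫ := by
  rw [inner_vproj_left _ (t.tangent z), inner_vproj_right _ (s.tangent z)]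
  exact pullbackDeriv_metric T A z v s.smooth t.smooth

/-- The area form is parallel: the product of two values of the area form is a Gram determinant,
and the derivative of the latter is given by the metric property of the connection. -/
theorem vproj_pullbackDeriv_area (A : MetricConnection E) (s t : VSection E)
    (z : SphereBundle E) (v : TangentSpace I6 z) :
    mvfderiv I6 (fun y => o.area y (s.toFun y) (t.toFun y)) z v
      = o.area z (vproj z (pullbackDeriv A s.toFun z v)) (t.toFun z)
        + o.area z (s.toFun z) (vproj z (pullbackDeriv A t.toFun z v)) := by
  let B : VSection E → E z.proj := fun s => vproj z (pullbackDeriv A s.toFun z v)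
  have hB : ∀ s, ⟪B s, z.vec⟫ = 0 := fun s => inner_vproj_vec z _
  let defect : VSection E → VSection E → ℝ := fun s t =>
    mvfderiv I6 (fun y => o.area y (s.toFun y) (t.toFun y)) z v
      - o.area z (B s) (t.toFun z) - o.area z (s.toFun z) (B t)
  have key : ∀ s t s' t' : VSection E, defect s t * o.area z (s'.toFun z) (t'.toFun z)
      + o.area z (s.toFun z) (t.toFun z) * defect s' t' = 0 := by
    intro s t s' t'
    have h1 : (fun y => o.area y (s.toFun y) (t.toFun y) * o.area y (s'.toFun y) (t'.toFun y))
        = fun y => ⟪s.toFun y, s'.toFun y⟫ * ⟪t.toFun y, t'.toFun y⟫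
          - ⟪s.toFun y, t'.toFun y⟫ * ⟪t.toFun y, s'.toFun y⟫ := funext fun y =>
      o.area_mul_area y (s.tangent y) (t.tangent y) (s'.tangent y) (t'.tangent y)
    have h2 := congrArg (fun f => mvfderiv I6 f z v) h1
    have hi : ∀ s t : VSection E, IsSmooth I6 fun y => ⟪s.toFun y, t.toFun y⟫ := fun s t =>
      SmoothAlong.inner s.smooth t.smooth
    beta_reduce at h2
    rw [dF_mul ((o.isSmooth_area T s t).mdiffAt z) ((o.isSmooth_area T s' t').mdiffAt z),
      dF_sub (((hi _ _).mul (hi _ _)).mdiffAt z) (((hi _ _).mul (hi _ _)).mdiffAt z),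
      dF_mul ((hi _ _).mdiffAt z) ((hi _ _).mdiffAt z),
      dF_mul ((hi _ _).mdiffAt z) ((hi _ _).mdiffAt z)] at h2
    simp only [vproj_pullbackDeriv_metric T A] at h2
    have e1 := o.area_mul_area z (hB s) (t.tangent z) (s'.tangent z) (t'.tangent z)
    have e2 := o.area_mul_area z (s.tangent z) (hB t) (s'.tangent z) (t'.tangent z)
    have e3 := o.area_mul_area z (s.tangent z) (t.tangent z) (hB s') (t'.tangent z)
    have e4 := o.area_mul_area z (s.tangent z) (t.tangent z) (s'.tangent z) (hB t')
    simp only [defect, B] at e1 e2 e3 e4 ⊢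
    linear_combination h2 - e1 - e2 - e3 - e4
  -- The case `(s', t') = (s, t)` of `key` gives `defect s' t' = 0`, and then `key` shows that all
  -- other defects vanish.
  obtain ⟨s', t', hne⟩ := exists_vsections T o z
  have h1 : defect s' t' = 0 := by
    have := key s' t' s' t'
    have h2 : o.area z (s'.toFun z) (t'.toFun z) * (2 * defect s' t') = 0 := by linarith
    have := (mul_eq_zero.1 h2).resolve_left hne
    linarith
  have h2 := key s t s' t'
  rw [h1, mul_zero, add_zero] at h2
  have h3 := (mul_eq_zero.1 h2).resolve_right hne
  simp only [defect, B] at h3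
  linarith

/-- The connection `A_V` induced by `A`. -/
def inducedConnection (A : MetricConnection E) : UnitaryConnection o where
  toFun s z :=
    { toFun v := vproj z (pullbackDeriv A s.toFun z v)
      map_add' v w := by rw [pullbackDeriv_add_vector T A z v s.smooth, vproj_add]
      map_smul' c v := by rw [pullbackDeriv_smul_vector T A z v s.smooth, vproj_smul]; rfl }
  tangent s z v := inner_vproj_vec z _
  add s t u h z := by
    ext v
    have hu : u.toFun = fun z => s.toFun z + t.toFun z := funext h
    change vproj z (pullbackDeriv A u.toFun z v) = vproj z (pullbackDeriv A s.toFun z v)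
      + vproj z (pullbackDeriv A t.toFun z v)
    rw [hu, pullbackDeriv_add T A z v s.smooth t.smooth, vproj_add]
  leibniz f s t hf h z v := by
    have ht : t.toFun = fun z => f z • s.toFun z := funext h
    change vproj z (pullbackDeriv A t.toFun z v) = f z • vproj z (pullbackDeriv A s.toFun z v) + _
    rw [ht, pullbackDeriv_smul T A z v hf s.smooth, vproj_add, vproj_smul, vproj_smul,
      vproj_of_tangent (s.tangent z)]
  metric s t z v := vproj_pullbackDeriv_metric T A s t z v
  area s t z v := vproj_pullbackDeriv_area T o A s t z v
  smooth s U := T.smoothAlong_vproj (smoothAlong_pullbackDeriv T TX A s.smooth U)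

theorem inducedConnection_apply (A : MetricConnection E) (s : VSection E) (z : SphereBundle E)
    (v : TangentSpace I6 z) :
    (inducedConnection T TX o A).toFun s z v = vproj z (pullbackDeriv A s.toFun z v) := rfl

theorem isInduced_inducedConnection (A : MetricConnection E) :
    IsInduced A (inducedConnection T TX o A) :=
  fun s _ v => (inducedDeriv_eq T TX A s v).symm

end Induced

/-! ### The curvature tensor -/

section Curvature
variable {X : Type*} [TopologicalSpace X] [ChartedSpace Coord4 X] [IsManifold (𝓡 4) ∞ X]
  {E : X → Type*} [TopologicalSpace (TotalSpace Fib E)]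
  [∀ x, NormedAddCommGroup (E x)] [∀ x, InnerProductSpace ℝ (E x)]
  [FiberBundle Fib E] [VectorBundle ℝ Fib E] [ContMDiffVectorBundle ∞ Fib E (𝓡 4)]
  [IsContMDiffRiemannianBundle (𝓡 4) ∞ Fib E] [T2Space X] [CompactSpace X]

theorem ext_inner_left {x : X} {v w : E x} (h : ∀ t : E x, ⟪v, t⟫ = ⟪w, t⟫) : v = w :=
  ext_inner_right ℝ h

variable (TX : TangentFrame (𝓡 4) X) (A : MetricConnection E)

/-- `F_A(u, w) σ` at `x` for tangent vectors `u` and `w`, in terms of a tangent frame. The formula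
is bilinear in `u` and `w` by definition, and the bracket term of the curvature does not occur in
it. -/
def curvTensor (x : X) (u w : TangentSpace (𝓡 4) x) (σ : Sec E) : E x :=
  ∑ l, ∑ k, (mvfderiv (𝓡 4) (TX.coord l) x u * mvfderiv (𝓡 4) (TX.coord k) x w) •
    (A.toFun (A.cov (TX.field k) σ) x (TX.field l x)
      - A.toFun (A.cov (TX.field l) σ) x (TX.field k x))

theorem toFun_eq_sum_field (σ : Sec E) (x : X) (v : TangentSpace (𝓡 4) x) :
    A.toFun σ x v = ∑ k, mvfderiv (𝓡 4) (TX.coord k) x v • A.toFun σ x (TX.field k x) := by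
  conv_lhs => rw [← TX.sum_eq x v, map_sum]
  simp only [map_smul]

theorem curvTensor_add_left (x : X) (u u' w : TangentSpace (𝓡 4) x) (σ : Sec E) :
    curvTensor TX A x (u + u') w σ = curvTensor TX A x u w σ + curvTensor TX A x u' w σ := by
  simp only [curvTensor, map_add, add_mul, add_smul, Finset.sum_add_distrib]

theorem curvTensor_smul_left (x : X) (c : ℝ) (u w : TangentSpace (𝓡 4) x) (σ : Sec E) :
    curvTensor TX A x (c • u) w σ = c • curvTensor TX A x u w σ := by
  simp only [curvTensor, map_smul, smul_eq_mul, mul_assoc, Finset.smul_sum, mul_smul]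

theorem curvTensor_swap (x : X) (u w : TangentSpace (𝓡 4) x) (σ : Sec E) :
    curvTensor TX A x u w σ = -curvTensor TX A x w u σ := by
  simp only [curvTensor, ← Finset.sum_neg_distrib]
  rw [Finset.sum_comm]
  refine Finset.sum_congr rfl fun l _ => Finset.sum_congr rfl fun k _ => ?_
  module

theorem cov_eq_sum (W : VF (𝓡 4) X) (σ : Sec E) : A.cov W σ
    = ∑ k, Sec.mul (lieD W (TX.coord k)) ((TX.smooth k).lieD W) (A.cov (TX.field k) σ) := by
  apply ContMDiffSection.ext
  intro x
  rw [Sec.sum_apply]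
  exact toFun_eq_sum_field TX A σ x (W x)

theorem cov_cov_eq_sum (U W : VF (𝓡 4) X) (σ : Sec E) (x : X) : A.cov U (A.cov W σ) x
    = ∑ k, (lieD W (TX.coord k) x • A.toFun (A.cov (TX.field k) σ) x (U x)
      + lieD U (lieD W (TX.coord k)) x • A.cov (TX.field k) σ x) := by
  change A.toFun (A.cov W σ) x (U x) = _
  rw [cov_eq_sum TX A W σ, A.toFun_sum]
  exact Finset.sum_congr rfl fun k _ => A.toFun_mul _ _ _ _

theorem curvTensor_eq_sub (x : X) (u w : TangentSpace (𝓡 4) x) (σ : Sec E) :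
    curvTensor TX A x u w σ
      = ∑ k, mvfderiv (𝓡 4) (TX.coord k) x w • A.toFun (A.cov (TX.field k) σ) x u
        - ∑ k, mvfderiv (𝓡 4) (TX.coord k) x u • A.toFun (A.cov (TX.field k) σ) x w := by
  have h : ∀ u w : TangentSpace (𝓡 4) x,
      ∑ k, mvfderiv (𝓡 4) (TX.coord k) x w • A.toFun (A.cov (TX.field k) σ) x u
      = ∑ l, ∑ k, (mvfderiv (𝓡 4) (TX.coord l) x u * mvfderiv (𝓡 4) (TX.coord k) x w) •
        A.toFun (A.cov (TX.field k) σ) x (TX.field l x) := by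
    intro u w
    rw [Finset.sum_comm]
    refine Finset.sum_congr rfl fun k _ => ?_
    rw [toFun_eq_sum_field TX A _ x u, Finset.smul_sum]
    refine Finset.sum_congr rfl fun l _ => ?_
    module
  rw [h u w, h w u, Finset.sum_comm (f := fun l k => (mvfderiv (𝓡 4) (TX.coord l) x w * _) • _)]
  simp only [curvTensor, ← Finset.sum_sub_distrib]
  refine Finset.sum_congr rfl fun l _ => Finset.sum_congr rfl fun k _ => ?_
  module

/-- The second derivatives of the coordinates of the frame, which come from the product rule, cancel
against the bracket term. -/
theorem curvature_eq_curvTensor (U W : VF (𝓡 4) X) (σ : Sec E) (x : X) :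
    A.curvature U W σ x = curvTensor TX A x (U x) (W x) σ := by
  unfold MetricConnection.curvature
  rw [cov_cov_eq_sum TX, cov_cov_eq_sum TX, curvTensor_eq_sub,
    toFun_eq_sum_field TX A σ x (VectorField.mlieBracket _ _ _ _)]
  simp only [TX.lieD_bracket (TX.smooth _), Finset.sum_add_distrib, sub_smul,
    Finset.sum_sub_distrib]
  simp only [lieD, MetricConnection.cov]
  simp only [ContMDiffSection.coeFn_mk]
  abel

include TX in
/-- The curvature is skew, since the connection is metric. -/
theorem inner_curvature (U W : VF (𝓡 4) X) (σ τ : Sec E) (x : X) :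
    ⟪A.curvature U W σ x, τ x⟫ = -⟪σ x, A.curvature U W τ x⟫ := by
  have hi : ∀ σ τ : Sec E, IsSmooth (𝓡 4) fun x => ⟪σ x, τ x⟫ := fun σ τ =>
    ContMDiff.inner_bundle σ.contMDiff τ.contMDiff
  have h1 : ∀ U : VF (𝓡 4) X, lieD U (fun y => ⟪σ y, τ y⟫)
      = fun y => ⟪A.cov U σ y, τ y⟫ + ⟪σ y, A.cov U τ y⟫ := fun U => funext fun y =>
    A.metric σ τ y (U y)
  have h2 : ∀ U W : VF (𝓡 4) X, lieD U (lieD W (fun y => ⟪σ y, τ y⟫)) x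
      = ⟪A.cov U (A.cov W σ) x, τ x⟫ + ⟪A.cov W σ x, A.cov U τ x⟫
        + (⟪A.cov U σ x, A.cov W τ x⟫ + ⟪σ x, A.cov U (A.cov W τ) x⟫) := by
    intro U W
    rw [h1]
    refine (dF_add ((hi _ _).mdiffAt x) ((hi _ _).mdiffAt x)).trans ?_
    rw [A.metric, A.metric]
    rfl
  have h3 := TX.lieD_bracket (hi σ τ) U W x
  rw [h2, h2, A.metric] at h3
  simp only [MetricConnection.curvature, inner_sub_left, inner_sub_right]
  linarith

variable (T : BundleFrame E)
include T

theorem inner_curvTensor (x : X) (u w : TangentSpace (𝓡 4) x) (σ τ : Sec E) :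
    ⟪curvTensor TX A x u w σ, τ x⟫ = -⟪σ x, curvTensor TX A x u w τ⟫ := by
  have := inner_curvature TX A (TX.extend x u) (TX.extend x w) σ τ x
  simpa only [curvature_eq_curvTensor TX, TX.extend_apply] using this

/-- The curvature is a tensor: it depends on the value of the section only. -/
theorem curvTensor_congr (x : X) (u w : TangentSpace (𝓡 4) x) {σ σ' : Sec E} (h : σ x = σ' x) :
    curvTensor TX A x u w σ = curvTensor TX A x u w σ' := by
  refine ext_inner_left fun t => ?_
  rw [← T.extend_apply x t, inner_curvTensor TX A T, h, inner_curvTensor TX A T]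

/-- `⟪F_A(u, w) e, e'⟫`. -/
def curvForm (x : X) (u w : TangentSpace (𝓡 4) x) (e e' : E x) : ℝ :=
  ⟪curvTensor TX A x u w (T.extend x e), e'⟫

theorem curvForm_eq (x : X) (u w : TangentSpace (𝓡 4) x) (σ : Sec E) (e : E x) :
    curvForm TX A T x u w (σ x) e = ⟪curvTensor TX A x u w σ, e⟫ := by
  rw [curvForm, curvTensor_congr TX A T x u w (T.extend_apply x (σ x))]

theorem curvForm_swap (x : X) (u w : TangentSpace (𝓡 4) x) (e e' : E x) :
    curvForm TX A T x u w e e' = -curvForm TX A T x w u e e' := by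
  rw [curvForm, curvTensor_swap, inner_neg_left, curvForm]

theorem curvForm_skew (x : X) (u w : TangentSpace (𝓡 4) x) (e e' : E x) :
    curvForm TX A T x u w e e' = -curvForm TX A T x u w e' e := by
  have := inner_curvTensor TX A T x u w (T.extend x e) (T.extend x e')
  rw [T.extend_apply, T.extend_apply, real_inner_comm] at this
  rw [curvForm, curvForm, real_inner_comm, this, real_inner_comm]

theorem curvForm_add_left (x : X) (u u' w : TangentSpace (𝓡 4) x) (e e' : E x) :
    curvForm TX A T x (u + u') w e e'
      = curvForm TX A T x u w e e' + curvForm TX A T x u' w e e' := by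
  rw [curvForm, curvTensor_add_left, inner_add_left]; rfl

theorem curvForm_smul_left (x : X) (c : ℝ) (u w : TangentSpace (𝓡 4) x) (e e' : E x) :
    curvForm TX A T x (c • u) w e e' = c * curvForm TX A T x u w e e' := by
  rw [curvForm, curvTensor_smul_left, real_inner_smul_left]; rfl

theorem curvForm_add_third (x : X) (u w : TangentSpace (𝓡 4) x) (e₁ e₂ e' : E x) :
    curvForm TX A T x u w (e₁ + e₂) e'
      = curvForm TX A T x u w e₁ e' + curvForm TX A T x u w e₂ e' := by
  rw [curvForm_skew, curvForm_skew TX A T x u w e₁, curvForm_skew TX A T x u w e₂]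
  simp only [curvForm, inner_add_right]
  ring

theorem curvForm_smul_third (x : X) (c : ℝ) (u w : TangentSpace (𝓡 4) x) (e e' : E x) :
    curvForm TX A T x u w (c • e) e' = c * curvForm TX A T x u w e e' := by
  rw [curvForm_skew, curvForm_skew TX A T x u w e]
  simp only [curvForm, real_inner_smul_right]
  ring

theorem curvForm_add_fourth (x : X) (u w : TangentSpace (𝓡 4) x) (e e₁ e₂ : E x) :
    curvForm TX A T x u w e (e₁ + e₂) = curvForm TX A T x u w e e₁ + curvForm TX A T x u w e e₂ :=
  inner_add_right _ _ _

theorem curvForm_smul_fourth (x : X) (c : ℝ) (u w : TangentSpace (𝓡 4) x) (e e' : E x) :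
    curvForm TX A T x u w e (c • e') = c * curvForm TX A T x u w e e' :=
  real_inner_smul_right _ _ _

/-! ### The curvature of the pulled back connection -/

/-- The curvature `R(U, W) s` of `π^*∇`. -/
def pullbackCurv (A : MetricConnection E) (U W : VF I6 (SphereBundle E))
    (s : ∀ z : SphereBundle E, E z.proj) (z : SphereBundle E) : E z.proj :=
  pullbackDeriv A (fun y => pullbackDeriv A s y (W y)) z (U z)
    - pullbackDeriv A (fun y => pullbackDeriv A s y (U y)) z (W z)
    - pullbackDeriv A s z (VectorField.mlieBracket I6 U W z)

variable (TZ : TangentFrame I6 (SphereBundle E)) (U W : VF I6 (SphereBundle E))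
  (z : SphereBundle E)

include TX TZ in
theorem inner_pullbackCurv {s t : ∀ z : SphereBundle E, E z.proj} (hs : SmoothAlong s)
    (ht : SmoothAlong t) : ⟪pullbackCurv A U W s z, t z⟫ = -⟪s z, pullbackCurv A U W t z⟫ := by
  have hD := fun {s : ∀ z : SphereBundle E, E z.proj} (hs : SmoothAlong s) U =>
    smoothAlong_pullbackDeriv T TX A hs U
  have h1 : ∀ U : VF I6 (SphereBundle E), lieD U (fun y => ⟪s y, t y⟫)
      = fun y => ⟪pullbackDeriv A s y (U y), t y⟫ + ⟪s y, pullbackDeriv A t y (U y)⟫ :=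
    fun U => funext fun y => pullbackDeriv_metric T A y (U y) hs ht
  have h2 : ∀ U W : VF I6 (SphereBundle E), lieD U (lieD W (fun y => ⟪s y, t y⟫)) z
      = ⟪pullbackDeriv A (fun y => pullbackDeriv A s y (W y)) z (U z), t z⟫
        + ⟪pullbackDeriv A s z (W z), pullbackDeriv A t z (U z)⟫
        + (⟪pullbackDeriv A s z (U z), pullbackDeriv A t z (W z)⟫
        + ⟪s z, pullbackDeriv A (fun y => pullbackDeriv A t y (W y)) z (U z)⟫) := by
    intro U W
    rw [h1]
    refine (dF_add (((hD hs W).inner ht).mdiffAt z) ((hs.inner (hD ht W)).mdiffAt z)).trans ?_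
    rw [pullbackDeriv_metric T A z _ (hD hs W) ht, pullbackDeriv_metric T A z _ hs (hD ht W)]
  have h3 := TZ.lieD_bracket (hs.inner ht) U W z
  rw [h2, h2, pullbackDeriv_metric T A z _ hs ht] at h3
  simp only [pullbackCurv, inner_sub_left, inner_sub_right]
  linarith

include TZ in
/-- On pulled back sections, the curvature of `π^*∇` is the pull back of the curvature of `∇`. -/
theorem pullbackCurv_pullback (σ : Sec E) :
    pullbackCurv A U W (fun z => σ z.proj) z
      = curvTensor TX A z.proj (dπ z (U z)) (dπ z (W z)) σ := by
  have h1 : ∀ W : VF I6 (SphereBundle E), (fun y => pullbackDeriv A (fun z => σ z.proj) y (W y))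
      = fun y => ∑ k, lieD W (fun z : SphereBundle E => TX.coord k z.proj) y
        • A.cov (TX.field k) σ y.proj := by
    intro W
    funext y
    rw [pullbackDeriv_pullback T, toFun_eq_sum_field TX]
    simp only [← dF_pullback (TX.smooth _)]
    rfl
  have h2 : ∀ U W : VF I6 (SphereBundle E),
      pullbackDeriv A (fun y => pullbackDeriv A (fun z => σ z.proj) y (W y)) z (U z)
      = ∑ k, (lieD W (fun z : SphereBundle E => TX.coord k z.proj) z
          • A.toFun (A.cov (TX.field k) σ) z.proj (dπ z (U z))
        + lieD U (lieD W (fun z : SphereBundle E => TX.coord k z.proj)) z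
          • A.cov (TX.field k) σ z.proj) := by
    intro U W
    rw [h1, pullbackDeriv_sum T A z _ fun k _ => T.smoothAlong_smul
      ((TX.smooth k).pullback.lieD W) (smoothAlong_pullback _)]
    refine Finset.sum_congr rfl fun k _ => ?_
    rw [pullbackDeriv_smul T A z _ ((TX.smooth k).pullback.lieD W) (smoothAlong_pullback _),
      pullbackDeriv_pullback T]
    rfl
  rw [pullbackCurv, h2, h2, pullbackDeriv_pullback T, toFun_eq_sum_field TX A σ,
    curvTensor_eq_sub]
  simp only [← dF_pullback (TX.smooth _), TZ.lieD_bracket (TX.smooth _).pullback,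
    Finset.sum_add_distrib, sub_smul, Finset.sum_sub_distrib]
  simp only [lieD, MetricConnection.cov]
  simp only [ContMDiffSection.coeFn_mk]
  abel

include TZ in
/-- The curvature of `π^*∇` is the pull back of the curvature of `∇`. Since both are skew, the
sections `s` and `t` may be replaced in turn by pulled back sections with the same value at `z`. -/
theorem inner_pullbackCurv_eq {s t : ∀ z : SphereBundle E, E z.proj} (hs : SmoothAlong s)
    (ht : SmoothAlong t) : ⟪pullbackCurv A U W s z, t z⟫
      = curvForm TX A T z.proj (dπ z (U z)) (dπ z (W z)) (s z) (t z) := by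
  have h1 : ∀ {s t : ∀ z : SphereBundle E, E z.proj}, SmoothAlong s → SmoothAlong t →
      ⟪pullbackCurv A U W s z, t z⟫ = -⟪s z, curvTensor TX A z.proj (dπ z (U z)) (dπ z (W z))
        (T.extend z.proj (t z))⟫ := by
    intro s t hs ht
    have := inner_pullbackCurv TX A T TZ U W z hs (smoothAlong_pullback (T.extend z.proj (t z)))
    rwa [T.extend_apply, pullbackCurv_pullback TX A T TZ] at this
  rw [h1 hs ht, curvForm_skew, curvForm, real_inner_comm]

end Curvature

/-! ### The curvature of the induced connection -/

section InducedCurvature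

/-- The alternating form given by an alternating bilinear function. -/
def alternatingOfBilinear {V : Type*} [AddCommGroup V] [Module ℝ V] (β : V → V → ℝ)
    (hadd : ∀ u v w, β (u + v) w = β u w + β v w) (hsmul : ∀ (c : ℝ) u w, β (c • u) w = c * β u w)
    (hswap : ∀ u w, β u w = -β w u) : V [⋀^Fin 2]→ₗ[ℝ] ℝ where
  toFun v := β (v 0) (v 1)
  map_update_add' := by
    intro _ v i x y
    have hadd' : ∀ u v w, β w (u + v) = β w u + β w v := fun u v w => by
      rw [hswap, hadd, hswap w u, hswap w v]; ring
    fin_cases i <;> simp [hadd, hadd']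
  map_update_smul' := by
    intro _ v i c x
    have hsmul' : ∀ (c : ℝ) u w, β w (c • u) = c * β w u := fun c u w => by
      rw [hswap, hsmul, hswap w u]; ring
    fin_cases i <;> simp [hsmul, hsmul']
  map_eq_zero_of_eq' := by
    intro v i j hij hne
    have h : v 0 = v 1 := by
      fin_cases i <;> fin_cases j <;> first | exact (hne rfl).elim | exact hij | exact hij.symm
    have := hswap (v 0) (v 1)
    rw [h] at this ⊢
    linarith

variable {X : Type*} [TopologicalSpace X] [ChartedSpace Coord4 X] [IsManifold (𝓡 4) ∞ X]
  {E : X → Type*} [TopologicalSpace (TotalSpace Fib E)]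
  [∀ x, NormedAddCommGroup (E x)] [∀ x, InnerProductSpace ℝ (E x)]
  [FiberBundle Fib E] [VectorBundle ℝ Fib E] [ContMDiffVectorBundle ∞ Fib E (𝓡 4)]
  [IsContMDiffRiemannianBundle (𝓡 4) ∞ Fib E] [T2Space X] [CompactSpace X]
  (T : BundleFrame E) (TX : TangentFrame (𝓡 4) X) (TZ : TangentFrame I6 (SphereBundle E))
  (o : FibreOrientation E) (A : MetricConnection E)

/-- `⟪R(u, w) e, e'⟫` for the curvature `R` of the induced connection: the curvature of `A` plus
the curvature of the unit sphere. -/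
def inducedCurv (z : SphereBundle E) (u w : TangentSpace I6 z) (e e' : E z.proj) : ℝ :=
  curvForm TX A T z.proj (dπ z u) (dπ z w) e e'
    + ⟪pullbackDeriv A SphereBundle.vec z w, e⟫ * ⟪pullbackDeriv A SphereBundle.vec z u, e'⟫
    - ⟪pullbackDeriv A SphereBundle.vec z u, e⟫ * ⟪pullbackDeriv A SphereBundle.vec z w, e'⟫

theorem inner_cov_cov_induced (U W : VF I6 (SphereBundle E)) (s t : VSection E)
    (z : SphereBundle E) :
    ⟪((inducedConnection T TX o A).cov U ((inducedConnection T TX o A).cov W s)).toFun z,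
      t.toFun z⟫ = ⟪pullbackDeriv A (fun y => pullbackDeriv A s.toFun y (W y)) z (U z), t.toFun z⟫
        + ⟪pullbackDeriv A SphereBundle.vec z (W z), s.toFun z⟫
          * ⟪pullbackDeriv A SphereBundle.vec z (U z), t.toFun z⟫ := by
  have hD := smoothAlong_pullbackDeriv T TX A s.smooth W
  have hf : IsSmooth I6 fun y => ⟪y.vec, pullbackDeriv A s.toFun y (W y)⟫ :=
    SmoothAlong.inner contMDiff_vec hD
  change ⟪vproj z (pullbackDeriv A (fun y => pullbackDeriv A s.toFun y (W y)
    - ⟪y.vec, pullbackDeriv A s.toFun y (W y)⟫ • y.vec) z (U z)), t.toFun z⟫ = _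
  rw [inner_vproj_left _ (t.tangent z), pullbackDeriv_sub T A z _ hD
    (T.smoothAlong_smul hf contMDiff_vec), pullbackDeriv_smul T A z _ hf contMDiff_vec,
    inner_sub_left, inner_add_left, real_inner_smul_left, real_inner_smul_left,
    real_inner_comm (t.toFun z) z.vec, t.tangent, real_inner_comm (pullbackDeriv A s.toFun z _),
    inner_pullbackDeriv_vsection T A s, real_inner_comm (s.toFun z)]
  ring

include TZ in
/-- The Gauss equation: projecting `π^*∇` to `V` adds the second fundamental form terms to the
curvature. -/
theorem inner_curvature_induced (U W : VF I6 (SphereBundle E)) (s t : VSection E)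
    (z : SphereBundle E) :
    ⟪(inducedConnection T TX o A).curvature U W s z, t.toFun z⟫
      = inducedCurv T TX A z (U z) (W z) (s.toFun z) (t.toFun z) := by
  have h := inner_pullbackCurv_eq TX A T TZ U W z s.smooth t.smooth
  rw [pullbackCurv, inner_sub_left, inner_sub_left] at h
  rw [UnitaryConnection.curvature, inner_sub_left, inner_sub_left, inner_cov_cov_induced,
    inner_cov_cov_induced, inducedConnection_apply, inner_vproj_left _ (t.tangent z), inducedCurv,
    ← h]
  ring

theorem inducedCurv_skew (z : SphereBundle E) (u w : TangentSpace I6 z) (e e' : E z.proj) :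
    inducedCurv T TX A z u w e e' = -inducedCurv T TX A z u w e' e := by
  rw [inducedCurv, inducedCurv, curvForm_skew]
  ring

theorem inducedCurv_swap (z : SphereBundle E) (u w : TangentSpace I6 z) (e e' : E z.proj) :
    inducedCurv T TX A z u w e e' = -inducedCurv T TX A z w u e e' := by
  rw [inducedCurv, inducedCurv, curvForm_swap]
  ring

theorem inducedCurv_add_left (z : SphereBundle E) (u v w : TangentSpace I6 z) (e e' : E z.proj) :
    inducedCurv T TX A z (u + v) w e e'
      = inducedCurv T TX A z u w e e' + inducedCurv T TX A z v w e e' := by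
  simp only [inducedCurv, dπ, map_add]
  rw [curvForm_add_left, pullbackDeriv_add_vector T A z u contMDiff_vec, inner_add_left,
    inner_add_left]
  ring

theorem inducedCurv_smul_left (z : SphereBundle E) (c : ℝ) (u w : TangentSpace I6 z)
    (e e' : E z.proj) :
    inducedCurv T TX A z (c • u) w e e' = c * inducedCurv T TX A z u w e e' := by
  simp only [inducedCurv, dπ, map_smul]
  rw [curvForm_smul_left, pullbackDeriv_smul_vector T A z u contMDiff_vec, real_inner_smul_left,
    real_inner_smul_left]
  ring

theorem inducedCurv_add_third (z : SphereBundle E) (u w : TangentSpace I6 z)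
    (e₁ e₂ e' : E z.proj) : inducedCurv T TX A z u w (e₁ + e₂) e'
      = inducedCurv T TX A z u w e₁ e' + inducedCurv T TX A z u w e₂ e' := by
  simp only [inducedCurv, curvForm_add_third, inner_add_right]
  ring

theorem inducedCurv_smul_third (z : SphereBundle E) (c : ℝ) (u w : TangentSpace I6 z)
    (e e' : E z.proj) :
    inducedCurv T TX A z u w (c • e) e' = c * inducedCurv T TX A z u w e e' := by
  simp only [inducedCurv, curvForm_smul_third, real_inner_smul_right]
  ring

/-- A skew form on the plane `V z` is a multiple of the area form. -/
theorem skew_eq_area {z : SphereBundle E} {q : E z.proj → E z.proj → ℝ}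
    (hadd : ∀ u v w, q (u + v) w = q u w + q v w) (hsmul : ∀ (c : ℝ) u w, q (c • u) w = c * q u w)
    (hswap : ∀ u w, q u w = -q w u) {s t : E z.proj} (hs : ⟪s, z.vec⟫ = 0) (ht : ⟪t, z.vec⟫ = 0) :
    q s t = q (adaptedBasis z 1) (adaptedBasis z 2)
      * o.area z (adaptedBasis z 1) (adaptedBasis z 2) * o.area z s t := by
  have hadd' : ∀ u v w, q w (u + v) = q w u + q w v := fun u v w => by
    rw [hswap, hadd, hswap w u, hswap w v]; ring
  have hsmul' : ∀ (c : ℝ) u w, q w (c • u) = c * q w u := fun c u w => by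
    rw [hswap, hsmul, hswap w u]; ring
  have hself : ∀ u, q u u = 0 := fun u => by linarith [hswap u u]
  rw [o.area_eq_coord z hs ht]
  conv_lhs => rw [eq_adaptedBasis hs, eq_adaptedBasis ht]
  simp only [hadd, hsmul, hadd', hsmul', hself]
  rw [hswap (adaptedBasis z 2)]
  linear_combination -(q (adaptedBasis z 1) (adaptedBasis z 2) * (⟪s, adaptedBasis z 1⟫ *
    ⟪t, adaptedBasis z 2⟫ - ⟪s, adaptedBasis z 2⟫ * ⟪t, adaptedBasis z 1⟫)) *
    o.area_adaptedBasis_sq z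

/-- The value of the form `i F / 2π` for the curvature `F` of the induced connection. -/
def kappaVal (z : SphereBundle E) : TangentSpace I6 z [⋀^Fin 2]→ₗ[ℝ] ℝ :=
  alternatingOfBilinear (fun u w => -(2 * Real.pi)⁻¹ *
      (inducedCurv T TX A z u w (adaptedBasis z 1) (adaptedBasis z 2)
        * o.area z (adaptedBasis z 1) (adaptedBasis z 2)))
    (fun u v w => by rw [inducedCurv_add_left]; ring)
    (fun c u w => by rw [inducedCurv_smul_left]; ring)
    (fun u w => by rw [inducedCurv_swap]; ring)

theorem two_pi_ne : 2 * Real.pi ≠ 0 := by positivity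

theorem inducedCurv_eq_kappaVal (z : SphereBundle E) (u w : TangentSpace I6 z) {s t : E z.proj}
    (hs : ⟪s, z.vec⟫ = 0) (ht : ⟪t, z.vec⟫ = 0) : inducedCurv T TX A z u w s t
      = -(2 * Real.pi) * kappaVal T TX o A z ![u, w] * o.area z s t := by
  rw [skew_eq_area o (q := fun e e' => inducedCurv T TX A z u w e e')
    (fun _ _ _ => inducedCurv_add_third ..) (fun _ _ _ => inducedCurv_smul_third ..)
    (fun _ _ => inducedCurv_skew ..) hs ht]
  change _ = -(2 * Real.pi) * (-(2 * Real.pi)⁻¹ * (inducedCurv T TX A z u w _ _ * _)) * _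
  have := mul_inv_cancel₀ two_pi_ne
  linear_combination -(inducedCurv T TX A z u w (adaptedBasis z 1) (adaptedBasis z 2)
    * o.area z (adaptedBasis z 1) (adaptedBasis z 2) * o.area z s t) * this

include T in
/-- A function on `Z` is smooth if its products with the values of the area form are smooth. -/
theorem isSmooth_of_mul_area {f : SphereBundle E → ℝ}
    (h : ∀ s t : VSection E, IsSmooth I6 fun z => f z * o.area z (s.toFun z) (t.toFun z)) :
    IsSmooth I6 f := by
  intro z
  obtain ⟨s, t, hne⟩ := exists_vsections T o z
  have h1 := o.isSmooth_area T s t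
  have h2 := (h s t z).mul ((h1 z).inv₀ hne)
  refine h2.congr_of_eventuallyEq ?_
  filter_upwards [h1.continuous.continuousAt.eventually_ne hne] with y hy
  simp only [Pi.mul_apply]
  field_simp

include TZ in
theorem isSmooth_kappaVal (V : Fin 2 → VF I6 (SphereBundle E)) :
    IsSmooth I6 fun z => kappaVal T TX o A z fun i => V i z := by
  refine isSmooth_of_mul_area T o fun s t => ?_
  have h : (fun z => kappaVal T TX o A z (fun i => V i z)
      * o.area z (s.toFun z) (t.toFun z)) = fun z => -(2 * Real.pi)⁻¹ *
        ⟪(inducedConnection T TX o A).curvature (V 0) (V 1) s z, t.toFun z⟫ := by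
    funext z
    rw [inner_curvature_induced T TX TZ,
      inducedCurv_eq_kappaVal T TX o A z _ _ (s.tangent z) (t.tangent z)]
    have h1 : (fun i => V i z) = ![V 0 z, V 1 z] := by
      funext i; fin_cases i <;> rfl
    rw [h1]
    have := mul_inv_cancel₀ two_pi_ne
    linear_combination -(kappaVal T TX o A z ![V 0 z, V 1 z]
      * o.area z (s.toFun z) (t.toFun z)) * this
  rw [h]
  refine (isSmooth_const _).mul ?_
  simp only [UnitaryConnection.curvature, inner_sub_left]
  let B := inducedConnection T TX o A
  exact ((SmoothAlong.inner (B.cov _ (B.cov _ s)).smooth t.smooth).sub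
    (SmoothAlong.inner (B.cov _ (B.cov _ s)).smooth t.smooth)).sub
    (SmoothAlong.inner (B.cov (bracket (V 0) (V 1)) s).smooth t.smooth)

include TZ in
theorem exists_isCurvatureForm : ∃ κ, (inducedConnection T TX o A).IsCurvatureForm κ ∧
    ∀ z, κ.val z = kappaVal T TX o A z :=
  ⟨⟨kappaVal T TX o A, isSmooth_kappaVal T TX TZ o A⟩, fun U W s t z => by
    rw [inner_curvature_induced T TX TZ,
      inducedCurv_eq_kappaVal T TX o A z _ _ (s.tangent z) (t.tangent z)], fun _ => rfl⟩

end InducedCurvature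

/-! ### Closedness of the curvature form -/

section Bianchi
variable {X : Type*} [TopologicalSpace X] [ChartedSpace Coord4 X] [IsManifold (𝓡 4) ∞ X]
  {E : X → Type*} [TopologicalSpace (TotalSpace Fib E)]
  [∀ x, NormedAddCommGroup (E x)] [∀ x, InnerProductSpace ℝ (E x)]
  [FiberBundle Fib E] [VectorBundle ℝ Fib E] [ContMDiffVectorBundle ∞ Fib E (𝓡 4)]
  [IsContMDiffRiemannianBundle (𝓡 4) ∞ Fib E] [T2Space X] [CompactSpace X]
  (T : BundleFrame E) {o : FibreOrientation E} (B : UnitaryConnection o)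

namespace UnitaryConnection

theorem toFun_sub {s t u : VSection E} (h : ∀ z, u.toFun z = s.toFun z - t.toFun z)
    (z : SphereBundle E) : B.toFun u z = B.toFun s z - B.toFun t z := by
  rw [eq_sub_iff_add_eq]
  exact (B.add u t s (fun z => by rw [h z]; abel) z).symm

/-- The section `R(U, W) s` of `V`, where `R` is the curvature. -/
def curvSection (U W : VF I6 (SphereBundle E)) (s : VSection E) : VSection E where
  toFun := B.curvature U W s
  tangent z := by
    simp only [curvature, inner_sub_left, B.tangent, VSection.tangent, sub_zero]
  smooth := T.smoothAlong_sub (T.smoothAlong_sub (B.cov U (B.cov W s)).smooth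
    (B.cov W (B.cov U s)).smooth) (B.cov (bracket U W) s).smooth

/-- `∇_Y (R(U, W) s)` in terms of iterated covariant derivatives. -/
theorem toFun_curvSection (U W Y : VF I6 (SphereBundle E)) (s : VSection E) (z : SphereBundle E) :
    B.toFun (B.curvSection T U W s) z (Y z)
      = (B.cov Y (B.cov U (B.cov W s))).toFun z - (B.cov Y (B.cov W (B.cov U s))).toFun z
        - (B.cov Y (B.cov (bracket U W) s)).toFun z := by
  let r : VSection E := ⟨fun z => (B.cov U (B.cov W s)).toFun z - (B.cov W (B.cov U s)).toFun z,
    fun z => by rw [inner_sub_left, VSection.tangent, VSection.tangent, sub_zero],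
    T.smoothAlong_sub (B.cov U (B.cov W s)).smooth (B.cov W (B.cov U s)).smooth⟩
  have h1 : ∀ z, (B.curvSection T U W s).toFun z = r.toFun z - (B.cov (bracket U W) s).toFun z :=
    fun _ => rfl
  have h2 : ∀ z, r.toFun z = (B.cov U (B.cov W s)).toFun z - (B.cov W (B.cov U s)).toFun z :=
    fun _ => rfl
  rw [B.toFun_sub h1, B.toFun_sub h2]
  rfl

variable {B} {κ : SmoothForm I6 (SphereBundle E) 2}

/-- The covariant derivative of the curvature. -/
theorem IsCurvatureForm.lieD_eq (hκ : B.IsCurvatureForm κ) (U W Y : VF I6 (SphereBundle E))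
    (s t : VSection E) (z : SphereBundle E) :
    -(2 * Real.pi) * lieD Y (fun q => κ.val q ![U q, W q]) z * o.area z (s.toFun z) (t.toFun z)
      = ⟪B.toFun (B.curvSection T U W s) z (Y z), t.toFun z⟫
        - ⟪B.curvature U W (B.cov Y s) z, t.toFun z⟫ := by
  have hs : IsSmooth I6 fun q => κ.val q ![U q, W q] := by
    refine (κ.smooth ![U, W]).congr fun q => ?_
    congr 1
    funext i; fin_cases i <;> rfl
  have h1 : (fun q => ⟪(B.curvSection T U W s).toFun q, t.toFun q⟫)
      = fun q => -(2 * Real.pi) * κ.val q ![U q, W q] * o.area q (s.toFun q) (t.toFun q) :=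
    funext fun q => hκ U W s t q
  have h2 := B.metric (B.curvSection T U W s) t z (Y z)
  rw [h1, dF_mul (((isSmooth_const _).mul hs).mdiffAt z) ((o.isSmooth_area T s t).mdiffAt z),
    dF_mul ((isSmooth_const _).mdiffAt z) (hs.mdiffAt z), dF_const, B.area] at h2
  have h3 := hκ U W s (B.cov Y t) z
  have h4 := hκ U W (B.cov Y s) t z
  change ⟪(B.curvSection T U W s).toFun z, B.toFun t z (Y z)⟫
    = _ * o.area z (s.toFun z) (B.toFun t z (Y z)) at h3
  change _ = _ * o.area z (B.toFun s z (Y z)) (t.toFun z) at h4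
  rw [h4]
  unfold lieD
  linear_combination h2 + h3

include T in
/-- The curvature form of a unitary connection is closed, by the second Bianchi identity. -/
theorem IsCurvatureForm.isClosed (hκ : B.IsCurvatureForm κ) : κ.IsClosed := by
  intro U V W z
  obtain ⟨s, t, hne⟩ := exists_vsections T o z
  have hU := hκ.lieD_eq T V W U s t z
  have hV := hκ.lieD_eq T U W V s t z
  have hW := hκ.lieD_eq T U V W s t z
  have kU := hκ (bracket U V) W s t z
  have kV := hκ (bracket U W) V s t z
  have kW := hκ (bracket V W) U s t z
  rw [B.toFun_curvSection T] at hU hV hW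
  simp only [curvature, inner_sub_left] at hU hV hW kU kV kW
  have hsm : ∀ Y : VF I6 (SphereBundle E), ContMDiffAt I6 (I6.prod 𝓘(ℝ, Coord4 × Coord2))
      (minSmoothness ℝ 2) (fun x => (⟨x, Y x⟩ : TangentBundle I6 (SphereBundle E))) z := fun Y =>
    (Y.contMDiff z).of_le (by simpa using two_le_infty)
  have h3 : IsManifold I6 (minSmoothness ℝ 3) (SphereBundle E) :=
    IsManifold.of_le (n := ∞) (by simpa using WithTop.coe_le_coe.2 (le_top : (3 : ℕ∞) ≤ ⊤))
  -- The iterated covariant derivatives in the sum cancel in pairs, and the derivatives along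
  -- iterated brackets add up to zero by the Jacobi identity.
  have J := VectorField.leibniz_identity_mlieBracket_apply (hsm U) (hsm V) (hsm W)
  rw [VectorField.mlieBracket_swap_apply (V := U),
    VectorField.mlieBracket_swap_apply (V := V)] at J
  have J2 := congrArg (fun v => ⟪B.toFun s z v, t.toFun z⟫) J
  simp only [map_add, map_neg, inner_add_left, inner_neg_left] at J2
  have hfin : -(2 * Real.pi) * o.area z (s.toFun z) (t.toFun z) *
    (lieD U (fun q => κ.val q ![V q, W q]) z - lieD V (fun q => κ.val q ![U q, W q]) z
      + lieD W (fun q => κ.val q ![U q, V q]) z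
      - κ.val z ![VectorField.mlieBracket I6 U V z, W z]
      + κ.val z ![VectorField.mlieBracket I6 U W z, V z]
      - κ.val z ![VectorField.mlieBracket I6 V W z, U z]) = 0 := by
    have e : ∀ Y Y', (bracket Y Y' : ∀ z : SphereBundle E, TangentSpace I6 z) z
      = VectorField.mlieBracket I6 Y Y' z := fun _ _ => rfl
    have e' : ∀ Y Y', ((bracket Y Y' : VF I6 (SphereBundle E)) : ∀ z : SphereBundle E,
      TangentSpace I6 z) = VectorField.mlieBracket I6 Y Y' := fun _ _ => rfl
    simp only [e'] at kU kV kW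
    simp only [cov, e'] at hU hV hW kU kV kW
    linear_combination hU - hV + hW + kU - kV + kW - J2
  exact (mul_eq_zero.1 hfin).resolve_left
    (mul_ne_zero (neg_ne_zero.2 two_pi_ne) hne)

end UnitaryConnection
end Bianchi

/-! ### Non-degeneracy of the curvature form -/

section Nondegenerate

/-- In dimension four, two linear equations have a solution outside a given line. -/
theorem exists_apply_eq_zero_smul_ne {V : Type*} [AddCommGroup V] [Module ℝ V]
    [FiniteDimensional ℝ V] (l : V →ₗ[ℝ] ℝ × ℝ) (hV : finrank ℝ V = 4) {u : V} (hu : u ≠ 0) :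
    ∃ w, l w = 0 ∧ ∀ a : ℝ, a • u ≠ w := by
  by_contra! h
  have hle : LinearMap.ker l ≤ Submodule.span ℝ {u} := fun w hw =>
    Submodule.mem_span_singleton.2 (h w (LinearMap.mem_ker.1 hw))
  have h1 := Submodule.finrank_mono hle
  have h2 := finrank_span_singleton (K := ℝ) hu
  have h3 := l.finrank_range_add_finrank_ker
  have h4 := Submodule.finrank_le (LinearMap.range l)
  have h5 : finrank ℝ (ℝ × ℝ) = 2 := by simp
  omega

variable {X : Type*} [TopologicalSpace X] [ChartedSpace Coord4 X] [IsManifold (𝓡 4) ∞ X]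
  {E : X → Type*} [TopologicalSpace (TotalSpace Fib E)]
  [∀ x, NormedAddCommGroup (E x)] [∀ x, InnerProductSpace ℝ (E x)]
  [FiberBundle Fib E] [VectorBundle ℝ Fib E] [ContMDiffVectorBundle ∞ Fib E (𝓡 4)]
  [IsContMDiffRiemannianBundle (𝓡 4) ∞ Fib E] [T2Space X] [CompactSpace X]
  (T : BundleFrame E) (TX : TangentFrame (𝓡 4) X) (TZ : TangentFrame I6 (SphereBundle E))
  (o : FibreOrientation E) (A : MetricConnection E)

theorem isSmooth_inner (σ τ : Sec E) : IsSmooth (𝓡 4) fun x => ⟪σ x, τ x⟫ :=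
  ContMDiff.inner_bundle σ.contMDiff τ.contMDiff

/-- The section of `Z` given by the direction of a section of `E` is smooth where the latter does
not vanish. -/
theorem contMDiffOn_toSphere (ρ : Sec E) :
    ContMDiffOn (𝓡 4) I6 ∞ (fun x => (toSphere (ρ x) : SphereBundle E)) {x | ρ x ≠ 0} := by
  intro x hx
  refine ContMDiffAt.contMDiffWithinAt (contMDiffAt_sphereBundle ?_)
  have hn0 : ⟪ρ x, ρ x⟫ ≠ 0 := inner_self_ne_zero.2 hx
  have h1 : ContMDiffAt (𝓡 4) ((𝓡 4).prod 𝓘(ℝ, Fib)) ∞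
      (fun y => (⟨y, (√⟪ρ y, ρ y⟫)⁻¹ • ρ y⟩ : TotalSpace Fib E)) x := by
    have h2 : ContMDiffAt (𝓡 4) 𝓘(ℝ, ℝ) ∞ (fun y => √⟪ρ y, ρ y⟫) x :=
      ContMDiffAt.comp (g := Real.sqrt) (f := fun y => ⟪ρ y, ρ y⟫) x
        (Real.contDiffAt_sqrt hn0).contMDiffAt (isSmooth_inner ρ ρ x)
    exact (h2.inv₀ (Real.sqrt_ne_zero'.2
      (lt_of_le_of_ne real_inner_self_nonneg hn0.symm))).smul_section (ρ.contMDiff x)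
  refine h1.congr_of_eventuallyEq ?_
  filter_upwards [(isSmooth_inner ρ ρ).continuous.continuousAt.eventually_ne hn0] with y hy
  have hy' : ρ y ≠ 0 := fun h => hy (by rw [h, inner_zero_left])
  rw [toSphere_val hy', norm_eq_sqrt_real_inner]

theorem isOpen_ne_zero (ρ : Sec E) : IsOpen {x | ρ x ≠ 0} := by
  have : {x | ρ x ≠ 0} = {x | ⟪ρ x, ρ x⟫ ≠ 0} := by
    ext x; simp
  rw [this]
  exact isOpen_ne_fun (isSmooth_inner ρ ρ).continuous continuous_const

/-- The section of `Z` given by the direction of a section of `E` is a right inverse of the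
projection. -/
theorem dπ_mfderiv_toSphere {ρ : Sec E} {x : X} (hx : ρ x ≠ 0) (v : TangentSpace (𝓡 4) x) :
    dπ (toSphere (ρ x)) (mfderiv (𝓡 4) I6 (fun y => (toSphere (ρ y) : SphereBundle E)) x v)
      = v := by
  have hζ := ((contMDiffOn_toSphere ρ).contMDiffAt
    ((isOpen_ne_zero ρ).mem_nhds hx)).mdifferentiableAt (by simp)
  have hd := mfderiv_comp_apply x (g := SphereBundle.proj (E := E)) (I := 𝓡 4)
    (I' := I6) (I'' := 𝓡 4) ((contMDiff_proj _).mdifferentiableAt (by simp)) hζ v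
  have hid : (SphereBundle.proj (E := E)) ∘ (fun y => toSphere (ρ y)) = id := rfl
  rw [hid, mfderiv_id] at hd
  exact hd.symm

include T in
/-- The differential of the projection is onto, since the projection has local sections through
every point. -/
theorem dπ_surjective (z : SphereBundle E) : Function.Surjective (dπ z) := by
  intro v
  let ρ := T.extend z.proj z.vec
  have hρ : ρ z.proj = z.vec := T.extend_apply _ _
  have hz : toSphere (ρ z.proj) = z := by
    rw [hρ]
    simpa using toSphere_vec z 1 one_pos
  have h5 : ∀ (y : SphereBundle E) (u : Coord4 × Coord2), y = z →
      mfderiv I6 (𝓡 4) SphereBundle.proj y u = (v : Coord4) →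
      ∃ u : TangentSpace I6 z, (dπ z u : Coord4) = v := by
    rintro _ u rfl h
    exact ⟨u, h⟩
  exact h5 _ _ hz (dπ_mfderiv_toSphere (by rw [hρ]; exact vec_ne_zero z) v)

include T TX in
/-- The horizontal part `dπ u` and the vertical part of a tangent vector `u` determine `u`: the map
to both parts is onto, and the dimensions agree. -/
theorem tangent_eq_zero {z : SphereBundle E} {u : TangentSpace I6 z} (h1 : dπ z u = 0)
    (h2 : pullbackDeriv A SphereBundle.vec z u = 0) : u = 0 := by
  let ν : TangentSpace I6 z → E z.proj := pullbackDeriv A SphereBundle.vec z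
  have hadd : ∀ u w, ν (u + w) = ν u + ν w := fun u w =>
    pullbackDeriv_add_vector T A z u contMDiff_vec w
  have hsmul : ∀ (c : ℝ) u, ν (c • u) = c • ν u := fun c u =>
    pullbackDeriv_smul_vector T A z u contMDiff_vec c
  let l : (Coord4 × Coord2) →ₗ[ℝ] Coord4 × (ℝ × ℝ) :=
    { toFun u := (dπ z u, (⟪ν u, adaptedBasis z 1⟫, ⟪ν u, adaptedBasis z 2⟫))
      map_add' u w := by
        refine Prod.ext (map_add _ _ _) (Prod.ext ?_ ?_)
        · exact (congrArg (fun e => ⟪e, adaptedBasis z 1⟫) (hadd u w)).trans (inner_add_left _ _ _)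
        · exact (congrArg (fun e => ⟪e, adaptedBasis z 2⟫) (hadd u w)).trans (inner_add_left _ _ _)
      map_smul' c u := by
        refine Prod.ext (map_smul _ _ _) (Prod.ext ?_ ?_)
        · exact (congrArg (fun e => ⟪e, adaptedBasis z 1⟫) (hsmul c u)).trans
            (real_inner_smul_left _ _ _)
        · exact (congrArg (fun e => ⟪e, adaptedBasis z 2⟫) (hsmul c u)).trans
            (real_inner_smul_left _ _ _) }
  have hsurj : Function.Surjective l := by
    rintro ⟨v, a, b⟩
    obtain ⟨u, hu⟩ := dπ_surjective T z v
    let e : E z.proj := a • adaptedBasis z 1 + b • adaptedBasis z 2 - ν u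
    have he : ⟪e, z.vec⟫ = 0 := by
      simp only [e, inner_sub_left, inner_add_left, real_inner_smul_left,
        adaptedBasis_inner_vec z (show (1 : Fin 3) ≠ 0 by decide),
        adaptedBasis_inner_vec z (show (2 : Fin 3) ≠ 0 by decide), ν,
        inner_pullbackDeriv_vec T A u]
      ring
    have hν : ν (u + fibreVector z e) = a • adaptedBasis z 1 + b • adaptedBasis z 2 := by
      rw [hadd]
      change ν u + pullbackDeriv A SphereBundle.vec z (fibreVector z e) = _
      rw [pullbackDeriv_vec_fibreVector T TX A he]
      simp [e]
    have ho := orthonormal_iff_ite.1 (adaptedBasis z).orthonormal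
    refine ⟨u + fibreVector z e, Prod.ext ?_ (Prod.ext ?_ ?_)⟩
    · change dπ z (u + fibreVector z e) = v
      rw [dπ, map_add]
      change dπ z u + dπ z (fibreVector z e) = v
      rw [dπ_fibreVector T he TX, hu]
      exact add_zero (v : Coord4)
    · change ⟪ν (u + fibreVector z e), adaptedBasis z 1⟫ = a
      rw [hν, inner_add_left, real_inner_smul_left, real_inner_smul_left, ho, ho]
      simp
    · change ⟪ν (u + fibreVector z e), adaptedBasis z 2⟫ = b
      rw [hν, inner_add_left, real_inner_smul_left, real_inner_smul_left, ho, ho]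
      simp
  have hinj : Function.Injective l :=
    (LinearMap.injective_iff_surjective_of_finrank_eq_finrank (by simp)).2 hsurj
  refine hinj (a₁ := u) (a₂ := (0 : Coord4 × Coord2)) ?_
  rw [map_zero]
  refine Prod.ext h1 (Prod.ext ?_ ?_)
  · change ⟪pullbackDeriv A SphereBundle.vec z u, adaptedBasis z 1⟫ = 0
    rw [h2, inner_zero_left]
  · change ⟪pullbackDeriv A SphereBundle.vec z u, adaptedBasis z 2⟫ = 0
    rw [h2, inner_zero_left]

theorem curvForm_zero_right (x : X) (u : TangentSpace (𝓡 4) x) (e e' : E x) :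
    curvForm TX A T x u 0 e e' = 0 := by
  rw [curvForm_swap, ← zero_smul ℝ (0 : TangentSpace (𝓡 4) x), curvForm_smul_left]
  ring

theorem curvForm_eq_zero_of_basis {x : X} {u w : TangentSpace (𝓡 4) x}
    (b : OrthonormalBasis (Fin 3) ℝ (E x)) (h01 : curvForm TX A T x u w (b 0) (b 1) = 0)
    (h02 : curvForm TX A T x u w (b 0) (b 2) = 0) (h12 : curvForm TX A T x u w (b 1) (b 2) = 0)
    (e e' : E x) : curvForm TX A T x u w e e' = 0 := by
  have hself : ∀ e, curvForm TX A T x u w e e = 0 := fun e => by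
    linarith [curvForm_skew TX A T x u w e e]
  rw [← b.sum_repr' e, ← b.sum_repr' e', Fin.sum_univ_three, Fin.sum_univ_three]
  simp only [curvForm_add_third, curvForm_add_fourth, curvForm_smul_third, curvForm_smul_fourth,
    hself, h01, h02, h12]
  rw [curvForm_skew TX A T x u w (b 1) (b 0), curvForm_skew TX A T x u w (b 2) (b 0),
    curvForm_skew TX A T x u w (b 2) (b 1), h01, h02, h12]
  ring

/-- If the component of the curvature in a given direction of `so(E)` vanishes on all planes
containing `u`, then the two other components vanish on one of these planes, by counting
dimensions, so that a definite connection has `u = 0`. -/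
theorem eq_zero_of_isDefinite (hA : A.IsDefinite) {x : X}
    (b : OrthonormalBasis (Fin 3) ℝ (E x)) {u : TangentSpace (𝓡 4) x}
    (h : ∀ w, curvForm TX A T x u w (b 1) (b 2) = 0) : u = 0 := by
  by_contra hu
  have hlin : ∀ e e', IsLinearMap ℝ fun w : TangentSpace (𝓡 4) x => curvForm TX A T x u w e e' := by
    intro e e'
    constructor
    · intro v w
      rw [curvForm_swap, curvForm_add_left, curvForm_swap TX A T x u v,
        curvForm_swap TX A T x u w]
      ring
    · intro c w
      rw [curvForm_swap, curvForm_smul_left, curvForm_swap TX A T x u w, smul_eq_mul]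
      ring
  let l : Coord4 →ₗ[ℝ] ℝ × ℝ := ((hlin (b 0) (b 1)).mk' _).prod ((hlin (b 0) (b 2)).mk' _)
  obtain ⟨w, hw', hwu⟩ : ∃ w : TangentSpace (𝓡 4) x, l w = 0 ∧ ∀ a : ℝ, a • u ≠ w :=
    exists_apply_eq_zero_smul_ne l (by simp) hu
  have h01 : curvForm TX A T x u w (b 0) (b 1) = 0 := congrArg Prod.fst hw'
  have h02 : curvForm TX A T x u w (b 0) (b 2) = 0 := congrArg Prod.snd hw'
  obtain ⟨σ, hσ⟩ := hA (TX.extend x u) (TX.extend x w) x (by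
    rw [TX.extend_apply, TX.extend_apply]
    exact (LinearIndependent.pair_iff' hu).2 hwu)
  refine hσ ?_
  rw [curvature_eq_curvTensor TX, TX.extend_apply, TX.extend_apply]
  refine ext_inner_left fun t => ?_
  rw [← curvForm_eq TX A T, inner_zero_left]
  exact curvForm_eq_zero_of_basis T TX A b h01 h02 (h w) _ _

include TZ in
/-- Let `u` be in the kernel of the curvature form. Testing with vertical vectors shows that `u` is
horizontal. Then the component of the curvature of `A` in the direction of the rotation of `z^⊥`
vanishes on all planes that contain `dπ u`, so that `dπ u = 0`. -/
theorem isSymplectic_inducedConnection (hA : A.IsDefinite) :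
    (inducedConnection T TX o A).IsSymplectic := by
  obtain ⟨κ, hκ, hval⟩ := exists_isCurvatureForm T TX TZ o A
  refine ⟨κ, hκ, hκ.isClosed T, fun z u hu => ?_⟩
  have h1 := adaptedBasis_inner_vec z (show (1 : Fin 3) ≠ 0 by decide)
  have h2 := adaptedBasis_inner_vec z (show (2 : Fin 3) ≠ 0 by decide)
  have ho := orthonormal_iff_ite.1 (adaptedBasis z).orthonormal
  have hQ : ∀ w, inducedCurv T TX A z u w (adaptedBasis z 1) (adaptedBasis z 2) = 0 := fun w => by
    rw [inducedCurv_eq_kappaVal T TX o A z u w h1 h2, ← hval, hu]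
    ring
  have hν : pullbackDeriv A SphereBundle.vec z u = 0 := by
    have hv : ∀ e, ⟪e, z.vec⟫ = 0 → ⟪e, adaptedBasis z 1⟫ *
        ⟪pullbackDeriv A SphereBundle.vec z u, adaptedBasis z 2⟫
        = ⟪pullbackDeriv A SphereBundle.vec z u, adaptedBasis z 1⟫ * ⟪e, adaptedBasis z 2⟫ := by
      intro e he
      have := hQ (fibreVector z e)
      rw [inducedCurv, dπ_fibreVector T he TX, curvForm_zero_right,
        pullbackDeriv_vec_fibreVector T TX A he] at this
      linarith
    have hv1 := hv _ h1
    have hv2 := hv _ h2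
    rw [ho, ho] at hv1 hv2
    simp only [if_true, Fin.reduceEq, if_false] at hv1 hv2
    rw [eq_adaptedBasis (inner_pullbackDeriv_vec T A u),
      show ⟪pullbackDeriv A SphereBundle.vec z u, adaptedBasis z 1⟫ = 0 by linarith,
      show ⟪pullbackDeriv A SphereBundle.vec z u, adaptedBasis z 2⟫ = 0 by linarith]
    simp
  refine tangent_eq_zero T TX A ?_ hν
  refine eq_zero_of_isDefinite T TX A hA (adaptedBasis z) fun w => ?_
  obtain ⟨w, rfl⟩ := dπ_surjective T z w
  have := hQ w
  rw [inducedCurv, hν] at this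
  simpa using this

end Nondegenerate

/-! ### The differential of the map to unitary connections -/

section Velocity
variable {X : Type*} [TopologicalSpace X] [ChartedSpace Coord4 X] [IsManifold (𝓡 4) ∞ X]
  {E : X → Type*} [TopologicalSpace (TotalSpace Fib E)]
  [∀ x, NormedAddCommGroup (E x)] [∀ x, InnerProductSpace ℝ (E x)]
  [FiberBundle Fib E] [VectorBundle ℝ Fib E] [ContMDiffVectorBundle ∞ Fib E (𝓡 4)]
  [IsContMDiffRiemannianBundle (𝓡 4) ∞ Fib E] [T2Space X] [CompactSpace X]
  (T : BundleFrame E) (TX : TangentFrame (𝓡 4) X) (o : FibreOrientation E)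

/-- The `1`-form on `Z` that corresponds to the component of `a` at `z` in the direction of the
rotation of `z^⊥`. The factor `-1 / 2π` comes from the identification of a real `1`-form `α` with
the tangent vector `-2πi α`. -/
def velocityVal (a : SoForm E) (z : SphereBundle E) : TangentSpace I6 z →ₗ[ℝ] ℝ :=
  (-(2 * Real.pi)⁻¹ * o.area z (adaptedBasis z 1) (adaptedBasis z 2)) •
    ((innerₗ (E z.proj) (adaptedBasis z 2)).comp
      ((a.toFun z.proj (adaptedBasis z 1)).comp
        (mfderiv I6 (𝓡 4) SphereBundle.proj z).toLinearMap))

theorem inner_eq_velocityVal (a : SoForm E) (z : SphereBundle E) (v : TangentSpace I6 z)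
    {s t : E z.proj} (hs : ⟪s, z.vec⟫ = 0) (ht : ⟪t, z.vec⟫ = 0) :
    ⟪a.toFun z.proj s (dπ z v), t⟫
      = -(2 * Real.pi) * velocityVal o a z v * o.area z s t := by
  rw [skew_eq_area o (q := fun e e' => ⟪a.toFun z.proj e (dπ z v), e'⟫)
    (fun _ _ _ => by rw [map_add, LinearMap.add_apply, inner_add_left])
    (fun _ _ _ => by rw [map_smul, LinearMap.smul_apply, real_inner_smul_left])
    (fun u w => by rw [a.skew, real_inner_comm]) hs ht]
  change _ = -(2 * Real.pi) * ((-(2 * Real.pi)⁻¹ * _) * ⟪adaptedBasis z 2, a.toFun z.proj _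
    (dπ z v)⟫) * _
  rw [real_inner_comm _ (adaptedBasis z 2)]
  have := mul_inv_cancel₀ two_pi_ne
  linear_combination -(⟪a.toFun z.proj (adaptedBasis z 1) (dπ z v), adaptedBasis z 2⟫
    * o.area z (adaptedBasis z 1) (adaptedBasis z 2) * o.area z s t) * this

/-- The section `a(U) σ` of `E`. -/
def SoForm.apply (a : SoForm E) (U : VF (𝓡 4) X) (σ : Sec E) : Sec E :=
  ⟨fun x => a.toFun x (σ x) (U x), a.smooth U σ⟩

include T TX in
theorem isSmooth_inner_soForm (a : SoForm E) (s t : VSection E) (V : VF I6 (SphereBundle E)) :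
    IsSmooth I6 fun z => ⟪a.toFun z.proj (s.toFun z) (dπ z (V z)), t.toFun z⟫ := by
  have h : (fun z => ⟪a.toFun z.proj (s.toFun z) (dπ z (V z)), t.toFun z⟫)
      = fun z => ∑ k, lieD V (fun y : SphereBundle E => TX.coord k y.proj) z
        * ∑ i, ⟪s.toFun z, T.dual i z.proj⟫
          * ⟪a.apply (TX.field k) (T.sec i) z.proj, t.toFun z⟫ := by
    funext z
    conv_lhs => rw [← T.sum_eq _ (s.toFun z), ← TX.sum_eq z.proj (dπ z (V z))]
    simp only [map_sum, map_smul, LinearMap.sum_apply, LinearMap.smul_apply, sum_inner,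
      real_inner_smul_left, ← dF_pullback (TX.smooth _)]
    simp only [Finset.mul_sum]
    rfl
  rw [h]
  exact IsSmooth.sum fun k _ => ((TX.smooth k).pullback.lieD V).mul <| IsSmooth.sum fun i _ =>
    (SmoothAlong.inner s.smooth (smoothAlong_pullback _)).mul
      (SmoothAlong.inner (smoothAlong_pullback _) t.smooth)

/-- The velocity of the curve `r ↦ (A + r a)_V`, as a `1`-form. -/
def velocity (a : SoForm E) : SmoothForm I6 (SphereBundle E) 1 where
  val z := AlternatingMap.ofSubsingleton ℝ (TangentSpace I6 z) ℝ (0 : Fin 1) (velocityVal o a z)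
  smooth V := by
    refine isSmooth_of_mul_area T o fun s t => ?_
    have h : (fun z => velocityVal o a z (V 0 z) * o.area z (s.toFun z) (t.toFun z))
        = fun z => -(2 * Real.pi)⁻¹ *
          ⟪a.toFun z.proj (s.toFun z) (dπ z (V 0 z)), t.toFun z⟫ := by
      funext z
      rw [inner_eq_velocityVal o a z _ (s.tangent z) (t.tangent z)]
      have := mul_inv_cancel₀ two_pi_ne
      linear_combination -(velocityVal o a z (V 0 z) * o.area z (s.toFun z) (t.toFun z)) * this
    exact h ▸ (isSmooth_const _).mul (isSmooth_inner_soForm T TX a s t (V 0))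

theorem velocity_apply (a : SoForm E) (z : SphereBundle E) (v : TangentSpace I6 z) :
    (velocity T TX o a).val z ![v] = velocityVal o a z v := rfl

include T in
theorem pullbackDeriv_translate (A : MetricConnection E) (r : ℝ) (a : SoForm E)
    (s : ∀ z : SphereBundle E, E z.proj) (z : SphereBundle E) (v : TangentSpace I6 z) :
    pullbackDeriv (A.translate r a) s z v
      = pullbackDeriv A s z v + r • a.toFun z.proj (s z) (dπ z v) := by
  have hσ := Classical.epsilon_spec (p := fun σ : Sec E => σ z.proj = s z)
    ⟨T.extend z.proj (s z), T.extend_apply _ _⟩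
  unfold pullbackDeriv
  simp only [MetricConnection.translate, LinearMap.add_apply, LinearMap.smul_apply]
  rw [add_assoc]
  exact congrArg (fun e => _ + (_ + r • a.toFun z.proj e (dπ z v))) hσ

theorem hasVelocity_velocity (A : MetricConnection E) (a : SoForm E) :
    UnitaryConnection.HasVelocity (fun r => inducedConnection T TX o (A.translate r a))
      (velocity T TX o a) := by
  intro s t z v
  have h : (fun r => ⟪(inducedConnection T TX o (A.translate r a)).toFun s z v, t.toFun z⟫)
      = fun r => ⟪pullbackDeriv A s.toFun z v, t.toFun z⟫
        + r * ⟪a.toFun z.proj (s.toFun z) (dπ z v), t.toFun z⟫ := by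
    funext r
    rw [inducedConnection_apply, inner_vproj_left _ (t.tangent z), pullbackDeriv_translate T,
      inner_add_left, real_inner_smul_left]
  rw [h, velocity_apply, ← inner_eq_velocityVal o a z v (s.tangent z) (t.tangent z)]
  simpa using ((hasDerivAt_id (0 : ℝ)).mul_const
    ⟪a.toFun z.proj (s.toFun z) (dπ z v), t.toFun z⟫).const_add
      ⟪pullbackDeriv A s.toFun z v, t.toFun z⟫

/-- Any two vectors of a fibre of `E` are orthogonal to a point of the unit sphere. -/
theorem exists_unit_perp {x : X} (e e' : E x) : ∃ w : E x, ‖w‖ = 1 ∧ ⟪e, w⟫ = 0 ∧ ⟪e', w⟫ = 0 := by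
  have := finiteDimensional_fibre (E := E) x
  classical
  let K := Submodule.span ℝ (({e, e'} : Finset (E x)) : Set (E x))
  have h1 : finrank ℝ K ≤ 2 := (finrank_span_finset_le_card _).trans Finset.card_le_two
  have h2 := K.finrank_add_finrank_orthogonal
  rw [finrank_fibre] at h2
  have : Nontrivial Kᗮ := finrank_pos_iff.1 (show 0 < finrank ℝ Kᗮ by omega)
  obtain ⟨w, hw⟩ := exists_norm_eq Kᗮ (zero_le_one' ℝ)
  have hK := (Submodule.mem_orthogonal K (w : E x)).1 w.2
  exact ⟨w, hw, hK e (Submodule.subset_span (by simp)), hK e' (Submodule.subset_span (by simp))⟩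

/-- The component of `a` in the direction of the rotation of `w^⊥` is determined by the velocity at
the point `w` of the sphere, and these rotations span `so(E)`. -/
theorem velocity_injective : Function.Injective (velocity T TX o : SoForm E → _) := by
  intro a b hab
  refine SoForm.ext (funext fun x => LinearMap.ext fun e => LinearMap.ext fun v =>
    ext_inner_left fun e' => ?_)
  obtain ⟨w, hw, he, he'⟩ := exists_unit_perp e e'
  let z : SphereBundle E := ⟨⟨x, w⟩, hw⟩
  obtain ⟨u, hu⟩ := dπ_surjective T z v
  have h1 := inner_eq_velocityVal o a z u he he'
  have h2 := inner_eq_velocityVal o b z u he he'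
  rw [hu] at h1 h2
  rw [← velocity_apply T TX] at h1 h2
  rw [hab] at h1
  exact h1.trans h2.symm

end Velocity

/-! ### Convergence in the smooth topology -/

section SmoothConvergence
variable {EM : Type*} [NormedAddCommGroup EM] [NormedSpace ℝ EM] {HM : Type*} [TopologicalSpace HM]
  {I : ModelWithCorners ℝ EM HM} {M : Type*} [TopologicalSpace M] [ChartedSpace HM M]
  [IsManifold I ∞ M] {ι : Type*} {F : Filter ι}

variable (F) in
/-- Uniform convergence to zero. -/
def UnifZero (f : ι → M → ℝ) : Prop := ∀ ε > 0, ∀ᶠ i in F, ∀ p, |f i p| < ε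

variable (I F) in
/-- Uniform convergence to zero of the derivatives of order at most `n`. -/
def SmoothZeroUpTo : ℕ → (ι → M → ℝ) → Prop
  | 0, f => UnifZero F f
  | n + 1, f => UnifZero F f ∧ ∀ U : VF I M, SmoothZeroUpTo n fun i => lieD U (f i)

variable (I F) in
/-- Convergence to zero of a family of smooth functions, with all derivatives. -/
structure SmoothZero (f : ι → M → ℝ) : Prop where
  smooth : ∀ i, IsSmooth I (f i)
  zero : ∀ n, SmoothZeroUpTo I F n f

theorem SmoothZeroUpTo.unifZero {f : ι → M → ℝ} {n : ℕ} (h : SmoothZeroUpTo I F n f) :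
    UnifZero F f := by
  cases n with
  | zero => exact h
  | succ n => exact h.1

theorem SmoothZeroUpTo.of_succ {f : ι → M → ℝ} {n : ℕ} (h : SmoothZeroUpTo I F (n + 1) f) :
    SmoothZeroUpTo I F n f := by
  induction n generalizing f with
  | zero => exact h.1
  | succ n ih => exact ⟨h.1, fun U => ih (h.2 U)⟩

theorem SmoothZero.lieD {f : ι → M → ℝ} (h : SmoothZero I F f) (U : VF I M) :
    SmoothZero I F fun i => lieD U (f i) :=
  ⟨fun i => (h.smooth i).lieD U, fun n => (h.zero (n + 1)).2 U⟩

theorem UnifZero.add {f g : ι → M → ℝ} (hf : UnifZero F f) (hg : UnifZero F g) :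
    UnifZero F fun i p => f i p + g i p := by
  intro ε hε
  filter_upwards [hf (ε / 2) (by positivity), hg (ε / 2) (by positivity)] with i h1 h2 p
  have := abs_add_le (f i p) (g i p)
  linarith [h1 p, h2 p]

theorem UnifZero.mul {f : ι → M → ℝ} {h : M → ℝ} {C : ℝ} (hC : ∀ p, |h p| ≤ C)
    (hf : UnifZero F f) : UnifZero F fun i p => h p * f i p := by
  intro ε hε
  have hC1 : 0 < |C| + 1 := by positivity
  filter_upwards [hf (ε / (|C| + 1)) (by positivity)] with i h1 p
  rw [abs_mul]
  have h2 : |h p| ≤ |C| + 1 := (hC p).trans ((le_abs_self C).trans (by linarith))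
  calc |h p| * |f i p| ≤ (|C| + 1) * |f i p| := by gcongr
    _ < (|C| + 1) * (ε / (|C| + 1)) := by gcongr; exact h1 p
    _ = ε := by field_simp

theorem exists_bound [CompactSpace M] {h : M → ℝ} (hh : IsSmooth I h) : ∃ C, ∀ p, |h p| ≤ C := by
  obtain ⟨C, hC⟩ := isCompact_univ.exists_bound_of_continuousOn hh.continuous.continuousOn
  exact ⟨C, fun p => hC p (mem_univ p)⟩

theorem SmoothZeroUpTo.add {f g : ι → M → ℝ} {n : ℕ} (hfs : ∀ i, IsSmooth I (f i))
    (hgs : ∀ i, IsSmooth I (g i)) (hf : SmoothZeroUpTo I F n f) (hg : SmoothZeroUpTo I F n g) :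
    SmoothZeroUpTo I F n fun i p => f i p + g i p := by
  induction n generalizing f g with
  | zero => exact UnifZero.add hf hg
  | succ n ih =>
    refine ⟨hf.1.add hg.1, fun U => ?_⟩
    simp only [lieD_add (hfs _) (hgs _)]
    exact ih (fun i => (hfs i).lieD U) (fun i => (hgs i).lieD U) (hf.2 U) (hg.2 U)

theorem SmoothZero.add {f g : ι → M → ℝ} (hf : SmoothZero I F f) (hg : SmoothZero I F g) :
    SmoothZero I F fun i p => f i p + g i p :=
  ⟨fun i => (hf.smooth i).add (hg.smooth i),
    fun n => (hf.zero n).add hf.smooth hg.smooth (hg.zero n)⟩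

theorem smoothZero_zero : SmoothZero I F fun (_ : ι) (_ : M) => (0 : ℝ) := by
  refine ⟨fun _ => isSmooth_const 0, fun n => ?_⟩
  have hu : UnifZero F fun (_ : ι) (_ : M) => (0 : ℝ) := fun ε hε =>
    Filter.Eventually.of_forall fun _ _ => by simpa using hε
  induction n with
  | zero => exact hu
  | succ n ih =>
    refine ⟨hu, fun U => ?_⟩
    have : Definite.lieD U (fun _ : M => (0 : ℝ)) = fun _ => 0 := funext fun p => dF_const 0
    simpa only [this] using ih

theorem SmoothZero.sum {κ : Type*} {s : Finset κ} {f : κ → ι → M → ℝ}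
    (hf : ∀ k ∈ s, SmoothZero I F (f k)) : SmoothZero I F fun i p => ∑ k ∈ s, f k i p := by
  classical
  induction s using Finset.induction_on with
  | empty => simpa using smoothZero_zero
  | insert k s hk ih =>
    simp only [Finset.sum_insert hk]
    exact (hf k (by simp)).add (ih fun l hl => hf l (by simp [hl]))

theorem SmoothZeroUpTo.mul [CompactSpace M] {f : ι → M → ℝ} {h : M → ℝ} {n : ℕ}
    (hh : IsSmooth I h) (hfs : ∀ i, IsSmooth I (f i)) (hf : SmoothZeroUpTo I F n f) :
    SmoothZeroUpTo I F n fun i p => h p * f i p := by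
  induction n generalizing f h with
  | zero =>
    obtain ⟨C, hC⟩ := exists_bound hh
    exact UnifZero.mul hC hf
  | succ n ih =>
    obtain ⟨C, hC⟩ := exists_bound hh
    refine ⟨hf.1.mul hC, fun U => ?_⟩
    simp only [lieD_mul hh (hfs _)]
    exact SmoothZeroUpTo.add (fun i => hh.mul ((hfs i).lieD U)) (fun i => (hh.lieD U).mul (hfs i))
      (ih hh (fun i => (hfs i).lieD U) (hf.2 U)) (ih (hh.lieD U) hfs hf.of_succ)

theorem SmoothZero.mul [CompactSpace M] {f : ι → M → ℝ} {h : M → ℝ} (hh : IsSmooth I h)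
    (hf : SmoothZero I F f) : SmoothZero I F fun i p => h p * f i p :=
  ⟨fun i => hh.mul (hf.smooth i), fun n => (hf.zero n).mul hh hf.smooth⟩

theorem isSmooth_foldr {f : M → ℝ} (hf : IsSmooth I f) (L : List (VF I M)) :
    IsSmooth I (L.foldr Definite.lieD f) := by
  induction L with
  | nil => exact hf
  | cons U L ih => exact ih.lieD U

theorem foldr_lieD_sub {f g : M → ℝ} (hf : IsSmooth I f) (hg : IsSmooth I g) (L : List (VF I M)) :
    L.foldr Definite.lieD (fun p => f p - g p)
      = fun p => L.foldr Definite.lieD f p - L.foldr Definite.lieD g p := by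
  induction L with
  | nil => rfl
  | cons U L ih =>
    rw [List.foldr_cons, ih]
    funext p
    exact dF_sub ((isSmooth_foldr hf L).mdiffAt p) ((isSmooth_foldr hg L).mdiffAt p)

theorem smoothZeroUpTo_iff {f : ι → M → ℝ} :
    (∀ n, SmoothZeroUpTo I F n f) ↔
      ∀ L : List (VF I M), UnifZero F fun i => L.foldr Definite.lieD (f i) := by
  constructor
  · intro h L
    induction L using List.reverseRecOn generalizing f with
    | nil => exact h 0
    | append_singleton L U ih =>
      simp only [List.foldr_append]
      exact ih fun n => (h (n + 1)).2 U
  · intro h n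
    induction n generalizing f with
    | zero => exact h []
    | succ n ih =>
      refine ⟨h [], fun U => ih fun L => ?_⟩
      have := h (L ++ [U])
      simpa only [List.foldr_append, List.foldr_cons, List.foldr_nil] using this

/-- Convergence in the smooth topology. The recursion in `SmoothZeroUpTo` applies one vector field
at a time, whereas the topology is defined by lists of vector fields. -/
theorem tendsto_smoothTopology_iff {f : ι → M → ℝ} {g : M → ℝ} (hf : ∀ i, IsSmooth I (f i))
    (hg : IsSmooth I g) :
    Filter.Tendsto f F (@nhds _ (smoothTopology I M) g) ↔
      SmoothZero I F fun i p => f i p - g p := by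
  have h1 : SmoothZero I F (fun i p => f i p - g p) ↔ ∀ L : List (VF I M),
      TendstoUniformly (fun i => L.foldr Definite.lieD (f i)) (L.foldr Definite.lieD g) F := by
    have h2 : SmoothZero I F (fun i p => f i p - g p)
        ↔ ∀ n, SmoothZeroUpTo I F n fun i p => f i p - g p :=
      ⟨fun h => h.zero, fun h => ⟨fun i => (hf i).sub hg, h⟩⟩
    rw [h2, smoothZeroUpTo_iff]
    refine forall_congr' fun L => ?_
    rw [Metric.tendstoUniformly_iff]
    refine forall_congr' fun ε => forall_congr' fun hε => Filter.eventually_congr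
      (Filter.Eventually.of_forall fun i => forall_congr' fun p => ?_)
    beta_reduce
    rw [foldr_lieD_sub (hf i) hg, dist_comm, Real.dist_eq]
  rw [h1, nhds_iInf, Filter.tendsto_iInf]
  refine forall_congr' fun L => ?_
  rw [nhds_induced, Filter.tendsto_comap_iff, UniformFun.tendsto_iff_tendstoUniformly]
  rfl

variable {EN HN N : Type*} [NormedAddCommGroup EN] [NormedSpace ℝ EN] [TopologicalSpace HN]
  {J : ModelWithCorners ℝ EN HN} [TopologicalSpace N] [ChartedSpace HN N] [IsManifold J ∞ N]

/-- A function that is smooth on an open set, multiplied by a cut-off function. -/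
theorem isSmooth_mul_of_tsupport {O : Set N} (hO : IsOpen O) {c f : N → ℝ} (hc : IsSmooth J c)
    (hcO : tsupport c ⊆ O) (hf : ContMDiffOn J 𝓘(ℝ, ℝ) ∞ f O) : IsSmooth J fun p => c p * f p := by
  intro p
  by_cases hp : p ∈ O
  · exact (hc p).mul (hf.contMDiffAt (hO.mem_nhds hp))
  · have h0 : (fun p => c p * f p) =ᶠ[𝓝 p] fun _ => 0 := by
      have : (tsupport c)ᶜ ∈ 𝓝 p := (isClosed_tsupport c).isOpen_compl.mem_nhds fun h => hp (hcO h)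
      filter_upwards [this] with q hq
      rw [image_eq_zero_of_notMem_tsupport hq, zero_mul]
    exact contMDiffAt_const.congr_of_eventuallyEq h0

theorem contMDiffOn_lieD {O : Set N} (hO : IsOpen O) {f : N → ℝ} (hf : ContMDiffOn J 𝓘(ℝ, ℝ) ∞ f O)
    (W : VF J N) : ContMDiffOn J 𝓘(ℝ, ℝ) ∞ (Definite.lieD W f) O := by
  have h1 := (hf.contMDiffOn_tangentMapWithin (m := ∞) (by simp) hO.uniqueMDiffOn).comp
    W.contMDiff.contMDiffOn fun p hp => hp
  refine ((contMDiff_snd_tangentBundle_modelSpace ℝ 𝓘(ℝ, ℝ)).comp_contMDiffOn h1).congr ?_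
  intro p hp
  change Definite.lieD W f p = mfderivWithin J 𝓘(ℝ, ℝ) f O p (W p)
  rw [mfderivWithin_of_isOpen hO hp]
  rfl

/-- Pull back of a family of functions that converges to zero by a map `ζ` that is smooth on an
open set `O`, multiplied by a function `c` with support in `O`. -/
theorem SmoothZero.pullback_mul [CompactSpace N] (TM : TangentFrame I M) {f : ι → M → ℝ}
    (hf : SmoothZero I F f) {O : Set N} (hO : IsOpen O) {ζ : N → M} (hζ : ContMDiffOn J I ∞ ζ O)
    {c : N → ℝ} (hc : IsSmooth J c) (hcO : tsupport c ⊆ O) :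
    SmoothZero J F fun i p => c p * f i (ζ p) := by
  have hsm : ∀ {g : M → ℝ}, IsSmooth I g → ContMDiffOn J 𝓘(ℝ, ℝ) ∞ (fun p => g (ζ p)) O :=
    fun hg => hg.comp_contMDiffOn hζ
  refine ⟨fun i => isSmooth_mul_of_tsupport hO hc hcO (hsm (hf.smooth i)), fun n => ?_⟩
  induction n generalizing f c with
  | zero =>
    obtain ⟨C, hC⟩ := exists_bound hc
    exact UnifZero.mul hC fun ε hε => (hf.zero 0 ε hε).mono fun i hi p => hi (ζ p)
  | succ n ih =>
    refine ⟨(ih hf hc hcO).unifZero, fun W => ?_⟩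
    have hWc : tsupport (Definite.lieD W c) ⊆ O := by
      refine (closure_minimal ?_ (isClosed_tsupport c)).trans hcO
      intro p hp
      by_contra hpc
      refine hp ?_
      have h0 : c =ᶠ[𝓝 p] fun _ => 0 := notMem_tsupport_iff_eventuallyEq.1 hpc
      exact (dF_congr h0).trans (dF_const 0)
    have hcH : ∀ k, IsSmooth J fun p => c p * Definite.lieD W (fun q => TM.coord k (ζ q)) p :=
      fun k => isSmooth_mul_of_tsupport hO hc hcO (contMDiffOn_lieD hO (hsm (TM.smooth k)) W)
    have hcHO : ∀ k, tsupport (fun p => c p * Definite.lieD W (fun q => TM.coord k (ζ q)) p) ⊆ O :=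
      fun k => (tsupport_mul_subset_left (f := c)).trans hcO
    -- The chain rule expresses the derivative along `W` by the derivatives of `f i` along the
    -- fields of the frame, with coefficients that do not depend on `i`.
    have hcomp : (fun i => Definite.lieD W fun p => c p * f i (ζ p)) = fun i p =>
        Definite.lieD W c p * f i (ζ p)
          + ∑ k, (c p * Definite.lieD W (fun q => TM.coord k (ζ q)) p)
            * Definite.lieD (TM.field k) (f i) (ζ p) := by
      funext i p
      by_cases hp : p ∈ O
      · have hζp := (hζ.contMDiffAt (hO.mem_nhds hp)).mdifferentiableAt (by simp)
        have h1 : Definite.lieD W (fun p => f i (ζ p)) p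
            = ∑ k, Definite.lieD W (fun q => TM.coord k (ζ q)) p
              * Definite.lieD (TM.field k) (f i) (ζ p) := by
          have h2 : ∀ {g : M → ℝ}, IsSmooth I g → Definite.lieD W (fun p => g (ζ p)) p
              = mvfderiv I g (ζ p) (mfderiv J I ζ p (W p)) := fun hg =>
            dF_comp (hg.mdiffAt _) hζp
          rw [h2 (hf.smooth i), ← TM.sum_eq (ζ p) (mfderiv J I ζ p (W p)), map_sum]
          refine Finset.sum_congr rfl fun k _ => ?_
          rw [map_smul, h2 (TM.smooth k), smul_eq_mul]
          rfl
        refine (dF_mul (hc.mdiffAt p)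
          (((hsm (hf.smooth i)).contMDiffAt (hO.mem_nhds hp)).mdifferentiableAt (by simp))).trans ?_
        change c p * Definite.lieD W (fun p => f i (ζ p)) p + _ = _
        rw [h1, Finset.mul_sum, add_comm]
        simp only [mul_assoc]
        rfl
      · have hpc : p ∉ tsupport c := fun h => hp (hcO h)
        have h0 : c =ᶠ[𝓝 p] fun _ => 0 := notMem_tsupport_iff_eventuallyEq.1 hpc
        have h1 : Definite.lieD W c p = 0 := (dF_congr h0).trans (dF_const 0)
        have h2 : (fun p => c p * f i (ζ p)) =ᶠ[𝓝 p] fun _ => 0 := by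
          filter_upwards [h0] with q hq
          rw [hq, zero_mul]
        have h3 : Definite.lieD W (fun p => c p * f i (ζ p)) p = 0 :=
          (dF_congr h2).trans (dF_const 0)
        rw [h3, h1, h0.eq_of_nhds]
        simp
    rw [hcomp]
    have hsum : SmoothZeroUpTo J F n fun i p =>
        ∑ k, (c p * Definite.lieD W (fun q => TM.coord k (ζ q)) p)
            * Definite.lieD (TM.field k) (f i) (ζ p) := by
      have key : ∀ s : Finset (Fin TM.n), SmoothZeroUpTo J F n fun i p =>
        ∑ k ∈ s, (c p * Definite.lieD W (fun q => TM.coord k (ζ q)) p)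
            * Definite.lieD (TM.field k) (f i) (ζ p) := by
        intro s
        induction s using Finset.induction_on with
        | empty => simpa using (smoothZero_zero (I := J) (M := N) (F := F)).zero n
        | insert k s hk ih' =>
          simp only [Finset.sum_insert hk]
          exact SmoothZeroUpTo.add
            (fun i => isSmooth_mul_of_tsupport hO (hcH k) (hcHO k) (hsm ((hf.smooth i).lieD _)))
            (fun i => IsSmooth.sum fun l _ => isSmooth_mul_of_tsupport hO (hcH l) (hcHO l)
              (hsm ((hf.smooth i).lieD _)))
            (ih (hf.lieD _) (hcH k) (hcHO k)) ih'
      exact key Finset.univ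
    exact SmoothZeroUpTo.add
      (fun i => isSmooth_mul_of_tsupport hO (hc.lieD W) hWc (hsm (hf.smooth i)))
      (fun i => IsSmooth.sum fun l _ => isSmooth_mul_of_tsupport hO (hcH l) (hcHO l)
        (hsm ((hf.smooth i).lieD _))) (ih hf (hc.lieD W) hWc) hsum

end SmoothConvergence

/-! ### The map to unitary connections is an embedding -/

section Embedding
variable {X : Type*} [TopologicalSpace X] [ChartedSpace Coord4 X] [IsManifold (𝓡 4) ∞ X]
  {E : X → Type*} [TopologicalSpace (TotalSpace Fib E)]
  [∀ x, NormedAddCommGroup (E x)] [∀ x, InnerProductSpace ℝ (E x)]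
  [FiberBundle Fib E] [VectorBundle ℝ Fib E] [ContMDiffVectorBundle ∞ Fib E (𝓡 4)]
  [IsContMDiffRiemannianBundle (𝓡 4) ∞ Fib E] [T2Space X] [CompactSpace X]
  (T : BundleFrame E) (TX : TangentFrame (𝓡 4) X) (TZ : TangentFrame I6 (SphereBundle E))
  (o : FibreOrientation E)

theorem tendsto_induced_iff {ι α β : Type*} {t : TopologicalSpace β} {g : α → β} {f : ι → α}
    {F : Filter ι} {a : α} : Filter.Tendsto f F (@nhds α (TopologicalSpace.induced g t) a)
      ↔ Filter.Tendsto (fun i => g (f i)) F (@nhds β t (g a)) := by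
  rw [nhds_induced, Filter.tendsto_comap_iff]
  rfl

namespace MetricConnection

/-- `A' σ - A σ` depends on the value of `σ` at `x` only. -/
theorem sum_sub_eq (A' A : MetricConnection E) (σ : Sec E) (x : X) (v : TangentSpace (𝓡 4) x) :
    ∑ i, ⟪σ x, T.dual i x⟫ • (A'.toFun (T.sec i) x v - A.toFun (T.sec i) x v)
      = A'.toFun σ x v - A.toFun σ x v := by
  rw [T.toFun_eq A' σ, T.toFun_eq A σ, ← Finset.sum_sub_distrib]
  exact Finset.sum_congr rfl fun i _ => by module

/-- The difference of two connections as a `1`-form with values in `so(E)`. -/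
def diff (A' A : MetricConnection E) : SoForm E where
  toFun x :=
    { toFun e := ∑ i, ⟪e, T.dual i x⟫ • (A'.toFun (T.sec i) x - A.toFun (T.sec i) x)
      map_add' e e' := by simp only [inner_add_left, add_smul, Finset.sum_add_distrib]
      map_smul' c e := by
        simp only [real_inner_smul_left, mul_smul, Finset.smul_sum, RingHom.id_apply] }
  skew x v w w' := by
    have h : ∀ w : E x, (∑ i, ⟪w, T.dual i x⟫ • (A'.toFun (T.sec i) x - A.toFun (T.sec i) x)) v
        = A'.toFun (T.extend x w) x v - A.toFun (T.extend x w) x v := by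
      intro w
      rw [← sum_sub_eq T A' A, T.extend_apply]
      simp only [LinearMap.sum_apply, LinearMap.smul_apply, LinearMap.sub_apply]
    change ⟪(∑ i, ⟪w, T.dual i x⟫ • (A'.toFun (T.sec i) x - A.toFun (T.sec i) x)) v, w'⟫
      = -⟪w, (∑ i, ⟪w', T.dual i x⟫ • (A'.toFun (T.sec i) x - A.toFun (T.sec i) x)) v⟫
    have h1 := A'.metric (T.extend x w) (T.extend x w') x v
    have h2 := A.metric (T.extend x w) (T.extend x w') x v
    rw [h2, T.extend_apply, T.extend_apply] at h1
    rw [h, h, inner_sub_left, inner_sub_right]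
    linarith
  smooth U σ := by
    have h := (A'.smooth σ U).sub_section (A.smooth σ U)
    convert h using 3 with x
    change _ = A'.toFun σ x (U x) - A.toFun σ x (U x)
    rw [← sum_sub_eq T A' A σ]
    simp only [LinearMap.coe_mk, AddHom.coe_mk, LinearMap.sum_apply, LinearMap.smul_apply,
      LinearMap.sub_apply]

theorem diff_apply (A' A : MetricConnection E) (σ : Sec E) (x : X) (v : TangentSpace (𝓡 4) x) :
    (diff T A' A).toFun x (σ x) v = A'.toFun σ x v - A.toFun σ x v := by
  rw [← sum_sub_eq T A' A σ]
  simp only [diff, LinearMap.coe_mk, AddHom.coe_mk, LinearMap.sum_apply, LinearMap.smul_apply,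
    LinearMap.sub_apply]

theorem translate_diff (A' A : MetricConnection E) : A.translate 1 (diff T A' A) = A' := by
  apply MetricConnection.ext
  funext σ x
  apply LinearMap.ext
  intro v
  change A.toFun σ x v + (1 : ℝ) • (diff T A' A).toFun x (σ x) v = _
  rw [diff_apply]
  module

theorem tendsto_nhds_iff {ι : Type*} {F : Filter ι} (f : ι → MetricConnection E)
    (A : MetricConnection E) : Filter.Tendsto f F (𝓝 A) ↔ ∀ (U : VF (𝓡 4) X) (σ τ : Sec E),
      SmoothZero (𝓡 4) F fun i x => ⟪(diff T (f i) A).toFun x (σ x) (U x), τ x⟫ := by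
  rw [nhds_iInf, Filter.tendsto_iInf]
  refine forall_congr' fun U => ?_
  rw [nhds_iInf, Filter.tendsto_iInf]
  refine forall_congr' fun σ => ?_
  rw [nhds_iInf, Filter.tendsto_iInf]
  refine forall_congr' fun τ => ?_
  refine tendsto_induced_iff.trans ?_
  have h1 : ∀ A : MetricConnection E, IsSmooth (𝓡 4) fun x => ⟪A.toFun σ x (U x), τ x⟫ :=
    fun A => isSmooth_inner (A.cov U σ) τ
  refine (tendsto_smoothTopology_iff (fun i => h1 (f i)) (h1 A)).trans ?_
  simp only [diff_apply, inner_sub_left]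

end MetricConnection

variable {o} in
theorem UnitaryConnection.tendsto_nhds_iff {ι : Type*} {F : Filter ι} (f : ι → UnitaryConnection o)
    (B : UnitaryConnection o) : Filter.Tendsto f F (𝓝 B) ↔
      ∀ (V : VF I6 (SphereBundle E)) (s t : VSection E), SmoothZero I6 F fun i z =>
        ⟪(f i).toFun s z (V z), t.toFun z⟫ - ⟪B.toFun s z (V z), t.toFun z⟫ := by
  rw [nhds_iInf, Filter.tendsto_iInf]
  refine forall_congr' fun V => ?_
  rw [nhds_iInf, Filter.tendsto_iInf]
  refine forall_congr' fun s => ?_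
  rw [nhds_iInf, Filter.tendsto_iInf]
  refine forall_congr' fun t => ?_
  refine tendsto_induced_iff.trans ?_
  have h1 : ∀ B : UnitaryConnection o, IsSmooth I6 fun z => ⟪B.toFun s z (V z), t.toFun z⟫ :=
    fun B => SmoothAlong.inner (B.cov V s).smooth t.smooth
  exact tendsto_smoothTopology_iff (fun i => h1 (f i)) (h1 B)

/-- The induced connections depend on the connection by an affine map. -/
theorem inner_inducedConnection_sub (A' A : MetricConnection E) (s t : VSection E)
    (z : SphereBundle E) (v : TangentSpace I6 z) :
    ⟪(inducedConnection T TX o A').toFun s z v, t.toFun z⟫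
      - ⟪(inducedConnection T TX o A).toFun s z v, t.toFun z⟫
      = ⟪(MetricConnection.diff T A' A).toFun z.proj (s.toFun z) (dπ z v), t.toFun z⟫ := by
  conv_lhs => rw [← MetricConnection.translate_diff T A' A]
  rw [inducedConnection_apply, inducedConnection_apply, inner_vproj_left _ (t.tangent z),
    inner_vproj_left _ (t.tangent z), pullbackDeriv_translate T, one_smul, inner_add_left]
  ring

section Families
variable {ι : Type*} {F : Filter ι} {a : ι → SoForm E}

include T TX in
/-- Convergence of `a` on `X` implies convergence of the corresponding forms on `Z`. -/
theorem smoothZero_lift (h : ∀ (U : VF (𝓡 4) X) (σ τ : Sec E),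
      SmoothZero (𝓡 4) F fun i x => ⟪(a i).toFun x (σ x) (U x), τ x⟫)
    (V : VF I6 (SphereBundle E)) (s t : VSection E) :
    SmoothZero I6 F fun i z => ⟪(a i).toFun z.proj (s.toFun z) (dπ z (V z)), t.toFun z⟫ := by
  have h1 : (fun i z => ⟪(a i).toFun z.proj (s.toFun z) (dπ z (V z)), t.toFun z⟫)
      = fun i (z : SphereBundle E) => ∑ l, ∑ k, ∑ j,
        (⟪t.toFun z, T.dual l z.proj⟫ * (lieD V (fun y : SphereBundle E => TX.coord k y.proj) z
          * ⟪s.toFun z, T.dual j z.proj⟫))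
          * ⟪(a i).toFun z.proj (T.sec j z.proj) (TX.field k z.proj), T.sec l z.proj⟫ := by
    funext i z
    conv_lhs => rw [← T.sum_eq _ (s.toFun z), ← TX.sum_eq z.proj (dπ z (V z)),
      ← T.sum_eq _ (t.toFun z)]
    simp only [map_sum, map_smul, LinearMap.sum_apply, LinearMap.smul_apply, sum_inner, inner_sum,
      real_inner_smul_left, real_inner_smul_right, ← dF_pullback (TX.smooth _)]
    simp only [Finset.mul_sum, mul_assoc]
    rfl
  rw [h1]
  refine SmoothZero.sum fun l _ => SmoothZero.sum fun k _ => SmoothZero.sum fun j _ => ?_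
  refine (h (TX.field k) (T.sec j) (T.sec l)).pullback_mul TX isOpen_univ
    contMDiff_proj.contMDiffOn ?_ (subset_univ _)
  exact (SmoothAlong.inner t.smooth (smoothAlong_pullback _)).mul
    (((TX.smooth k).pullback.lieD V).mul (SmoothAlong.inner s.smooth (smoothAlong_pullback _)))

/-- The cross product of two sections, for the orientation `o`. -/
def crossSec (σ τ : Sec E) : Sec E :=
  ∑ k, Sec.mul (fun x => o.vol x ![σ x, τ x, T.sec k x]) (by
    refine (o.smooth ![σ, τ, T.sec k]).congr fun x => ?_
    congr 1
    funext l; fin_cases l <;> rfl) (T.dual k)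

theorem inner_crossSec (σ τ : Sec E) (x : X) (w : E x) :
    ⟪crossSec T o σ τ x, w⟫ = o.vol x ![σ x, τ x, w] := by
  conv_rhs => rw [← T.sum_eq x w]
  rw [crossSec, Sec.sum_apply, sum_inner, FibreOrientation.vol_sum_third]
  refine Finset.sum_congr rfl fun k _ => ?_
  rw [Sec.mul_apply, real_inner_smul_left, real_inner_comm w]
  ring

theorem inner_crossSec_left (σ τ : Sec E) (x : X) : ⟪crossSec T o σ τ x, σ x⟫ = 0 := by
  rw [inner_crossSec]
  exact (o.vol x).map_eq_zero_of_eq _ (i := 0) (j := 2) rfl (by decide)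

theorem inner_crossSec_right (σ τ : Sec E) (x : X) : ⟪crossSec T o σ τ x, τ x⟫ = 0 := by
  rw [inner_crossSec]
  exact (o.vol x).map_eq_zero_of_eq _ (i := 1) (j := 2) rfl (by decide)

/-- At the point of `Z` in the direction of `ρ x`, a section orthogonal to `ρ` is its own vertical
part. -/
theorem vsec_toSphere {ρ σ : Sec E} {x : X} (hx : ρ x ≠ 0) (h : ⟪ρ x, σ x⟫ = 0) :
    (T.vsec _ (smoothAlong_pullback σ)).toFun (toSphere (ρ x)) = σ x := by
  refine vproj_of_tangent ?_
  change ⟪σ x, unitVec (ρ x)⟫ = 0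
  rw [unitVec, if_neg hx, real_inner_smul_right, real_inner_comm, h, mul_zero]

theorem crossSec_ne_zero {x : X} {σ : Fin 3 → Sec E} (h : LinearIndependent ℝ fun i => σ i x)
    {i j : Fin 3} (hij : i ≠ j) : crossSec T o (σ i) (σ j) x ≠ 0 := by
  obtain ⟨k, hk⟩ : ∃ k : Fin 3, Function.Injective ![i, j, k] := by
    revert i j; decide
  intro h0
  have h1 := inner_crossSec T o (σ i) (σ j) x (σ k x)
  rw [h0, inner_zero_left] at h1
  let b := basisOfLinearIndependentOfCardEqFinrank (h.comp _ hk) (by simp [finrank_fibre])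
  have h2 : o.vol x b ≠ 0 := by
    rw [Ne, ← Ne, AlternatingMap.map_basis_ne_zero_iff]
    intro hvol
    have := finiteDimensional_fibre (E := E) x
    have := o.unit x ((stdOrthonormalBasis ℝ (E x)).reindex (finCongr (finrank_fibre x)))
    rw [hvol] at this
    simp at this
  refine h2 ?_
  rw [h1]
  congr 1
  rw [coe_basisOfLinearIndependentOfCardEqFinrank]
  funext l; fin_cases l <;> rfl

theorem linearIndependent_of_sum_eq {g : ℝ} (hg : g ≠ 0) {x : X} {v w : Fin 3 → E x}
    (h : ∀ e : E x, ∑ i, ⟪e, w i⟫ • v i = g • e) : LinearIndependent ℝ v := by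
  refine linearIndependent_of_top_le_span_of_card_eq_finrank (fun e _ => ?_)
    (by simp [finrank_fibre])
  have he : g⁻¹ • (∑ i, ⟪e, w i⟫ • v i) = e := by rw [h, inv_smul_smul₀ hg]
  rw [← he]
  exact Submodule.smul_mem _ _ (Submodule.sum_mem _ fun i _ =>
    Submodule.smul_mem _ _ (Submodule.subset_span ⟨i, rfl⟩))

variable (hv : ∀ (V : VF I6 (SphereBundle E)) (s t : VSection E),
  SmoothZero I6 F fun i z => ⟪(a i).toFun z.proj (s.toFun z) (dπ z (V z)), t.toFun z⟫)
include T TZ o hv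

/-- Where `σ` and `τ` are independent, the function `⟪a(U) σ, τ⟫` is the restriction of a function
on `Z` to the section of `Z` given by the cross product of `σ` and `τ`. -/
theorem smoothZero_mul_inner (U : VF (𝓡 4) X) (σ τ : Sec E) {c : X → ℝ} (hc : IsSmooth (𝓡 4) c)
    (hcO : tsupport c ⊆ {x | crossSec T o σ τ x ≠ 0}) :
    SmoothZero (𝓡 4) F fun i x => c x * ⟪(a i).toFun x (σ x) (U x), τ x⟫ := by
  set ρ := crossSec T o σ τ
  let ζ : X → SphereBundle E := fun x => toSphere (ρ x)
  have hO := isOpen_ne_zero ρ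
  have hζ := contMDiffOn_toSphere ρ
  let s := T.vsec _ (smoothAlong_pullback σ)
  let t := T.vsec _ (smoothAlong_pullback τ)
  have hsm : ∀ k, ContMDiffOn (𝓡 4) 𝓘(ℝ, ℝ) ∞ (fun x => TZ.coord k (ζ x)) {x | ρ x ≠ 0} :=
    fun k => (TZ.smooth k).comp_contMDiffOn hζ
  have h1 : (fun i x => c x * ⟪(a i).toFun x (σ x) (U x), τ x⟫)
      = fun i x => ∑ k, (c x * lieD U (fun x => TZ.coord k (ζ x)) x)
        * ⟪(a i).toFun (ζ x).proj (s.toFun (ζ x)) (dπ (ζ x) (TZ.field k (ζ x))),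
          t.toFun (ζ x)⟫ := by
    funext i x
    by_cases hx : ρ x ≠ 0
    · have hζx := (hζ.contMDiffAt (hO.mem_nhds hx)).mdifferentiableAt (by simp)
      have hU : dπ (ζ x) (mfderiv (𝓡 4) I6 ζ x (U x)) = U x := dπ_mfderiv_toSphere hx (U x)
      have hs : s.toFun (ζ x) = σ x := vsec_toSphere T hx (inner_crossSec_left T o σ τ x)
      have ht : t.toFun (ζ x) = τ x := vsec_toSphere T hx (inner_crossSec_right T o σ τ x)
      have hcomp : ∀ k, lieD U (fun x => TZ.coord k (ζ x)) x
          = mvfderiv I6 (TZ.coord k) (ζ x) (mfderiv (𝓡 4) I6 ζ x (U x)) := fun k =>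
        dF_comp ((TZ.smooth k).mdiffAt _) hζx
      have key : ⟪(a i).toFun (ζ x).proj (s.toFun (ζ x))
          (dπ (ζ x) (mfderiv (𝓡 4) I6 ζ x (U x))), t.toFun (ζ x)⟫
          = ⟪(a i).toFun x (σ x) (U x), τ x⟫ := by
        rw [hU, hs, ht]; rfl
      rw [← key]
      conv_lhs => rw [← TZ.sum_eq (ζ x) (mfderiv (𝓡 4) I6 ζ x (U x))]
      simp only [dπ, map_sum, map_smul, sum_inner, real_inner_smul_left, Finset.mul_sum, hcomp,
        mul_assoc]
    · have : c x = 0 := image_eq_zero_of_notMem_tsupport fun h => hx (hcO h)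
      simp [this]
  rw [h1]
  refine SmoothZero.sum fun k _ => ?_
  refine (hv (TZ.field k) s t).pullback_mul TZ hO hζ ?_ ?_
  · exact isSmooth_mul_of_tsupport hO hc hcO (contMDiffOn_lieD hO (hsm k) U)
  · exact (tsupport_mul_subset_left (f := c)).trans hcO

/-- Convergence of the forms on `Z` that correspond to `a` implies convergence of `a` on `X`: near a
point of `X` there is a frame of `E`, and the matrix entries of `a` in this frame are controlled by
`smoothZero_mul_inner`. -/
theorem smoothZero_descend (U : VF (𝓡 4) X) (σ τ : Sec E) :
    SmoothZero (𝓡 4) F fun i x => ⟪(a i).toFun x (σ x) (U x), τ x⟫ := by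
  choose g v w hg hg0 hgc hsum using exists_local_bundleFrame (E := E)
  have hu : ∀ c, {x | 0 < g c x} ∈ 𝓝 c := fun c =>
    (isOpen_lt continuous_const (hg c).continuous).mem_nhds (hgc c)
  choose b hb hb0 hb1 hbs using fun c => exists_bump (I := 𝓡 4) (hu c)
  obtain ⟨t, ht⟩ := exists_finset_sum_pos (fun c x => b c x * (g c x * g c x))
    (fun c => ((hb c).mul ((hg c).mul (hg c))).continuous)
    (fun c p => mul_nonneg (hb0 c p) (mul_self_nonneg _))
    (fun c => by rw [(hb1 c).eq_of_nhds]; simpa using mul_pos (hgc c) (hgc c))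
  have hS := (IsSmooth.sum (s := t) fun c _ => (hb c).mul ((hg c).mul (hg c))).inv
    fun p => (ht p).ne'
  have h1 : (fun i x => ⟪(a i).toFun x (σ x) (U x), τ x⟫) = fun i x =>
      (∑ c ∈ t, b c x * (g c x * g c x))⁻¹ * ∑ c ∈ t, ∑ j, ∑ k,
        (⟪τ x, w c j x⟫ * ⟪σ x, w c k x⟫)
          * (b c x * ⟪(a i).toFun x (v c k x) (U x), v c j x⟫) := by
    funext i x
    have h2 : ∀ c, b c x * (g c x * g c x) * ⟪(a i).toFun x (σ x) (U x), τ x⟫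
        = ∑ j, ∑ k, (⟪τ x, w c j x⟫ * ⟪σ x, w c k x⟫)
          * (b c x * ⟪(a i).toFun x (v c k x) (U x), v c j x⟫) := by
      intro c
      have h3 : g c x * g c x * ⟪(a i).toFun x (σ x) (U x), τ x⟫
          = ⟪(a i).toFun x (g c x • σ x) (U x), g c x • τ x⟫ := by
        rw [map_smul, LinearMap.smul_apply, real_inner_smul_left, real_inner_smul_right]
        ring
      rw [mul_assoc, h3, ← hsum, ← hsum]
      simp only [map_sum, map_smul, LinearMap.sum_apply, LinearMap.smul_apply, sum_inner,
        inner_sum, real_inner_smul_left, real_inner_smul_right, Finset.mul_sum]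
      refine Finset.sum_congr rfl fun j _ => Finset.sum_congr rfl fun k _ => ?_
      ring
    rw [← Finset.sum_congr rfl fun c _ => h2 c, ← Finset.sum_mul,
      inv_mul_cancel_left₀ (ht x).ne']
  rw [h1]
  refine SmoothZero.mul hS (SmoothZero.sum fun c _ => SmoothZero.sum fun j _ =>
    SmoothZero.sum fun k _ => SmoothZero.mul ((isSmooth_inner _ _).mul (isSmooth_inner _ _)) ?_)
  rcases eq_or_ne k j with rfl | hkj
  · have h0 : ∀ i x, ⟪(a i).toFun x (v c k x) (U x), v c k x⟫ = 0 := fun i x => by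
      have := (a i).skew x (U x) (v c k x) (v c k x)
      rw [real_inner_comm] at this ⊢
      linarith
    simpa only [h0, mul_zero] using smoothZero_zero
  · refine smoothZero_mul_inner T TZ o hv U (v c k) (v c j) (hb c) fun x hx => ?_
    exact crossSec_ne_zero T o (linearIndependent_of_sum_eq (hbs c hx).ne' (hsum c x)) hkj

end Families

include TZ in
theorem tendsto_inducedConnection_iff {ι : Type*} {F : Filter ι} (f : ι → MetricConnection E)
    (A : MetricConnection E) :
    Filter.Tendsto (fun i => inducedConnection T TX o (f i)) F (𝓝 (inducedConnection T TX o A))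
      ↔ Filter.Tendsto f F (𝓝 A) := by
  rw [UnitaryConnection.tendsto_nhds_iff, MetricConnection.tendsto_nhds_iff T]
  simp only [inner_inducedConnection_sub]
  exact ⟨fun h => smoothZero_descend T TZ o h, fun h => smoothZero_lift T TX h⟩

theorem inducedConnection_injective :
    Function.Injective (inducedConnection T TX o : MetricConnection E → _) := by
  intro A' A h
  let zero : SoForm E :=
    { toFun _ := 0
      skew _ _ _ _ := by simp
      smooth _ _ := contMDiff_zeroSection ℝ E }
  have h1 : MetricConnection.diff T A' A = zero := by
    refine velocity_injective T TX o ?_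
    refine SmoothForm.ext (funext fun z => AlternatingMap.ext fun v => ?_)
    change velocityVal o _ z (v 0) = velocityVal o zero z (v 0)
    obtain ⟨s, t, hne⟩ := exists_vsections T o z
    have h2 := inner_inducedConnection_sub T TX o A' A s t z (v 0)
    rw [h, sub_self, inner_eq_velocityVal o _ z _ (s.tangent z) (t.tangent z)] at h2
    have h3 := inner_eq_velocityVal o zero z (v 0) (s.tangent z) (t.tangent z)
    rw [show ⟪zero.toFun z.proj (s.toFun z) (dπ z (v 0)), t.toFun z⟫ = 0 from
      inner_zero_left _, h2] at h3
    exact mul_left_cancel₀ (neg_ne_zero.2 two_pi_ne) (mul_right_cancel₀ hne h3)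
  have h4 := MetricConnection.translate_diff T A' A
  rw [← h4, h1]
  apply MetricConnection.ext
  funext σ x
  change A.toFun σ x + (1 : ℝ) • (0 : E x →ₗ[ℝ] TangentSpace (𝓡 4) x →ₗ[ℝ] E x) (σ x) = _
  simp

include TZ in
theorem isEmbedding_inducedConnection :
    IsEmbedding (inducedConnection T TX o : MetricConnection E → _) := by
  refine ⟨isInducing_iff_nhds.2 fun A => le_antisymm ?_ ?_, inducedConnection_injective T TX o⟩
  · exact Filter.tendsto_iff_comap.1
      ((tendsto_inducedConnection_iff T TX TZ o (fun A => A) A).2 Filter.tendsto_id)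
  · exact (tendsto_inducedConnection_iff T TX TZ o (fun A => A) A).1 Filter.tendsto_comap

include TZ in
theorem isEmbedding_definite (h : ∀ A : MetricConnection E, A.IsDefinite →
      (inducedConnection T TX o A).IsSymplectic) :
    IsEmbedding fun A : DefiniteSpace E =>
      (⟨inducedConnection T TX o A, h A A.2⟩ : SymplecticSpace o) := by
  have h1 := (isEmbedding_inducedConnection T TX TZ o).comp
    (IsEmbedding.subtypeVal (p := MetricConnection.IsDefinite (E := E)))
  exact IsEmbedding.of_comp (h1.continuous.subtype_mk _) continuous_subtype_val h1

end Embedding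

/-! ### Wedge products -/

section Wedge

/-- The wedge product as a sum over representatives of shuffles. -/
theorem wedge_apply {V : Type*} [AddCommGroup V] [Module ℝ V] {k l : ℕ}
    (α : V [⋀^Fin k]→ₗ[ℝ] ℝ) (β : V [⋀^Fin l]→ₗ[ℝ] ℝ) (v : Fin (k + l) → V) :
    wedge α β v = ∑ σ : Equiv.Perm.ModSumCongr (Fin k) (Fin l),
      ((Equiv.Perm.sign (Quotient.out σ) : ℤ) : ℝ) *
        (α (fun i => v (finSumFinEquiv (Quotient.out σ (Sum.inl i))))
          * β fun i => v (finSumFinEquiv (Quotient.out σ (Sum.inr i)))) := by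
  change LinearMap.mul' ℝ ℝ ((∑ σ : Equiv.Perm.ModSumCongr (Fin k) (Fin l),
    AlternatingMap.domCoprod.summand α β σ) fun i => v (finSumFinEquiv i)) = _
  rw [_root_.sum_apply, map_sum]
  refine Finset.sum_congr rfl fun σ _ => ?_
  have h : AlternatingMap.domCoprod.summand α β σ
      = Equiv.Perm.sign (Quotient.out σ) • (MultilinearMap.domCoprod α.toMultilinearMap
        β.toMultilinearMap).domDomCongr (Quotient.out σ) := by
    conv_lhs => rw [← Quotient.out_eq' σ]
    rfl
  rw [h, _root_.smul_apply, Units.smul_def, map_zsmul, MultilinearMap.domDomCongr_apply,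
    MultilinearMap.domCoprod_apply, LinearMap.mul'_apply, zsmul_eq_mul]
  rfl

variable {EM : Type*} [NormedAddCommGroup EM] [NormedSpace ℝ EM] {HM : Type*} [TopologicalSpace HM]
  {I : ModelWithCorners ℝ EM HM} {M : Type*} [TopologicalSpace M] [ChartedSpace HM M]
  [IsManifold I ∞ M]

/-- The wedge product of smooth forms. -/
def SmoothForm.wedge {k l : ℕ} (α : SmoothForm I M k) (β : SmoothForm I M l) :
    SmoothForm I M (k + l) where
  val p := Definite.wedge (α.val p) (β.val p)
  smooth U := by
    simp only [wedge_apply]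
    exact IsSmooth.sum fun σ _ => (isSmooth_const _).mul ((α.smooth _).mul (β.smooth _))

/-- The pull back of `η` by `τ` is `ε η`. -/
def IsEigenform (τ : M → M) (ε : ℝ) {k : ℕ} (η : ∀ p : M, TangentSpace I p [⋀^Fin k]→ₗ[ℝ] ℝ) :
    Prop :=
  ∀ (p : M) (v : Fin k → TangentSpace I p), η (τ p) (fun i => mfderiv I I τ p (v i)) = ε * η p v

theorem IsEigenform.wedge {τ : M → M} {ε δ : ℝ} {k l : ℕ}
    {α : ∀ p : M, TangentSpace I p [⋀^Fin k]→ₗ[ℝ] ℝ}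
    {β : ∀ p : M, TangentSpace I p [⋀^Fin l]→ₗ[ℝ] ℝ}
    (hα : IsEigenform τ ε α) (hβ : IsEigenform τ δ β) :
    IsEigenform τ (ε * δ) fun p => Definite.wedge (α p) (β p) := by
  intro p v
  rw [wedge_apply, wedge_apply, Finset.mul_sum]
  refine Finset.sum_congr rfl fun σ _ => ?_
  rw [hα p fun i => v (finSumFinEquiv (Quotient.out σ (Sum.inl i))),
    hβ p fun i => v (finSumFinEquiv (Quotient.out σ (Sum.inr i)))]
  ring

end Wedge

/-! ### Integration and involutions -/

section Integration
variable {EM : Type*} [NormedAddCommGroup EM] [NormedSpace ℝ EM] {HM : Type*} [TopologicalSpace HM]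
  {I : ModelWithCorners ℝ EM HM} {M : Type*} [TopologicalSpace M] [ChartedSpace HM M]
  [IsManifold I ∞ M] [I.Boundaryless] {n : ℕ} (b : Basis (Fin n) ℝ EM)

/-- The coefficient of a smooth form in a chart is continuous. -/
theorem continuousOn_coordCoeff (TM : TangentFrame I M) (η : SmoothForm I M n) (c : M) :
    ContinuousOn (coordCoeff b η.val c) (extChartAt I c).target := by
  have h : ∀ y ∈ (extChartAt I c).target, coordCoeff b η.val c y = ∑ K : Fin n → Fin TM.n,
      (∏ i, fderiv ℝ (fun y => TM.coord (K i) ((extChartAt I c).symm y)) y (b i))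
        * η.val ((extChartAt I c).symm y) fun i => TM.field (K i) ((extChartAt I c).symm y) := by
    intro y hy
    have hy' : MDifferentiableAt 𝓘(ℝ, EM) I (extChartAt I c).symm y :=
      ((contMDiffOn_extChartAt_symm (n := ∞) c).contMDiffAt
        ((isOpen_extChartAt_target c).mem_nhds hy)).mdifferentiableAt (by simp)
    have h1 : ∀ i k, mvfderiv I (TM.coord k) ((extChartAt I c).symm y)
        (mfderiv 𝓘(ℝ, EM) I (extChartAt I c).symm y (b i))
        = fderiv ℝ (fun y => TM.coord k ((extChartAt I c).symm y)) y (b i) := by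
      intro i k
      rw [← mvfderiv_model]
      exact (dF_comp ((TM.smooth k).mdiffAt _) hy').symm
    unfold coordCoeff
    have h2 : (fun i => mfderiv 𝓘(ℝ, EM) I (extChartAt I c).symm y (b i))
        = fun i => ∑ k, fderiv ℝ (fun y => TM.coord k ((extChartAt I c).symm y)) y (b i)
          • TM.field k ((extChartAt I c).symm y) := by
      funext i
      rw [← TM.sum_eq _ (mfderiv 𝓘(ℝ, EM) I (extChartAt I c).symm y (b i))]
      simp only [h1]
    rw [h2]
    refine ((η.val ((extChartAt I c).symm y)).toMultilinearMap.map_sum _).trans ?_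
    refine Finset.sum_congr rfl fun K _ => ?_
    exact (η.val ((extChartAt I c).symm y)).toMultilinearMap.map_smul_univ _ _
  refine ContinuousOn.congr ?_ h
  refine continuousOn_finsetSum _ fun K _ => ContinuousOn.mul ?_ ?_
  · refine continuousOn_finsetProd _ fun i _ => ?_
    have h1 : ContDiffOn ℝ ∞ (fun y => TM.coord (K i) ((extChartAt I c).symm y))
        (extChartAt I c).target :=
      contMDiffOn_iff_contDiffOn.1 ((TM.smooth (K i)).comp_contMDiffOn
        (contMDiffOn_extChartAt_symm c))
    exact (h1.continuousOn_fderiv_of_isOpen (isOpen_extChartAt_target c) (by simp)).clm_apply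
      continuousOn_const
  · exact (η.smooth fun i => TM.field (K i)).continuous.comp_continuousOn
      (continuousOn_extChartAt_symm c)

theorem alternatingMap_comp_basis {V : Type*} [AddCommGroup V] [Module ℝ V] (b : Basis (Fin n) ℝ V)
    (μ : V [⋀^Fin n]→ₗ[ℝ] ℝ) (A : V →ₗ[ℝ] V) :
    μ (fun i => A (b i)) = LinearMap.det A * μ b := by
  rw [μ.eq_smul_basis_det b]
  have := b.det_comp A b
  simp only [AlternatingMap.smul_apply, smul_eq_mul, b.det_self, mul_one]
  rw [show (fun i => A (b i)) = A ∘ b from rfl, this, b.det_self]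
  ring

variable {τ : M → M} (hτ : ContMDiff I I ∞ τ)

variable (I τ) in
/-- The map `τ` in the charts centred at `c` and `d`. -/
def chartMap (c d : M) (y : EM) : EM := extChartAt I d (τ ((extChartAt I c).symm y))

variable (I τ) in
/-- The domain of `chartMap I τ c d`. -/
def chartDomain (c d : M) : Set EM :=
  (extChartAt I c).target ∩ (extChartAt I c).symm ⁻¹' (τ ⁻¹' (extChartAt I d).source)

include hτ

theorem isOpen_chartDomain (c d : M) : IsOpen (chartDomain I τ c d) :=
  (continuousOn_extChartAt_symm c).isOpen_inter_preimage (isOpen_extChartAt_target c)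
    ((isOpen_extChartAt_source d).preimage hτ.continuous)

theorem contMDiffAt_chartMap {c d : M} {y : EM} (hy : y ∈ chartDomain I τ c d) :
    ContMDiffAt 𝓘(ℝ, EM) 𝓘(ℝ, EM) ∞ (chartMap I τ c d) y := by
  have h1 : ContMDiffAt 𝓘(ℝ, EM) I ∞ (extChartAt I c).symm y :=
    (contMDiffOn_extChartAt_symm c).contMDiffAt ((isOpen_extChartAt_target c).mem_nhds hy.1)
  have h2 : ContMDiffAt I 𝓘(ℝ, EM) ∞ (extChartAt I d) (τ ((extChartAt I c).symm y)) :=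
    contMDiffAt_extChartAt' (by simpa using hy.2)
  exact h2.comp y ((hτ _).comp y h1)

/-- In coordinates, the pull back by `τ` of a form of top degree is multiplication by the
determinant of the derivative. -/
theorem coordCoeff_chartMap {c d : M} {y : EM} (hy : y ∈ chartDomain I τ c d) {ε : ℝ}
    {μ : ∀ p : M, TangentSpace I p [⋀^Fin n]→ₗ[ℝ] ℝ} (hμ : IsEigenform τ ε μ) :
    ε * coordCoeff b μ c y = (fderiv ℝ (chartMap I τ c d) y).det
      * coordCoeff b μ d (chartMap I τ c d y) := by
  have hm := contMDiffAt_chartMap hτ hy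
  have hmem : chartMap I τ c d y ∈ (extChartAt I d).target := (extChartAt I d).map_source hy.2
  have hd : MDifferentiableAt 𝓘(ℝ, EM) I (extChartAt I d).symm (chartMap I τ c d y) :=
    ((contMDiffOn_extChartAt_symm (n := ∞) d).contMDiffAt
      ((isOpen_extChartAt_target d).mem_nhds hmem)).mdifferentiableAt (by simp)
  have hc : MDifferentiableAt 𝓘(ℝ, EM) I (extChartAt I c).symm y :=
    ((contMDiffOn_extChartAt_symm (n := ∞) c).contMDiffAt
      ((isOpen_extChartAt_target c).mem_nhds hy.1)).mdifferentiableAt (by simp)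
  have hev : (extChartAt I d).symm ∘ chartMap I τ c d =ᶠ[𝓝 y] τ ∘ (extChartAt I c).symm := by
    filter_upwards [(isOpen_chartDomain hτ c d).mem_nhds hy] with x hx
    exact (extChartAt I d).left_inv hx.2
  have hder : ∀ w : EM, mfderiv 𝓘(ℝ, EM) I (extChartAt I d).symm (chartMap I τ c d y)
      (fderiv ℝ (chartMap I τ c d) y w)
      = (mfderiv I I τ ((extChartAt I c).symm y)
        (mfderiv 𝓘(ℝ, EM) I (extChartAt I c).symm y w) : EM) := by
    intro w
    have h1 := mfderiv_comp_apply y hd (hm.mdifferentiableAt (by simp)) w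
    have h2 := mfderiv_comp_apply y ((hτ ((extChartAt I c).symm y)).mdifferentiableAt (by simp))
      hc w
    rw [mfderiv_eq_fderiv] at h1
    exact h1.symm.trans ((congrArg (fun L : EM →L[ℝ] EM => L w) hev.mfderiv_eq).trans h2)
  have h3 := alternatingMap_comp_basis b
    ((μ ((extChartAt I d).symm (chartMap I τ c d y))).compLinearMap
    (mfderiv 𝓘(ℝ, EM) I (extChartAt I d).symm (chartMap I τ c d y)).toLinearMap)
    (fderiv ℝ (chartMap I τ c d) y).toLinearMap
  refine Eq.trans ?_ h3
  have h4 := hμ ((extChartAt I c).symm y) fun i => mfderiv 𝓘(ℝ, EM) I (extChartAt I c).symm y (b i)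
  refine h4.symm.trans ?_
  have h5 : ∀ (q : M) (v w : Fin n → EM), q = τ ((extChartAt I c).symm y) → (∀ i, w i = v i) →
      μ (τ ((extChartAt I c).symm y)) v = μ q w := by
    rintro _ v w rfl h
    rw [funext h]
  exact h5 _ _ _ ((extChartAt I d).left_inv hy.2) fun i => hder (b i)

variable (hinv : ∀ p, τ (τ p) = p)
include hinv

theorem injOn_chartMap (c d : M) : InjOn (chartMap I τ c d) (chartDomain I τ c d) := by
  intro x hx y hy hxy
  have h1 := (extChartAt I d).injOn hx.2 hy.2 hxy
  have h2 := congrArg τ h1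
  rw [hinv, hinv] at h2
  exact (extChartAt I c).symm.injOn hx.1 hy.1 h2

theorem symm_chartMap {c d : M} {y : EM} (hy : y ∈ chartDomain I τ c d) :
    (extChartAt I d).symm (chartMap I τ c d y) = τ ((extChartAt I c).symm y) :=
  (extChartAt I d).left_inv hy.2

theorem chartMap_mem {c d : M} {y : EM} (hy : y ∈ chartDomain I τ c d) :
    chartMap I τ c d y ∈ chartDomain I τ d c := by
  refine ⟨(extChartAt I d).map_source hy.2, ?_⟩
  change τ ((extChartAt I d).symm (chartMap I τ c d y)) ∈ (extChartAt I c).source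
  rw [symm_chartMap hτ hinv hy, hinv]
  exact (extChartAt I c).map_target hy.1

theorem image_chartMap (c d : M) :
    chartMap I τ c d '' chartDomain I τ c d = chartDomain I τ d c := by
  refine Subset.antisymm (image_subset_iff.2 fun y hy => chartMap_mem hτ hinv hy) fun y hy => ?_
  refine ⟨chartMap I τ d c y, chartMap_mem hτ hinv hy, ?_⟩
  unfold chartMap
  rw [(extChartAt I c).left_inv hy.2, hinv]
  exact (extChartAt I d).right_inv hy.1

end Integration

section IntegralVanishing

theorem sign_mul_mul_self (a x : ℝ) : Real.sign (a * x) * a = |a| * Real.sign x := by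
  rcases lt_trichotomy a 0 with h | rfl | h
  · have : Real.sign (a * x) = - Real.sign x := by
      rcases lt_trichotomy x 0 with hx | rfl | hx
      · rw [Real.sign_of_pos (mul_pos_of_neg_of_neg h hx), Real.sign_of_neg hx]; ring
      · simp
      · rw [Real.sign_of_neg (mul_neg_of_neg_of_pos h hx), Real.sign_of_pos hx]
    rw [this, abs_of_neg h]; ring
  · simp
  · have : Real.sign (a * x) = Real.sign x := by
      rcases lt_trichotomy x 0 with hx | rfl | hx
      · rw [Real.sign_of_neg (mul_neg_of_pos_of_neg h hx), Real.sign_of_neg hx]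
      · simp
      · rw [Real.sign_of_pos (mul_pos h hx), Real.sign_of_pos hx]
    rw [this, abs_of_pos h]; ring

theorem measurable_realSign : Measurable Real.sign :=
  Measurable.ite measurableSet_Iio measurable_const
    (Measurable.ite measurableSet_Ioi measurable_const measurable_const)

theorem norm_realSign_le (x : ℝ) : ‖Real.sign x‖ ≤ 1 := by
  rcases Real.sign_apply_eq x with h | h | h <;> simp [h]

open MeasureTheory

variable {EM : Type*} [NormedAddCommGroup EM] [NormedSpace ℝ EM] [FiniteDimensional ℝ EM]
  [MeasureSpace EM] [BorelSpace EM] [(volume : Measure EM).IsAddHaarMeasure]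
  {HM : Type*} [TopologicalSpace HM]
  {I : ModelWithCorners ℝ EM HM} {M : Type*} [TopologicalSpace M] [ChartedSpace HM M]
  [IsManifold I ∞ M] [I.Boundaryless] [CompactSpace M] [T2Space M]
  {n : ℕ} (b : Basis (Fin n) ℝ EM)
  {θ η : ∀ p : M, TangentSpace I p [⋀^Fin n]→ₗ[ℝ] ℝ}

variable (θ η) in
/-- The integrand of `integralForm` in the chart centred at `c`, for the partition of unity `ρ`. -/
def localIntegrand (ρ : PartitionOfUnity M M) (c : M) (y : EM) : ℝ :=
  ρ c ((extChartAt I c).symm y) * Real.sign (coordCoeff b θ c y) * coordCoeff b η c y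

variable (hθc : ∀ c, ContinuousOn (coordCoeff b θ c) (extChartAt I c).target)
  (hηc : ∀ c, ContinuousOn (coordCoeff b η c) (extChartAt I c).target)
  {ρ : PartitionOfUnity M M} (hρ : ρ.IsSubordinate fun c => (chartAt HM c).source)

include hθc hηc hρ in
/-- The integrand is a bounded measurable sign times a continuous function with compact support in
the chart. -/
theorem integrableOn_mul_localIntegrand {f : M → ℝ} (hf : Continuous f) (c : M) :
    IntegrableOn (fun y => f ((extChartAt I c).symm y) * localIntegrand b θ η ρ c y)
      (extChartAt I c).target := by
  have hmeas : MeasurableSet (extChartAt I c).target := (isOpen_extChartAt_target c).measurableSet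
  have hsub : tsupport (ρ c) ⊆ (extChartAt I c).source := by
    rw [extChartAt_source]; exact hρ c
  have hK : IsCompact (extChartAt I c '' tsupport (ρ c)) :=
    (isClosed_tsupport _).isCompact.image_of_continuousOn ((continuousOn_extChartAt c).mono hsub)
  have hKT : extChartAt I c '' tsupport (ρ c) ⊆ (extChartAt I c).target :=
    image_subset_iff.2 fun p hp => (extChartAt I c).map_source (hsub hp)
  have h1 : IntegrableOn (fun y => f ((extChartAt I c).symm y) * (ρ c ((extChartAt I c).symm y)
      * coordCoeff b η c y)) (extChartAt I c).target := by
    refine IntegrableOn.of_forall_sdiff_eq_zero (s := extChartAt I c '' tsupport (ρ c)) ?_ hmeas ?_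
    · refine ContinuousOn.integrableOn_compact hK ?_
      refine ContinuousOn.mono ?_ hKT
      exact (hf.comp_continuousOn (continuousOn_extChartAt_symm c)).mul
        (((ρ c).continuous.comp_continuousOn (continuousOn_extChartAt_symm c)).mul (hηc c))
    · rintro y ⟨hy, hyK⟩
      have : ρ c ((extChartAt I c).symm y) = 0 := by
        by_contra h
        exact hyK ⟨_, subset_tsupport _ h, (extChartAt I c).right_inv hy⟩
      rw [this]; ring
  have h2 := Integrable.bdd_mul (c := 1) (f := fun y => Real.sign (coordCoeff b θ c y)) h1
    ((measurable_realSign.comp_aemeasurable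
      ((hθc c).aemeasurable hmeas)).aestronglyMeasurable)
    (Filter.Eventually.of_forall fun y => norm_realSign_le _)
  refine h2.congr (Filter.Eventually.of_forall fun y => ?_)
  simp only [localIntegrand]
  ring

variable {τ : M → M} (hτ : ContMDiff I I ∞ τ) (hinv : ∀ p, τ (τ p) = p)
  (hθ : IsEigenform τ (-1) θ) (hη : IsEigenform τ 1 η)

include hτ hinv hθ hη hρ in
/-- The part of the integral over the chart at `c` that `τ` maps to the chart at `d` cancels with
the part of the integral over the chart at `d` that `τ` maps to the chart at `c`. -/
theorem integral_mul_localIntegrand_swap (c d : M) :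
    ∫ y in (extChartAt I c).target, ρ d (τ ((extChartAt I c).symm y)) * localIntegrand b θ η ρ c y
      = -∫ y in (extChartAt I d).target,
          ρ c (τ ((extChartAt I d).symm y)) * localIntegrand b θ η ρ d y := by
  have hres : ∀ c d : M, ∫ y in (extChartAt I c).target,
      ρ d (τ ((extChartAt I c).symm y)) * localIntegrand b θ η ρ c y
      = ∫ y in chartDomain I τ c d,
        ρ d (τ ((extChartAt I c).symm y)) * localIntegrand b θ η ρ c y := by
    intro c d
    refine setIntegral_eq_of_subset_of_forall_sdiff_eq_zero
      (isOpen_extChartAt_target c).measurableSet inter_subset_left ?_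
    rintro y ⟨hy, hy'⟩
    have : ρ d (τ ((extChartAt I c).symm y)) = 0 := by
      by_contra h
      refine hy' ⟨hy, ?_⟩
      change _ ∈ (extChartAt I d).source
      rw [extChartAt_source]
      exact hρ d (subset_tsupport _ h)
    rw [this, zero_mul]
  rw [hres c d, hres d c, ← image_chartMap hτ hinv c d,
    integral_image_eq_integral_abs_det_fderiv_smul volume
      (isOpen_chartDomain hτ c d).measurableSet
      (fun y hy => ((contMDiffAt_chartMap hτ hy).contDiffAt.differentiableAt
        (by simp)).hasFDerivAt.hasFDerivWithinAt) (injOn_chartMap hτ hinv c d), ← integral_neg]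
  refine setIntegral_congr_fun (isOpen_chartDomain hτ c d).measurableSet fun y hy => ?_
  have h1 := coordCoeff_chartMap b hτ hy hθ
  have h2 := coordCoeff_chartMap b hτ hy hη
  have h3 := sign_mul_mul_self (fderiv ℝ (chartMap I τ c d) y).det
    (coordCoeff b θ d (chartMap I τ c d y))
  rw [← h1, neg_one_mul, Real.sign_neg] at h3
  rw [one_mul] at h2
  simp only [localIntegrand, smul_eq_mul]
  rw [symm_chartMap hτ hinv hy, hinv, h2]
  -- The sign of the coefficient of `θ` changes by minus the sign of the determinant, since `τ`
  -- reverses `θ`, so that the product with the coefficient of `η` changes by `-|det|`.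
  linear_combination (-(ρ d (τ ((extChartAt I c).symm y)) * ρ c ((extChartAt I c).symm y)
    * coordCoeff b η d (chartMap I τ c d y))) * h3

include hθc hηc hρ hτ hinv hθ hη in
/-- Splitting each local integral by the partition of unity pulled back by `τ` gives a double sum
that is skew in the two charts. -/
theorem finsum_localIntegrand_eq_zero :
    ∑ᶠ c : M, ∫ y in (extChartAt I c).target, localIntegrand b θ η ρ c y = 0 := by
  have hfin := ρ.locallyFinite.finite_nonempty_of_compact
  have hz : ∀ c, c ∉ hfin.toFinset → ∀ p, ρ c p = 0 := by
    intro c hc p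
    by_contra h
    exact hc (hfin.mem_toFinset.2 ⟨p, h⟩)
  have hone : ∀ p, ∑ d ∈ hfin.toFinset, ρ d p = 1 := by
    intro p
    refine ρ.sum_finsupport' (mem_univ p) fun d hd => ?_
    by_contra h
    exact (ρ.mem_finsupport p).1 hd (hz d h p)
  rw [finsum_eq_sum_of_support_subset (s := hfin.toFinset)]
  swap
  · intro c hc
    by_contra h
    refine hc ?_
    simp [localIntegrand, hz c h]
  have hsplit : ∀ c, ∫ y in (extChartAt I c).target, localIntegrand b θ η ρ c y
      = ∑ d ∈ hfin.toFinset, ∫ y in (extChartAt I c).target,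
        ρ d (τ ((extChartAt I c).symm y)) * localIntegrand b θ η ρ c y := by
    intro c
    rw [← integral_finsetSum]
    · refine integral_congr_ae (Filter.Eventually.of_forall fun y => ?_)
      simp only
      rw [← Finset.sum_mul, hone, one_mul]
    · intro d _
      exact integrableOn_mul_localIntegrand b hθc hηc hρ
        ((ρ d).continuous.comp hτ.continuous) c
  have h : ∑ c ∈ hfin.toFinset, ∫ y in (extChartAt I c).target, localIntegrand b θ η ρ c y
      = -∑ c ∈ hfin.toFinset, ∫ y in (extChartAt I c).target, localIntegrand b θ η ρ c y := by
    conv_lhs => rw [Finset.sum_congr rfl fun c _ => hsplit c, Finset.sum_comm]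
    rw [← Finset.sum_neg_distrib]
    refine Finset.sum_congr rfl fun d _ => ?_
    rw [hsplit d, ← Finset.sum_neg_distrib]
    exact Finset.sum_congr rfl fun c _ => integral_mul_localIntegrand_swap b hρ hτ hinv hθ hη c d
  linarith

include hθc hηc hτ hinv hθ hη in
/-- If the involution `τ` reverses the orientation form `θ` and preserves `η`, then `η` has
integral zero. -/
theorem integralForm_eq_zero : integralForm b θ η = 0 := by
  unfold integralForm
  split_ifs with h
  · exact finsum_localIntegrand_eq_zero b hθc hηc h.choose_spec hτ hinv hθ hη
  · rfl

end IntegralVanishing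

/-! ### The antipodal map -/

section Antipode
variable {X : Type*} [TopologicalSpace X] [ChartedSpace Coord4 X] [IsManifold (𝓡 4) ∞ X]
  {E : X → Type*} [TopologicalSpace (TotalSpace Fib E)]
  [∀ x, NormedAddCommGroup (E x)] [∀ x, InnerProductSpace ℝ (E x)]
  [FiberBundle Fib E] [VectorBundle ℝ Fib E] [ContMDiffVectorBundle ∞ Fib E (𝓡 4)]
  [IsContMDiffRiemannianBundle (𝓡 4) ∞ Fib E]

/-- The antipodal map of the fibres of `Z`. -/
def antipode (z : SphereBundle E) : SphereBundle E :=
  ⟨⟨z.proj, -z.vec⟩, (norm_neg _).trans z.norm_vec⟩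

theorem vec_antipode (z : SphereBundle E) : (antipode z).vec = (-z.vec : E z.proj) := rfl

theorem antipode_antipode (z : SphereBundle E) : antipode (antipode z) = z := by
  refine Subtype.ext ?_
  change (⟨z.proj, - -z.vec⟩ : TotalSpace Fib E) = ⟨z.proj, z.vec⟩
  rw [neg_neg]

theorem area_antipode (o : FibreOrientation E) (z : SphereBundle E) (s t : E z.proj) :
    o.area (antipode z) s t = -o.area z s t := by
  have h := (o.vol z.proj).curryLeft.map_neg z.vec
  exact congrArg (fun l : E z.proj [⋀^Fin 2]→ₗ[ℝ] ℝ => l ![s, t]) h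

theorem inner_vec_antipode {z : SphereBundle E} {s : E z.proj} (hs : ⟪s, z.vec⟫ = 0) :
    ⟪s, (antipode z).vec⟫ = 0 := by
  rw [vec_antipode]
  exact (inner_neg_right s z.vec).trans (by rw [hs, neg_zero])

variable (T : BundleFrame E)

include T in
theorem BundleFrame.contMDiff_antipode : ContMDiff I6 I6 ∞ (antipode : SphereBundle E → _) := by
  intro z
  refine contMDiffAt_sphereBundle ?_
  refine T.contMDiff_of_inner (s := fun z : SphereBundle E => -z.vec) contMDiff_proj (fun i => ?_) z
  simp only [inner_neg_left]
  exact (SmoothAlong.inner contMDiff_vec (smoothAlong_pullback _)).neg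

/-- The differential of the antipodal map. -/
abbrev dAntipode (z : SphereBundle E) (v : TangentSpace I6 z) : TangentSpace I6 (antipode z) :=
  mfderiv I6 I6 antipode z v

include T in
theorem dπ_dAntipode (z : SphereBundle E) (v : TangentSpace I6 z) :
    dπ (antipode z) (dAntipode z v) = (dπ z v : Coord4) := by
  have h := mfderiv_comp_apply z
    ((contMDiff_proj (E := E) (antipode z)).mdifferentiableAt (by simp))
    ((T.contMDiff_antipode z).mdifferentiableAt (by simp)) v
  exact h.symm

include T in
/-- The covariant derivative of the tautological section at the antipode: the antipodal map reverses
this section and preserves the connection. -/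
theorem pullbackDeriv_vec_dAntipode (A : MetricConnection E) (z : SphereBundle E)
    (v : TangentSpace I6 z) :
    pullbackDeriv A SphereBundle.vec (antipode z) (dAntipode z v)
      = (-pullbackDeriv A SphereBundle.vec z v : E z.proj) := by
  have h2 : ∀ i, mvfderiv I6 (fun y : SphereBundle E => ⟪y.vec, T.dual i y.proj⟫) (antipode z)
      (dAntipode z v) = -mvfderiv I6 (fun y : SphereBundle E => ⟪y.vec, T.dual i y.proj⟫) z v := by
    intro i
    have hs : IsSmooth I6 fun y : SphereBundle E => ⟪y.vec, T.dual i y.proj⟫ :=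
      SmoothAlong.inner contMDiff_vec (smoothAlong_pullback _)
    have h3 := dF_comp (hs.mdiffAt (antipode z))
      ((T.contMDiff_antipode z).mdifferentiableAt (by simp)) (v := v)
    rw [← dF_neg]
    refine h3.symm.trans ?_
    congr 2
    funext y
    exact inner_neg_left _ _
  have e1 := T.pullbackDeriv_eq A contMDiff_vec (antipode z) (dAntipode z v)
  have e2 := T.pullbackDeriv_eq A contMDiff_vec z v
  simp only [h2] at e1
  rw [e2, ← Finset.sum_neg_distrib]
  refine e1.trans (Finset.sum_congr rfl fun i _ => ?_)
  have h4 : A.toFun (T.sec i) (antipode z).proj (dπ (antipode z) (dAntipode z v))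
      = A.toFun (T.sec i) z.proj (dπ z v) :=
    congrArg (A.toFun (T.sec i) z.proj) (dπ_dAntipode T z v)
  have h5 : ⟪(antipode z).vec, T.dual i (antipode z).proj⟫ = -⟪z.vec, T.dual i z.proj⟫ :=
    inner_neg_left _ _
  rw [h4, h5]
  have h6 : ∀ (c d : ℝ) (p q : E z.proj), (-c) • p + (-d) • q = -(c • p + d • q) := by
    intros; module
  exact h6 _ _ _ _

variable [T2Space X] [CompactSpace X] (TX : TangentFrame (𝓡 4) X) (o : FibreOrientation E)

theorem inducedCurv_dAntipode (A : MetricConnection E) (z : SphereBundle E)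
    (u w : TangentSpace I6 z) (e e' : E z.proj) :
    inducedCurv T TX A (antipode z) (dAntipode z u) (dAntipode z w) e e'
      = inducedCurv T TX A z u w e e' := by
  unfold inducedCurv
  rw [pullbackDeriv_vec_dAntipode T A z u, pullbackDeriv_vec_dAntipode T A z w]
  have h1 := dπ_dAntipode T z u
  have h2 := dπ_dAntipode T z w
  have h3 : ∀ v : TangentSpace I6 z, ∀ e : E z.proj,
      ⟪(-pullbackDeriv A SphereBundle.vec z v : E z.proj), e⟫
        = -⟪pullbackDeriv A SphereBundle.vec z v, e⟫ := fun v e => inner_neg_left _ _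
  have h4 : curvForm TX A T (antipode z).proj (dπ (antipode z) (dAntipode z u))
      (dπ (antipode z) (dAntipode z w)) e e' = curvForm TX A T z.proj (dπ z u) (dπ z w) e e' := by
    rw [h1, h2]; rfl
  rw [h4]
  change _ + ⟪(-pullbackDeriv A SphereBundle.vec z w : E z.proj), e⟫
    * ⟪(-pullbackDeriv A SphereBundle.vec z u : E z.proj), e'⟫
    - ⟪(-pullbackDeriv A SphereBundle.vec z u : E z.proj), e⟫
    * ⟪(-pullbackDeriv A SphereBundle.vec z w : E z.proj), e'⟫ = _
  simp only [h3]
  ring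

/-- The antipodal map preserves the curvature of `A_V` and reverses the orientation of `V`, so that
it changes the sign of the curvature form. -/
theorem isEigenform_kappaVal (A : MetricConnection E) :
    IsEigenform antipode (-1) (kappaVal T TX o A) := by
  intro z v
  have hs := adaptedBasis_inner_vec z (i := 1) (by decide)
  have ht := adaptedBasis_inner_vec z (i := 2) (by decide)
  have h1 := inducedCurv_eq_kappaVal T TX o A z (v 0) (v 1) hs ht
  have h2 := inducedCurv_eq_kappaVal T TX o A (antipode z) (dAntipode z (v 0)) (dAntipode z (v 1))
    (inner_vec_antipode hs) (inner_vec_antipode ht)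
  rw [inducedCurv_dAntipode, h1, area_antipode] at h2
  have hv : v = ![v 0, v 1] := by funext i; fin_cases i <;> rfl
  have hv' : (fun i => mfderiv I6 I6 antipode z (v i))
      = ![dAntipode z (v 0), dAntipode z (v 1)] := by funext i; fin_cases i <;> rfl
  rw [hv', hv]
  refine mul_left_cancel₀ (mul_ne_zero two_pi_ne (o.area_adaptedBasis_ne z)) ?_
  simp only [Matrix.cons_val_zero, Matrix.cons_val_one] at h2 ⊢
  linear_combination -h2

/-- The antipodal map preserves the pull back of `a` and reverses the orientation of `V`. -/
theorem isEigenform_velocity (a : SoForm E) :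
    IsEigenform antipode (-1) (velocity T TX o a).val := by
  intro z v
  have hs := adaptedBasis_inner_vec z (i := 1) (by decide)
  have ht := adaptedBasis_inner_vec z (i := 2) (by decide)
  have h1 := inner_eq_velocityVal o a z (v 0) hs ht
  have h2 := inner_eq_velocityVal o a (antipode z) (dAntipode z (v 0))
    (inner_vec_antipode hs) (inner_vec_antipode ht)
  rw [dπ_dAntipode T, area_antipode] at h2
  have h3 := h1.symm.trans h2
  change velocityVal o a (antipode z) (dAntipode z (v 0)) = -1 * velocityVal o a z (v 0)
  refine mul_left_cancel₀ (mul_ne_zero two_pi_ne (o.area_adaptedBasis_ne z)) ?_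
  linear_combination -h3

/-- A connection in `V` has at most one curvature form. -/
theorem eq_kappaVal (TZ : TangentFrame I6 (SphereBundle E)) {A : MetricConnection E}
    {κ : SmoothForm I6 (SphereBundle E) 2} (hκ : (inducedConnection T TX o A).IsCurvatureForm κ) :
    κ.val = kappaVal T TX o A := by
  funext z
  ext v
  obtain ⟨s, t, hne⟩ := exists_vsections T o z
  have h := hκ (TZ.extend z (v 0)) (TZ.extend z (v 1)) s t z
  rw [inner_curvature_induced T TX TZ, inducedCurv_eq_kappaVal T TX o A z _ _ (s.tangent z)
    (t.tangent z), TZ.extend_apply, TZ.extend_apply] at h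
  have hv : v = ![v 0, v 1] := by funext i; fin_cases i <;> rfl
  rw [hv]
  refine mul_left_cancel₀ (mul_ne_zero two_pi_ne hne) ?_
  linear_combination h

set_option maxRecDepth 10000 in
/-- The antipodal map reverses the orientation form `κ ∧ κ ∧ κ` and preserves `L a ∧ L b ∧ κ ∧ κ`,
as it changes the sign of each factor. -/
theorem omega_velocity_eq_zero (TZ : TangentFrame I6 (SphereBundle E)) (A : MetricConnection E)
    (h : (inducedConnection T TX o A).IsSymplectic) (a b : SoForm E) :
    SymplecticSpace.Omega (o := o) ⟨inducedConnection T TX o A, h⟩ (velocity T TX o a)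
      (velocity T TX o b) = 0 := by
  set κ := SymplecticSpace.omega (o := o) ⟨inducedConnection T TX o A, h⟩ with hκ
  have hκ' : IsEigenform antipode (-1) κ.val := by
    rw [eq_kappaVal T TX o TZ (show (inducedConnection T TX o A).IsCurvatureForm κ from
      h.choose_spec.1)]
    exact isEigenform_kappaVal T TX o A
  have ha := isEigenform_velocity T TX o a
  have hb := isEigenform_velocity T TX o b
  have hθ : IsEigenform antipode (-1) (κ.wedge (κ.wedge κ)).val := by
    rw [show (-1 : ℝ) = -1 * (-1 * -1) by norm_num]
    exact hκ'.wedge (hκ'.wedge hκ')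
  have hη : IsEigenform antipode 1
      ((velocity T TX o a).wedge ((velocity T TX o b).wedge (κ.wedge κ))).val := by
    rw [show (1 : ℝ) = -1 * (-1 * (-1 * -1)) by norm_num]
    exact ha.wedge (hb.wedge (hκ'.wedge hκ'))
  have : (MeasureTheory.volume : MeasureTheory.Measure (Coord4 × Coord2)).IsAddHaarMeasure :=
    MeasureTheory.Measure.prod.instIsAddHaarMeasure _ _
  unfold SymplecticSpace.Omega
  refine mul_eq_zero_of_right _ ?_
  simp only [← hκ]
  refine integralForm_eq_zero basis6 ?_ ?_ T.contMDiff_antipode antipode_antipode ?_ ?_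
  · exact continuousOn_coordCoeff basis6 TZ (κ.wedge (κ.wedge κ))
  · exact continuousOn_coordCoeff basis6 TZ
      ((velocity T TX o a).wedge ((velocity T TX o b).wedge (κ.wedge κ)))
  · exact hθ
  · exact hη

end Antipode

end Definite
end

theorem mainTheorem11 {X : Type*} [TopologicalSpace X] [CompactSpace X] [T2Space X]
    [ChartedSpace Coord4 X] [IsManifold (𝓡 4) ∞ X]
    (E : X → Type*) [TopologicalSpace (TotalSpace Fib E)]
    [∀ x, NormedAddCommGroup (E x)] [∀ x, InnerProductSpace ℝ (E x)]
    [FiberBundle Fib E] [VectorBundle ℝ Fib E] [ContMDiffVectorBundle ∞ Fib E (𝓡 4)]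
    [IsContMDiffRiemannianBundle (𝓡 4) ∞ Fib E] (o : FibreOrientation E) :
    ∃ Φ : MetricConnection E → UnitaryConnection o,
      (∀ A, IsInduced A (Φ A)) ∧
      ∃ hΦ : ∀ A, A.IsDefinite → (Φ A).IsSymplectic,
        Topology.IsEmbedding
          (fun A : DefiniteSpace E => (⟨Φ A, hΦ A A.2⟩ : SymplecticSpace o)) ∧
        ∀ (A : MetricConnection E) (hA : A.IsDefinite),
          ∃ L : SoForm E → SmoothForm I6 (SphereBundle E) 1,
            (∀ a, UnitaryConnection.HasVelocity (fun r => Φ (A.translate r a)) (L a)) ∧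
            Function.Injective L ∧
            ∀ a b : SoForm E,
              SymplecticSpace.Omega (o := o) ⟨Φ A, hΦ A hA⟩ (L a) (L b) = 0 := by
  obtain ⟨T⟩ := exists_bundleFrame E
  obtain ⟨TX⟩ := exists_tangentFrame (𝓡 4) X
  obtain ⟨TZ⟩ := exists_tangentFrame I6 (SphereBundle E)
  have hΦ := isSymplectic_inducedConnection T TX TZ o
  exact ⟨inducedConnection T TX o, isInduced_inducedConnection T TX o, hΦ,
    isEmbedding_definite T TX TZ o hΦ, fun A hA => ⟨velocity T TX o,
      hasVelocity_velocity T TX o A, velocity_injective T TX o,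
      omega_velocity_eq_zero T TX o TZ A (hΦ A hA)⟩⟩
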